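/- All systems are finite-dimensional with fixed orthonormal bases. Let $\mathcal N^{A'\to BC}$ be a quantum broadcast channel, i.e. a completely positive trace-preserving map with non-zero input space $A'$ controlled by Alice and outputs $B$ (Bob) and $C$ (Charlie). Write $\phi$ for the maximally entangled state (EPR pair) of the indicated dimension and $\widetilde N^{A'BC}=(\mathrm{id}^{A'}\otimes\mathcal N)(\phi^{A'\widetilde A'})$ for the Choi state of $\mathcal N$. *PPT-preserving operations.* A tripartite channel $\mathcal Y^{ABC\to A'B'C'}$ (Alice holds $A,A'$; Bob $B,B'$; Charlie $C,C'$) is PPT-preserving if its Choi matrix $Y$ satisfies $Y^{T_{AA'}}\ge 0$, $Y^{T_{BB'}}\ge 0$ and $Y^{T_{CC'}}\ge 0$. *Combing.* For a tripartite state $\rho^{A'BC}$ and integers $r_1=|A_1|=|B'|$, $r_2=|A_2|=|C'|$, a PPT-preserving operation $\mathcal Y^{A'BC\to A_1A_2B'C'}$ has combing fidelity $\operatorname{Tr}\big[\phi^{A_1B'}\phi^{A_2C'}\,\mathcal Y(\rho)\big]$; $F_\Gamma^{\mathrm{PPT}}(\rho,r_1,r_2)$ is the supremum of this over all such $\mathcal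 Y$, and $$D_\Gamma^{\mathrm{PPT}}(\rho)=\sup\Big\{R_1+R_2:\ R_1,R_2\ge 0,\ \lim_{n\to\infty}F_\Gamma^{\mathrm{PPT}}\big(\rho^{\otimes n},\lfloor 2^{nR_1}\rfloor,\lfloor 2^{nR_2}\rfloor\big)=1\Big\}.$$ *Codes.* A forward-assisted code of size $(r_1,r_2)$ for $\mathcal N$ consists of an encoding isometry $\mathcal E^{A_1A_2\to A'R}$ ($R$ of any finite dimension) and a joint decoding channel $\mathcal D^{RBC\to B'C'}$, where $|A_1|=|B'|=r_1$ and $|A_2|=|C'|=r_2$. It is PPT-preserving if the tripartite operation $\mathcal D\circ\mathcal E:(A_1A_2)BC\to A'B'C'$ is. Its induced channel is $\mathcal M=\mathcal D\circ\mathcal N\circ\mathcal E$, and its channel fidelity is $\operatorname{Tr}\big[\phi^{\widetilde A_1B'}\phi^{\widetilde A_2C'}\,\mathcal M(\phi^{\widetilde A_1A_1}\phi^{\widetilde A_2A_2})\big]$; $F^{\mathrm{PPT}}(\mathcal N,r_1,r_2)$ is the supremum of this over all PPT-preserving codes of size $(r_1,r_2)$. Put $$Q_1^{\mathrm{PPT}}(\mathcal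 N,\varepsilon)=\sup\{\log_2 r_1+\log_2 r_2:\ r_1,r_2\ge 1,\ F^{\mathrm{PPT}}(\mathcal N,r_1,r_2)\ge 1-\varepsilon\},$$ $$Q^{\mathrm{PPT}}(\mathcal N)=\lim_{\varepsilon\to 0^+}\lim_{n\to\infty}\tfrac1n Q_1^{\mathrm{PPT}}(\mathcal N^{\otimes n},\varepsilon),$$ where the inner limit may be read as $\liminf_n$ or as $\limsup_n$. (Capacities, rates and these limits are taken in the extended reals.) *Teleportation simulability.* $\mathcal N$ can be exactly simulated from one copy of its Choi state with forward classical communication if there are a POVM $\{O_{l_1l_2}\}$ with finitely many outcomes on $\widetilde A'A'$ and channels $\mathcal V_{1,l_1}$ on $B$, $\mathcal V_{2,l_2}$ on $C$ such that for all operators $X$ on $\widetilde A'\cong A'$ $$\mathcal N(X)=\sum_{l_1,l_2}(\mathcal V_{1,l_1}\otimes\mathcal V_{2,l_2})\Big(\operatorname{Tr}_{\widetilde A'A'}\big[(O_{l_1l_2}\otimes 1^{BC})(X^{\widetilde A'}\otimes\widetilde N^{A'BC})\big]\Big).$$ **Proposition.** (i) Let $r_1,r_2\ge 1$. For every PPT-preserving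 operation $\mathcal Y^{A'BC\to A_1A_2B'C'}$ that has combing fidelity $f$ on $\widetilde N^{A'BC}$ there is a PPT-preserving code of size $(r_1,r_2)$ for $\mathcal N$ with channel fidelity $f$. Consequently $$F^{\mathrm{PPT}}(\mathcal N,r_1,r_2)\ \ge\ F_\Gamma^{\mathrm{PPT}}(\widetilde N^{A'BC},r_1,r_2).$$ (ii) Suppose that $\mathcal N$ can be exactly simulated from one copy of its Choi state with forward classical communication. Then, for all $r_1,r_2\ge 1$, conversely every PPT-preserving code of size $(r_1,r_2)$ with channel fidelity $f$ yields a PPT-preserving operation $\mathcal Y^{A'BC\to A_1A_2B'C'}$ with combing fidelity $f$ on $\widetilde N^{A'BC}$, and therefore $$F^{\mathrm{PPT}}(\mathcal N,r_1,r_2)=F_\Gamma^{\mathrm{PPT}}(\widetilde N^{A'BC},r_1,r_2).$$ Moreover $$Q^{\mathrm{PPT}}(\mathcal N)=D_\Gamma^{\mathrm{PPT}}(\widetilde N^{A'BC}),$$ that is, the limit $\varepsilon\to0^+$ exists and equals $D_\Gamma^{\mathrm{PPT}}(\widetilde N^{A'BC})$, both with $\liminf_n$ and with $\limsup_n$ as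 the inner limit. -/

import Mathlib

open scoped ComplexOrder Kronecker
open Filter Topology

namespace BroadcastCode

noncomputable section

/-! ### Quantum channels

A finite-dimensional system is given by a finite type indexing its standard basis, an operator on it
by a square matrix, and a map between operators by a `ℂ`-linear map. Composite systems are indexed by
product types. -/

variable {a b c a' b' c' k : Type*}

/-- `id ⊗ Φ`, where the identity acts on a system with basis `k`: the map `Φ` is applied blockwise. -/
def idTensor (k : Type*) (Φ : Matrix a a ℂ →ₗ[ℂ] Matrix b b ℂ) :
    Matrix (k × a) (k × a) ℂ →ₗ[ℂ] Matrix (k × b) (k × b) ℂ where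
  toFun X := Matrix.of fun p q => Φ (Matrix.of fun i j => X (p.1, i) (q.1, j)) p.2 q.2
  map_add' X Y := by
    ext p q
    exact congrFun₂ (map_add Φ (Matrix.of fun i j => X (p.1, i) (q.1, j))
      (Matrix.of fun i j => Y (p.1, i) (q.1, j))) p.2 q.2
  map_smul' z X := by
    ext p q
    exact congrFun₂ (map_smul Φ z (Matrix.of fun i j => X (p.1, i) (q.1, j))) p.2 q.2

/-- Relabelling of the basis of a system. -/
def relabel (e : a ≃ b) : Matrix a a ℂ →ₗ[ℂ] Matrix b b ℂ :=
  (Matrix.reindexLinearEquiv ℂ ℂ e e).toLinearMap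

/-- `Φ ⊗ id`, where the identity acts on a system with basis `k`. -/
def tensorId (Φ : Matrix a a ℂ →ₗ[ℂ] Matrix b b ℂ) (k : Type*) :
    Matrix (a × k) (a × k) ℂ →ₗ[ℂ] Matrix (b × k) (b × k) ℂ :=
  relabel (Equiv.prodComm k b) ∘ₗ idTensor k Φ ∘ₗ relabel (Equiv.prodComm a k)

/-- `Φ ⊗ Ψ`. -/
def tensorMap (Φ : Matrix a a ℂ →ₗ[ℂ] Matrix a' a' ℂ) (Ψ : Matrix b b ℂ →ₗ[ℂ] Matrix b' b' ℂ) :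
    Matrix (a × b) (a × b) ℂ →ₗ[ℂ] Matrix (a' × b') (a' × b') ℂ :=
  idTensor a' Ψ ∘ₗ tensorId Φ b

/-- A quantum channel: a completely positive and trace-preserving linear map. -/
structure IsChannel [Fintype a] [Fintype b] (Φ : Matrix a a ℂ →ₗ[ℂ] Matrix b b ℂ) : Prop where
  completelyPositive : ∀ (m : ℕ) (X : Matrix (Fin m × a) (Fin m × a) ℂ),
    X.PosSemidef → (idTensor (Fin m) Φ X).PosSemidef
  tracePreserving : ∀ X : Matrix a a ℂ, (Φ X).trace = X.trace

/-! ### Maximally entangled states and Choi operators -/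

/-- The unnormalized maximally entangled operator `∑ i j, |i i⟩⟨j j|`. -/
def eprUnnormalized (a : Type*) [DecidableEq a] : Matrix (a × a) (a × a) ℂ :=
  Matrix.of fun p q => if p.1 = p.2 ∧ q.1 = q.2 then 1 else 0

/-- The EPR pair (maximally entangled state) `φ`. -/
def epr (a : Type*) [Fintype a] [DecidableEq a] : Matrix (a × a) (a × a) ℂ :=
  (Fintype.card a : ℂ)⁻¹ • eprUnnormalized a

/-- The Choi matrix `(id ⊗ Φ)(∑ i j, |i i⟩⟨j j|)`. -/
def choiMatrix [DecidableEq a] (Φ : Matrix a a ℂ →ₗ[ℂ] Matrix b b ℂ) :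
    Matrix (a × b) (a × b) ℂ :=
  idTensor a Φ (eprUnnormalized a)

/-- The Choi state `(id ⊗ Φ)(φ)`. -/
def choiState [Fintype a] [DecidableEq a] (Φ : Matrix a a ℂ →ₗ[ℂ] Matrix b b ℂ) :
    Matrix (a × b) (a × b) ℂ :=
  idTensor a Φ (epr a)

/-- The two EPR pairs `φ^{A₁B'} ⊗ φ^{A₂C'}` of dimensions `r₁` and `r₂`, as an operator on
`(A₁A₂)(B'C')`. -/
def eprPair (r₁ r₂ : ℕ) :
    Matrix ((Fin r₁ × Fin r₂) × (Fin r₁ × Fin r₂)) ((Fin r₁ × Fin r₂) × (Fin r₁ × Fin r₂)) ℂ :=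
  Matrix.of fun p q =>
    epr (Fin r₁) (p.1.1, p.2.1) (q.1.1, q.2.1) * epr (Fin r₂) (p.1.2, p.2.2) (q.1.2, q.2.2)

/-- The fidelity `Tr (φ^{A₁B'} ⊗ φ^{A₂C'}) σ` of a state `σ` on `(A₁A₂)(B'C')`. -/
def eprFidelity {r₁ r₂ : ℕ}
    (σ : Matrix ((Fin r₁ × Fin r₂) × (Fin r₁ × Fin r₂)) ((Fin r₁ × Fin r₂) × (Fin r₁ × Fin r₂)) ℂ) :
    ℝ :=
  (eprPair r₁ r₂ * σ).trace.re

/-! ### PPT-preserving tripartite operations -/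

/-- Partial transpose on Alice's input and output of an operator on `(ABC)(A'B'C')`. -/
def transposeA (M : Matrix ((a × b × c) × (a' × b' × c')) ((a × b × c) × (a' × b' × c')) ℂ) :
    Matrix ((a × b × c) × (a' × b' × c')) ((a × b × c) × (a' × b' × c')) ℂ :=
  Matrix.of fun p q =>
    M ((q.1.1, p.1.2.1, p.1.2.2), (q.2.1, p.2.2.1, p.2.2.2))
      ((p.1.1, q.1.2.1, q.1.2.2), (p.2.1, q.2.2.1, q.2.2.2))

/-- Partial transpose on Bob's input and output of an operator on `(ABC)(A'B'C')`. -/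
def transposeB (M : Matrix ((a × b × c) × (a' × b' × c')) ((a × b × c) × (a' × b' × c')) ℂ) :
    Matrix ((a × b × c) × (a' × b' × c')) ((a × b × c) × (a' × b' × c')) ℂ :=
  Matrix.of fun p q =>
    M ((p.1.1, q.1.2.1, p.1.2.2), (p.2.1, q.2.2.1, p.2.2.2))
      ((q.1.1, p.1.2.1, q.1.2.2), (q.2.1, p.2.2.1, q.2.2.2))

/-- Partial transpose on Charlie's input and output of an operator on `(ABC)(A'B'C')`. -/
def transposeC (M : Matrix ((a × b × c) × (a' × b' × c')) ((a × b × c) × (a' × b' × c')) ℂ) :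
    Matrix ((a × b × c) × (a' × b' × c')) ((a × b × c) × (a' × b' × c')) ℂ :=
  Matrix.of fun p q =>
    M ((p.1.1, p.1.2.1, q.1.2.2), (p.2.1, p.2.2.1, q.2.2.2))
      ((q.1.1, q.1.2.1, p.1.2.2), (q.2.1, q.2.2.1, p.2.2.2))

/-- A tripartite channel `ABC → A'B'C'` is PPT-preserving if its Choi matrix has a positive partial
transpose with respect to each of the cuts `A|BC`, `B|AC`, `C|AB`. -/
structure IsPPTPreserving [Fintype a] [Fintype b] [Fintype c] [Fintype a'] [Fintype b'] [Fintype c']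
    [DecidableEq a] [DecidableEq b] [DecidableEq c]
    (Y : Matrix (a × b × c) (a × b × c) ℂ →ₗ[ℂ] Matrix (a' × b' × c') (a' × b' × c') ℂ) :
    Prop where
  isChannel : IsChannel Y
  pptA : (transposeA (choiMatrix Y)).PosSemidef
  pptB : (transposeB (choiMatrix Y)).PosSemidef
  pptC : (transposeC (choiMatrix Y)).PosSemidef

/-! ### Entanglement combing -/

/-- The optimal entanglement combing fidelity of a state `ρ` on `A'BC` under PPT-preserving
operations `A'BC → (A₁A₂)B'C'`. -/
def combingFidelity [Fintype a] [Fintype b] [Fintype c]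
    [DecidableEq a] [DecidableEq b] [DecidableEq c]
    (ρ : Matrix (a × b × c) (a × b × c) ℂ) (r₁ r₂ : ℕ) : ℝ :=
  sSup {f : ℝ | ∃ Y : Matrix (a × b × c) (a × b × c) ℂ →ₗ[ℂ]
      Matrix ((Fin r₁ × Fin r₂) × Fin r₁ × Fin r₂) ((Fin r₁ × Fin r₂) × Fin r₁ × Fin r₂) ℂ,
    IsPPTPreserving Y ∧ f = eprFidelity (Y ρ)}

/-- `ρ^{⊗ n}` for a tripartite state, regrouped as an operator on `AⁿBⁿCⁿ`. -/
def statePow (ρ : Matrix (a × b × c) (a × b × c) ℂ) (n : ℕ) :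
    Matrix ((Fin n → a) × (Fin n → b) × (Fin n → c)) ((Fin n → a) × (Fin n → b) × (Fin n → c)) ℂ :=
  Matrix.of fun p q => ∏ i, ρ (p.1 i, p.2.1 i, p.2.2 i) (q.1 i, q.2.1 i, q.2.2 i)

/-- The asymptotic sum-rate of PPT-preserving entanglement combing. The supremum is taken in the
extended reals. -/
def combingSumRate [Fintype a] [Fintype b] [Fintype c]
    [DecidableEq a] [DecidableEq b] [DecidableEq c]
    (ρ : Matrix (a × b × c) (a × b × c) ℂ) : EReal :=
  sSup {s : EReal | ∃ R₁ R₂ : ℝ, 0 ≤ R₁ ∧ 0 ≤ R₂ ∧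
    Tendsto (fun n : ℕ => combingFidelity (statePow ρ n)
      ⌊(2 : ℝ) ^ ((n : ℝ) * R₁)⌋₊ ⌊(2 : ℝ) ^ ((n : ℝ) * R₂)⌋₊) atTop (𝓝 1) ∧
    s = ((R₁ + R₂ : ℝ) : EReal)}

/-! ### Codes for a broadcast channel -/

/-- The map `X ↦ V X V†`. -/
def conjBy [Fintype a] (V : Matrix b a ℂ) : Matrix a a ℂ →ₗ[ℂ] Matrix b b ℂ where
  toFun X := V * X * V.conjTranspose
  map_add' X Y := by rw [Matrix.mul_add, Matrix.add_mul]
  map_smul' z X := by simp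

/-- A forward-assisted code of size `(r₁, r₂)` for a broadcast channel `A' → BC`: an encoding isometry
`A₁A₂ → A'R` of Alice, and a joint decoding channel `RBC → B'C'` of Bob and Charlie, where the system
`R`, of arbitrary finite dimension `dimR`, is sent from Alice to Bob and Charlie noiselessly. -/
structure ForwardAssistedCode (a b c : Type*) [Fintype a] [Fintype b] [Fintype c] [DecidableEq a]
    (r₁ r₂ : ℕ) where
  dimR : ℕ
  encoder : Matrix (a × Fin dimR) (Fin r₁ × Fin r₂) ℂ
  encoder_isometry : encoder.conjTranspose * encoder = 1
  decoder : Matrix (Fin dimR × b × c) (Fin dimR × b × c) ℂ →ₗ[ℂ]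
    Matrix (Fin r₁ × Fin r₂) (Fin r₁ × Fin r₂) ℂ
  decoder_isChannel : IsChannel decoder

namespace ForwardAssistedCode

variable [Fintype a] [Fintype b] [Fintype c] [DecidableEq a] {r₁ r₂ : ℕ}

/-- The tripartite operation `(A₁A₂)BC → A'B'C'` of the code: encode `A₁A₂` into `A'R`, output `A'`,
and decode `RBC`. -/
def operation (Z : ForwardAssistedCode a b c r₁ r₂) :
    Matrix ((Fin r₁ × Fin r₂) × b × c) ((Fin r₁ × Fin r₂) × b × c) ℂ →ₗ[ℂ]
      Matrix (a × Fin r₁ × Fin r₂) (a × Fin r₁ × Fin r₂) ℂ :=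
  idTensor a Z.decoder ∘ₗ relabel (Equiv.prodAssoc a (Fin Z.dimR) (b × c)) ∘ₗ
    tensorId (conjBy Z.encoder) (b × c)

/-- The channel `A₁A₂ → B'C'` induced by the code and the broadcast channel `N`: encode `A₁A₂` into
`A'R`, apply `N` to `A'`, and decode `RBC`. -/
def inducedChannel (Z : ForwardAssistedCode a b c r₁ r₂)
    (N : Matrix a a ℂ →ₗ[ℂ] Matrix (b × c) (b × c) ℂ) :
    Matrix (Fin r₁ × Fin r₂) (Fin r₁ × Fin r₂) ℂ →ₗ[ℂ]
      Matrix (Fin r₁ × Fin r₂) (Fin r₁ × Fin r₂) ℂ :=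
  Z.decoder ∘ₗ idTensor (Fin Z.dimR) N ∘ₗ relabel (Equiv.prodComm a (Fin Z.dimR)) ∘ₗ
    conjBy Z.encoder

/-- The channel fidelity of the code: the fidelity with two EPR pairs of the state obtained by sending
halves of two EPR pairs through the induced channel. -/
def fidelity (Z : ForwardAssistedCode a b c r₁ r₂)
    (N : Matrix a a ℂ →ₗ[ℂ] Matrix (b × c) (b × c) ℂ) : ℝ :=
  eprFidelity (idTensor (Fin r₁ × Fin r₂) (Z.inducedChannel N) (eprPair r₁ r₂))

end ForwardAssistedCode

/-- The maximum channel fidelity of `N` over PPT-preserving codes of size `(r₁, r₂)`. -/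
def codeFidelity [Fintype a] [Fintype b] [Fintype c]
    [DecidableEq a] [DecidableEq b] [DecidableEq c]
    (N : Matrix a a ℂ →ₗ[ℂ] Matrix (b × c) (b × c) ℂ) (r₁ r₂ : ℕ) : ℝ :=
  sSup {f : ℝ | ∃ Z : ForwardAssistedCode a b c r₁ r₂,
    IsPPTPreserving Z.operation ∧ f = Z.fidelity N}

/-- The `ε`-one-shot sum-capacity of `N` (in qubits) assisted by PPT-preserving codes. The supremum is
taken in the extended reals. -/
def oneShotSumCapacity [Fintype a] [Fintype b] [Fintype c]
    [DecidableEq a] [DecidableEq b] [DecidableEq c]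
    (N : Matrix a a ℂ →ₗ[ℂ] Matrix (b × c) (b × c) ℂ) (ε : ℝ) : EReal :=
  sSup {s : EReal | ∃ r₁ r₂ : ℕ, 0 < r₁ ∧ 0 < r₂ ∧ 1 - ε ≤ codeFidelity N r₁ r₂ ∧
    s = ((Real.logb 2 r₁ + Real.logb 2 r₂ : ℝ) : EReal)}

/-- `N^{⊗ n}` for a broadcast channel, regrouped as a map from operators on `A'ⁿ` to operators on
`BⁿCⁿ`; on matrix units it is `|x⟩⟨x'| ↦ ⨂ i, N |x i⟩⟨x' i|`. -/
def channelPow [Fintype a] [DecidableEq a]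
    (N : Matrix a a ℂ →ₗ[ℂ] Matrix (b × c) (b × c) ℂ) (n : ℕ) :
    Matrix (Fin n → a) (Fin n → a) ℂ →ₗ[ℂ]
      Matrix ((Fin n → b) × (Fin n → c)) ((Fin n → b) × (Fin n → c)) ℂ where
  toFun X := Matrix.of fun p q => ∑ x : Fin n → a, ∑ x' : Fin n → a,
    X x x' * ∏ i, N (Matrix.single (x i) (x' i) 1) (p.1 i, p.2 i) (q.1 i, q.2 i)
  map_add' X Y := by
    ext p q
    simp [add_mul, Finset.sum_add_distrib]
  map_smul' z X := by
    ext p q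
    simp [Finset.mul_sum, mul_assoc]

/-- `q` is the asymptotic sum-capacity `lim_{ε → 0} lim_{n → ∞} (1/n) Q₁(N^{⊗ n}, ε)` of `N` assisted by
PPT-preserving codes. As the inner limit is not known to exist for a fixed `ε`, the
outer limit is required to be `q` both with the lower and with the upper inner limit. -/
def HasAsymptoticSumCapacity [Fintype a] [Fintype b] [Fintype c]
    [DecidableEq a] [DecidableEq b] [DecidableEq c]
    (N : Matrix a a ℂ →ₗ[ℂ] Matrix (b × c) (b × c) ℂ) (q : EReal) : Prop :=
  Tendsto (fun ε : ℝ => liminf (fun n : ℕ => oneShotSumCapacity (channelPow N n) ε / (n : EReal))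
      atTop) (𝓝[>] 0) (𝓝 q) ∧
    Tendsto (fun ε : ℝ => limsup (fun n : ℕ => oneShotSumCapacity (channelPow N n) ε / (n : EReal))
      atTop) (𝓝[>] 0) (𝓝 q)

/-! ### Teleportation simulation -/

/-- Measuring the systems `Ã'A'` of the state `X^{Ã'} ⊗ ρ^{A'B}` with the effect `O` on `Ã'A'`: the
unnormalized state `Tr_{Ã'A'} [(O ⊗ 1)(X ⊗ ρ)]` of the remaining system `B`. -/
def measureOut [Fintype a] (O : Matrix (a × a) (a × a) ℂ) (X : Matrix a a ℂ)
    (ρ : Matrix (a × b) (a × b) ℂ) : Matrix b b ℂ :=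
  Matrix.of fun y y' => ∑ s : a × a, ∑ t : a × a, O s t * (X t.1 s.1 * ρ (t.2, y) (s.2, y'))

/-- `N` can be simulated exactly from one copy of its Choi state and forward classical communication:
Alice measures the channel input together with her share of the Choi state by a POVM `O` with outcomes
`(l₁, l₂)`, sends `l₁` to Bob and `l₂` to Charlie, and they apply channels `V₁ l₁` and `V₂ l₂` to
their shares. -/
def IsTeleportationSimulable [Fintype a] [Fintype b] [Fintype c] [DecidableEq a]
    (N : Matrix a a ℂ →ₗ[ℂ] Matrix (b × c) (b × c) ℂ) : Prop :=
  ∃ (m₁ m₂ : ℕ) (O : Fin m₁ → Fin m₂ → Matrix (a × a) (a × a) ℂ)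
    (V₁ : Fin m₁ → (Matrix b b ℂ →ₗ[ℂ] Matrix b b ℂ))
    (V₂ : Fin m₂ → (Matrix c c ℂ →ₗ[ℂ] Matrix c c ℂ)),
    (∀ l₁ l₂, (O l₁ l₂).PosSemidef) ∧ (∑ l₁, ∑ l₂, O l₁ l₂ = 1) ∧
    (∀ l₁, IsChannel (V₁ l₁)) ∧ (∀ l₂, IsChannel (V₂ l₂)) ∧
    ∀ X : Matrix a a ℂ, N X =
      ∑ l₁, ∑ l₂, tensorMap (V₁ l₁) (V₂ l₂) (measureOut (O l₁ l₂) X (choiState N))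

end

end BroadcastCode

open BroadcastCode

namespace BroadcastCode

noncomputable section

/-! ### Entrywise criteria for positivity -/

/-! Everything is done on Choi matrices. Composing maps means contracting shared indices, and
contracting an entrywise product of positive matrices gives a positive matrix, by the Schur product
theorem. If every index is assigned to a party, the operators all of whose partial transposes are
positive (`IsPPT`) are stable under such contractions (`IsPPT.link`). For every operation built from
others it then suffices to check the ingredients and trace preservation.

Part (i). Alice sends half of a local EPR pair into `N` and forwards the other half with her
message. The decoder applies `Y` to the resulting Choi state, twirls the output and teleports the
message through it. On Choi matrices, teleportation turns Alice's output index of the twirled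
operation into an input index. This is legitimate because the twirled state has a maximally mixed
marginal, and it respects the PPT conditions because both roles belong to Alice. Twirling leaves the
EPR fidelity unchanged (`fidelity_combingCode`).

Part (ii). Teleportation simulation writes the Choi matrix of `N` as the Choi state contracted with
a PPT kernel (`IsSimulationKernel`). Running the code on halves of local EPR pairs with this kernel
in place of `N` is a combing operation whose output is the normalized Choi matrix of the induced
channel. Both conversions keep the fidelity, so the two suprema agree. Kernels tensorize, so they
agree for all powers of `N` as well.

Asymptotics. A combing rate with vanishing error satisfies every `ε`, which bounds the capacity from
below. The converse must turn a small but fixed error, available at infinitely many block lengths,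
into a vanishing one (`exists_le_combingSumRate`). For this, `k` blocks are combed independently,
and for each receiver one tests that at most `t = k / M` of the `k` pairs fail to be EPR. By Rains'
criterion an effect `E` can be converted by a PPT operation into an EPR pair of dimension `d` once
`-1 ≤ d E^Γ ≤ 1`. Here `E^Γ` is bounded by `4 ^ k * r ^ (-(k - t))`, so `d` may be nearly `r ^ k` up
to a factor exponential in `k`. The test fails with probability at most `2 ^ k * η ^ (t + 1) ≤ 2 ^
(-k)` when `η ≤ 4 ^ (-M)`. The loss in rate is of order `1 / M + 1 / n` and disappears for large `M`
and `n`. -/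

theorem posSemidef_contract {p m : Type*} [Fintype p] [Fintype m]
    {G : Matrix (p × m) (p × m) ℂ} (hG : G.PosSemidef) :
    (Matrix.of fun i j => ∑ k, ∑ l, G (i, k) (j, l) : Matrix p p ℂ).PosSemidef := by
  classical
  -- The contraction is a compression `W G W†`, with `W` the identity on `p` times the all-ones row
  -- on `m`.
  let W : Matrix p (p × m) ℂ := Matrix.of fun i x => if x.1 = i then 1 else 0
  have h := hG.mul_mul_conjTranspose_same W
  have hl (i : p) (y : p × m) : (W * G) i y = ∑ k, G (i, k) y := by
    simp only [W, Matrix.mul_apply, Matrix.of_apply, Fintype.sum_prod_type, ite_mul, one_mul,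
      zero_mul]
    rw [Finset.sum_comm]
    simp
  have hW : W * G * W.conjTranspose = Matrix.of fun i j => ∑ k, ∑ l, G (i, k) (j, l) := by
    ext i j
    rw [Matrix.mul_apply]
    simp only [hl]
    simp only [W, Matrix.of_apply, Matrix.conjTranspose_apply,
      Fintype.sum_prod_type, apply_ite star, star_one, star_zero, mul_ite, mul_one, mul_zero]
    rw [Finset.sum_comm]
    simp only [Finset.sum_ite_eq', Finset.mem_univ, if_true]
    rw [Finset.sum_comm]
  exact hW ▸ h

theorem posSemidef_const_one {p : Type*} :
    (Matrix.of fun _ _ => 1 : Matrix p p ℂ).PosSemidef := by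
  have h := (Matrix.PosSemidef.one (n := Unit) (R := ℂ)).submatrix (fun _ : p => ())
  have he : Matrix.submatrix (1 : Matrix Unit Unit ℂ) (fun _ : p => ()) (fun _ => ()) =
      (Matrix.of fun _ _ => 1 : Matrix p p ℂ) := by
    ext
    simp
  exact he ▸ h

theorem posSemidef_mul_entries {p : Type*} {A B : Matrix p p ℂ} (hA : A.PosSemidef)
    (hB : B.PosSemidef) : (Matrix.of fun x y => A x y * B x y : Matrix p p ℂ).PosSemidef :=
  hA.hadamard hB

theorem posSemidef_finset_prod {p ι : Type*} (s : Finset ι)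
    {M : ι → Matrix p p ℂ} (hM : ∀ i ∈ s, (M i).PosSemidef) :
    (Matrix.of fun x y => ∏ i ∈ s, M i x y : Matrix p p ℂ).PosSemidef := by
  classical
  induction s using Finset.induction_on with
  | empty => simpa using posSemidef_const_one
  | insert i s hi ih =>
    simp only [Finset.prod_insert hi]
    exact posSemidef_mul_entries (hM i (Finset.mem_insert_self i s))
      (ih fun j hj => hM j (Finset.mem_insert_of_mem hj))

theorem posSemidef_pi {ι : Type*} [Fintype ι] {d : Type*} {M : ι → Matrix d d ℂ}
    (hM : ∀ i, (M i).PosSemidef) :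
    (Matrix.of fun (x : ι → d) (y : ι → d) => ∏ i, M i (x i) (y i)).PosSemidef :=
  posSemidef_finset_prod (M := fun i => (M i).submatrix (fun x : ι → d => x i) fun x => x i) _
    fun i _ => (hM i).submatrix fun x : ι → d => x i

/-! ### Tripartite operators whose partial transposes are all positive -/

section PPT

variable {α β γ α' β' γ' μ ν κ : Type*}

/-- The partial transpose on the parties selected by `s₁`, `s₂`, `s₃`. -/
def partialTranspose (s₁ s₂ s₃ : Bool) (M : Matrix (α × β × γ) (α × β × γ) ℂ) :
    Matrix (α × β × γ) (α × β × γ) ℂ :=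
  Matrix.of fun p q =>
    M (cond s₁ q.1 p.1, cond s₂ q.2.1 p.2.1, cond s₃ q.2.2 p.2.2)
      (cond s₁ p.1 q.1, cond s₂ p.2.1 q.2.1, cond s₃ p.2.2 q.2.2)

/-- All partial transposes of a tripartite operator are positive semidefinite. -/
def IsPPT (M : Matrix (α × β × γ) (α × β × γ) ℂ) : Prop :=
  ∀ s₁ s₂ s₃, (partialTranspose s₁ s₂ s₃ M).PosSemidef

theorem IsPPT.posSemidef {M : Matrix (α × β × γ) (α × β × γ) ℂ} (hM : IsPPT M) : M.PosSemidef :=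
  hM false false false

/-- Complementary choices of transposed parties differ by a full transpose, which preserves
positivity, so four of the eight conditions suffice. -/
theorem isPPT_of_posSemidef {M : Matrix (α × β × γ) (α × β × γ) ℂ} (h : M.PosSemidef)
    (hA : (partialTranspose true false false M).PosSemidef)
    (hB : (partialTranspose false true false M).PosSemidef)
    (hC : (partialTranspose false false true M).PosSemidef) : IsPPT M := by
  intro s₁ s₂ s₃
  cases s₁ <;> cases s₂ <;> cases s₃
  · exact h
  · exact hC
  · exact hB
  · exact hA.transpose
  · exact hA
  · exact hB.transpose
  · exact hC.transpose
  · exact h.transpose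

theorem IsPPT.hadamard [Fintype α] [Fintype β] [Fintype γ]
    {M M' : Matrix (α × β × γ) (α × β × γ) ℂ} (hM : IsPPT M) (hM' : IsPPT M') :
    IsPPT (Matrix.of fun p q => M p q * M' p q) := fun s₁ s₂ s₃ =>
  (hM s₁ s₂ s₃).hadamard (hM' s₁ s₂ s₃)

theorem IsPPT.submatrix {M : Matrix (α × β × γ) (α × β × γ) ℂ} (hM : IsPPT M)
    (f : α' → α) (g : β' → β) (h : γ' → γ) :
    IsPPT (Matrix.of fun p q : α' × β' × γ' =>
      M (f p.1, g p.2.1, h p.2.2) (f q.1, g q.2.1, h q.2.2)) := by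
  intro s₁ s₂ s₃
  have := (hM s₁ s₂ s₃).submatrix fun p : α' × β' × γ' => (f p.1, g p.2.1, h p.2.2)
  convert this using 1
  ext p q
  cases s₁ <;> cases s₂ <;> cases s₃ <;> rfl

theorem IsPPT.sum {ι : Type*} (s : Finset ι) {M : ι → Matrix (α × β × γ) (α × β × γ) ℂ}
    (hM : ∀ i ∈ s, IsPPT (M i)) : IsPPT (∑ i ∈ s, M i) := by
  intro s₁ s₂ s₃
  have := Matrix.posSemidef_sum s fun i hi => hM i hi s₁ s₂ s₃
  convert this using 1
  ext p q
  simp [partialTranspose, Matrix.sum_apply]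

theorem IsPPT.smul {M : Matrix (α × β × γ) (α × β × γ) ℂ} (hM : IsPPT M) {z : ℂ} (hz : 0 ≤ z) :
    IsPPT (z • M) := fun s₁ s₂ s₃ => (hM s₁ s₂ s₃).smul hz

theorem IsPPT.pi [Fintype α] [Fintype β] [Fintype γ] {ι : Type*} [Fintype ι]
    {M : Matrix (α × β × γ) (α × β × γ) ℂ} (hM : IsPPT M) :
    IsPPT (Matrix.of fun p q : (ι → α) × (ι → β) × (ι → γ) =>
      ∏ i, M (p.1 i, p.2.1 i, p.2.2 i) (q.1 i, q.2.1 i, q.2.2 i)) := by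
  intro s₁ s₂ s₃
  have := posSemidef_finset_prod (M := fun i =>
    (partialTranspose s₁ s₂ s₃ M).submatrix
      (fun p : (ι → α) × (ι → β) × (ι → γ) => (p.1 i, p.2.1 i, p.2.2 i)) fun p =>
        (p.1 i, p.2.1 i, p.2.2 i)) Finset.univ fun i _ => (hM s₁ s₂ s₃).submatrix _
  convert this using 1
  ext p q
  cases s₁ <;> cases s₂ <;> cases s₃ <;> rfl

theorem posSemidef_cond_swap {X : Matrix α α ℂ} (hX : X.PosSemidef) (s : Bool) :
    (Matrix.of fun p q => X (cond s q p) (cond s p q) : Matrix α α ℂ).PosSemidef := by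
  cases s
  · exact hX
  · exact hX.transpose

theorem IsPPT.product [Fintype α] [Fintype β] [Fintype γ] {X : Matrix α α ℂ} {Y : Matrix β β ℂ}
    {W : Matrix γ γ ℂ} (hX : X.PosSemidef) (hY : Y.PosSemidef) (hW : W.PosSemidef) :
    IsPPT (Matrix.of fun p q : α × β × γ => X p.1 q.1 * (Y p.2.1 q.2.1 * W p.2.2 q.2.2)) :=
  fun s₁ s₂ s₃ =>
  ((posSemidef_cond_swap hX s₁).submatrix fun p : α × β × γ => p.1).hadamard
    (((posSemidef_cond_swap hY s₂).submatrix fun p : α × β × γ => p.2.1).hadamard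
      ((posSemidef_cond_swap hW s₃).submatrix fun p : α × β × γ => p.2.2))

/-- The third party carries an all-ones matrix, so transposing it has no effect, and transposing the
first party is the full transpose of transposing the second. -/
theorem IsPPT.of_fst {X : Matrix (α × β) (α × β) ℂ} (hX : X.PosSemidef)
    (hX' : (Matrix.of fun p q => X (p.1, q.2) (q.1, p.2) : Matrix (α × β) (α × β) ℂ).PosSemidef) :
    IsPPT (Matrix.of fun p q : α × β × γ => X (p.1, p.2.1) (q.1, q.2.1)) := by
  have h := hX.submatrix fun p : α × β × γ => (p.1, p.2.1)
  have h' := hX'.submatrix fun p : α × β × γ => (p.1, p.2.1)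
  exact isPPT_of_posSemidef h h'.transpose h' h

theorem IsPPT.of_snd {X : Matrix (α × γ) (α × γ) ℂ} (hX : X.PosSemidef)
    (hX' : (Matrix.of fun p q => X (p.1, q.2) (q.1, p.2) : Matrix (α × γ) (α × γ) ℂ).PosSemidef) :
    IsPPT (Matrix.of fun p q : α × β × γ => X (p.1, p.2.2) (q.1, q.2.2)) := by
  have h := hX.submatrix fun p : α × β × γ => (p.1, p.2.2)
  have h' := hX'.submatrix fun p : α × β × γ => (p.1, p.2.2)
  exact isPPT_of_posSemidef h h'.transpose h h'

/-- The exchange of the components selected by `s₁`, `s₂`, `s₃` between two triples. -/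
def exchange (s₁ s₂ s₃ : Bool) :
    (μ × ν × κ) × (μ × ν × κ) ≃ (μ × ν × κ) × (μ × ν × κ) where
  toFun m := ((cond s₁ m.2.1 m.1.1, cond s₂ m.2.2.1 m.1.2.1, cond s₃ m.2.2.2 m.1.2.2),
    (cond s₁ m.1.1 m.2.1, cond s₂ m.1.2.1 m.2.2.1, cond s₃ m.1.2.2 m.2.2.2))
  invFun m := ((cond s₁ m.2.1 m.1.1, cond s₂ m.2.2.1 m.1.2.1, cond s₃ m.2.2.2 m.1.2.2),
    (cond s₁ m.1.1 m.2.1, cond s₂ m.1.2.1 m.2.2.1, cond s₃ m.1.2.2 m.2.2.2))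
  left_inv m := by cases s₁ <;> cases s₂ <;> cases s₃ <;> rfl
  right_inv m := by cases s₁ <;> cases s₂ <;> cases s₃ <;> rfl

/-- Partial transposition commutes with contraction: exchanging the two summation indices of each
transposed party only permutes the terms of the sum. -/
theorem IsPPT.contract [Fintype α] [Fintype β] [Fintype γ] [Fintype μ] [Fintype ν] [Fintype κ]
    {G : Matrix ((α × μ) × (β × ν) × (γ × κ)) ((α × μ) × (β × ν) × (γ × κ)) ℂ} (hG : IsPPT G) :
    IsPPT (Matrix.of fun p q : α × β × γ => ∑ m : μ × ν × κ, ∑ m' : μ × ν × κ,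
      G ((p.1, m.1), (p.2.1, m.2.1), (p.2.2, m.2.2))
        ((q.1, m'.1), (q.2.1, m'.2.1), (q.2.2, m'.2.2))) := by
  intro s₁ s₂ s₃
  have := posSemidef_contract ((hG s₁ s₂ s₃).submatrix
    fun x : (α × β × γ) × (μ × ν × κ) =>
      ((x.1.1, x.2.1), (x.1.2.1, x.2.2.1), (x.1.2.2, x.2.2.2)))
  convert this using 1
  ext p q
  simp only [partialTranspose, Matrix.of_apply, Matrix.submatrix_apply]
  rw [← Fintype.sum_prod_type', ← Fintype.sum_prod_type']
  refine Fintype.sum_equiv (exchange s₁ s₂ s₃) _ _ fun m => ?_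
  cases s₁ <;> cases s₂ <;> cases s₃ <;> rfl

/-- Contracting two operators with positive partial transposes over a common tripartite system. -/
theorem IsPPT.link [Fintype α] [Fintype β] [Fintype γ] [Fintype μ] [Fintype ν] [Fintype κ]
    {α₁ β₁ γ₁ α₂ β₂ γ₂ : Type*}
    {J : Matrix (α₁ × β₁ × γ₁) (α₁ × β₁ × γ₁) ℂ} {K : Matrix (α₂ × β₂ × γ₂) (α₂ × β₂ × γ₂) ℂ}
    (hJ : IsPPT J) (hK : IsPPT K)
    (f₁ : α × μ → α₁) (g₁ : β × ν → β₁) (h₁ : γ × κ → γ₁)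
    (f₂ : α × μ → α₂) (g₂ : β × ν → β₂) (h₂ : γ × κ → γ₂) :
    IsPPT (Matrix.of fun p q : α × β × γ => ∑ m : μ × ν × κ, ∑ m' : μ × ν × κ,
      J (f₁ (p.1, m.1), g₁ (p.2.1, m.2.1), h₁ (p.2.2, m.2.2))
        (f₁ (q.1, m'.1), g₁ (q.2.1, m'.2.1), h₁ (q.2.2, m'.2.2)) *
      K (f₂ (p.1, m.1), g₂ (p.2.1, m.2.1), h₂ (p.2.2, m.2.2))
        (f₂ (q.1, m'.1), g₂ (q.2.1, m'.2.1), h₂ (q.2.2, m'.2.2))) :=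
  ((hJ.submatrix f₁ g₁ h₁).hadamard (hK.submatrix f₂ g₂ h₂)).contract

end PPT

/-! ### Linear maps in terms of their Choi matrices -/

section Choi

variable {a b c a' b' c' : Type*}

theorem choiMatrix_apply [DecidableEq a] (Φ : Matrix a a ℂ →ₗ[ℂ] Matrix b b ℂ) (p q : a × b) :
    choiMatrix Φ p q = Φ (Matrix.single p.1 q.1 1) p.2 q.2 := by
  have h : (Matrix.of fun i j => eprUnnormalized a (p.1, i) (q.1, j)) =
      Matrix.single p.1 q.1 (1 : ℂ) := by
    ext i j
    simp [eprUnnormalized, Matrix.single_apply]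
  rw [← h]
  rfl

theorem map_apply_eq_sum [Fintype a] [DecidableEq a] (Φ : Matrix a a ℂ →ₗ[ℂ] Matrix b b ℂ)
    (X : Matrix a a ℂ) (u v : b) :
    Φ X u v = ∑ i, ∑ j, X i j * choiMatrix Φ (i, u) (j, v) := by
  conv_lhs => rw [Matrix.matrix_eq_sum_single X]
  simp only [map_sum, Matrix.sum_apply]
  refine Finset.sum_congr rfl fun i _ => Finset.sum_congr rfl fun j _ => ?_
  rw [choiMatrix_apply, ← mul_one (X i j), ← smul_eq_mul, ← Matrix.smul_single, map_smul]
  simp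

theorem choiState_apply [Fintype a] [DecidableEq a] (Φ : Matrix a a ℂ →ₗ[ℂ] Matrix b b ℂ) :
    choiState Φ = (Fintype.card a : ℂ)⁻¹ • choiMatrix Φ := by
  ext p q
  have h := congrFun₂ (map_smul (idTensor a Φ) (Fintype.card a : ℂ)⁻¹ (eprUnnormalized a)) p q
  exact h

/-- The linear map with a given Choi matrix. -/
def ofChoi [Fintype a] (J : Matrix (a × b) (a × b) ℂ) : Matrix a a ℂ →ₗ[ℂ] Matrix b b ℂ where
  toFun X := Matrix.of fun u v => ∑ i, ∑ j, X i j * J (i, u) (j, v)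
  map_add' X Y := by
    ext u v
    simp [add_mul, Finset.sum_add_distrib]
  map_smul' z X := by
    ext u v
    simp [Finset.mul_sum, mul_assoc]

theorem ofChoi_apply [Fintype a] (J : Matrix (a × b) (a × b) ℂ) (X : Matrix a a ℂ) (u v : b) :
    ofChoi J X u v = ∑ i, ∑ j, X i j * J (i, u) (j, v) := rfl

theorem sum_single_mul [Fintype a] [DecidableEq a] (i j : a) (f : a → a → ℂ) :
    ∑ k, ∑ l, Matrix.single i j (1 : ℂ) k l * f k l = f i j := by
  rw [Finset.sum_eq_single i, Finset.sum_eq_single j]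
  · simp
  · intro l _ hl
    simp [hl.symm]
  · simp
  · intro k _ hk
    simp [hk.symm]
  · simp

@[simp]
theorem choiMatrix_ofChoi [Fintype a] [DecidableEq a] (J : Matrix (a × b) (a × b) ℂ) :
    choiMatrix (ofChoi J) = J := by
  ext p q
  rw [choiMatrix_apply, ofChoi_apply, sum_single_mul p.1 q.1 fun i j => J (i, p.2) (j, q.2)]

theorem choiMatrix_comp [DecidableEq a] [Fintype b] [DecidableEq b]
    (Ψ : Matrix b b ℂ →ₗ[ℂ] Matrix c c ℂ) (Φ : Matrix a a ℂ →ₗ[ℂ] Matrix b b ℂ) (p q : a × c) :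
    choiMatrix (Ψ ∘ₗ Φ) p q = ∑ m, ∑ m', choiMatrix Φ (p.1, m) (q.1, m') *
      choiMatrix Ψ (m, p.2) (m', q.2) := by
  rw [choiMatrix_apply, LinearMap.comp_apply, map_apply_eq_sum]
  simp only [choiMatrix_apply]

/-- `IsChannel` only speaks of reference systems `Fin m`, so the maximally entangled vector lives on
`Fin (card a) × a` and the reference is relabelled afterwards. -/
theorem IsChannel.posSemidef_choiMatrix [Fintype a] [Fintype b] [DecidableEq a]
    {Φ : Matrix a a ℂ →ₗ[ℂ] Matrix b b ℂ} (h : IsChannel Φ) : (choiMatrix Φ).PosSemidef := by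
  let e := Fintype.equivFin a
  let v : Fin (Fintype.card a) × a → ℂ := fun p => if e.symm p.1 = p.2 then 1 else 0
  have hv := h.completelyPositive _ _ (Matrix.posSemidef_vecMulVec_self_star v)
  have := hv.submatrix fun p : a × b => (e p.1, p.2)
  convert this using 1
  ext p q
  rw [choiMatrix_apply]
  have hs : Matrix.single p.1 q.1 (1 : ℂ) =
      Matrix.of fun i j => Matrix.vecMulVec v (star v) (e p.1, i) (e q.1, j) := by
    ext i j
    by_cases h1 : p.1 = i <;> by_cases h2 : q.1 = j <;>
      simp [Matrix.vecMulVec_apply, v, h1, h2]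
  rw [hs]
  rfl

theorem trace_eq_sum_choiMatrix [Fintype a] [DecidableEq a] [Fintype b]
    (Φ : Matrix a a ℂ →ₗ[ℂ] Matrix b b ℂ) (X : Matrix a a ℂ) :
    (Φ X).trace = ∑ i, ∑ j, X i j * ∑ u, choiMatrix Φ (i, u) (j, u) := by
  simp only [Matrix.trace, Matrix.diag_apply, map_apply_eq_sum Φ X]
  rw [Finset.sum_comm]
  refine Finset.sum_congr rfl fun i _ => ?_
  rw [Finset.sum_comm]
  simp only [Finset.mul_sum]

theorem IsChannel.sum_choiMatrix [Fintype a] [DecidableEq a] [Fintype b]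
    {Φ : Matrix a a ℂ →ₗ[ℂ] Matrix b b ℂ} (h : IsChannel Φ) (i j : a) :
    ∑ u, choiMatrix Φ (i, u) (j, u) = if i = j then 1 else 0 := by
  have := h.tracePreserving (Matrix.single i j 1)
  simp only [choiMatrix_apply]
  rw [Matrix.trace] at this
  simp only [Matrix.diag_apply] at this
  rw [this]
  by_cases hij : i = j
  · subst hij
    simp [Matrix.trace_single_eq_same]
  · simp [hij, Matrix.trace_single_eq_of_ne]

/-- Choi's theorem: `id ⊗ Φ` applied to `X` is a contraction of the Schur product of `X` with the
Choi matrix. -/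
theorem isChannel_of_choiMatrix [Fintype a] [DecidableEq a] [Fintype b]
    {Φ : Matrix a a ℂ →ₗ[ℂ] Matrix b b ℂ} (h : (choiMatrix Φ).PosSemidef)
    (htr : ∀ i j, ∑ u, choiMatrix Φ (i, u) (j, u) = if i = j then 1 else 0) : IsChannel Φ where
  completelyPositive m X hX := by
    have h1 := hX.submatrix fun x : (Fin m × b) × a => (x.1.1, x.2)
    have h2 := h.submatrix fun x : (Fin m × b) × a => (x.2, x.1.2)
    have := posSemidef_contract (posSemidef_mul_entries h1 h2)
    convert this using 1
    ext p q
    exact map_apply_eq_sum Φ _ _ _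
  tracePreserving X := by
    rw [trace_eq_sum_choiMatrix]
    simp [htr, Matrix.trace]

theorem IsChannel.comp [Fintype a] [DecidableEq a] [Fintype b] [DecidableEq b] [Fintype c]
    {Ψ : Matrix b b ℂ →ₗ[ℂ] Matrix c c ℂ} {Φ : Matrix a a ℂ →ₗ[ℂ] Matrix b b ℂ}
    (hΨ : IsChannel Ψ) (hΦ : IsChannel Φ) : IsChannel (Ψ ∘ₗ Φ) where
  completelyPositive m X hX := hΨ.completelyPositive m _ (hΦ.completelyPositive m X hX)
  tracePreserving X := (hΨ.tracePreserving _).trans (hΦ.tracePreserving X)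

/-- The operator on `(AA')(BB')(CC')` obtained from an operator on `(ABC)(A'B'C')`. -/
def regroup (M : Matrix ((a × b × c) × (a' × b' × c')) ((a × b × c) × (a' × b' × c')) ℂ) :
    Matrix ((a × a') × (b × b') × (c × c')) ((a × a') × (b × b') × (c × c')) ℂ :=
  Matrix.of fun p q =>
    M ((p.1.1, p.2.1.1, p.2.2.1), (p.1.2, p.2.1.2, p.2.2.2))
      ((q.1.1, q.2.1.1, q.2.2.1), (q.1.2, q.2.1.2, q.2.2.2))

variable [Fintype a] [Fintype b] [Fintype c] [Fintype a'] [Fintype b'] [Fintype c']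
  [DecidableEq a] [DecidableEq b] [DecidableEq c]

theorem IsPPTPreserving.isPPT
    {Y : Matrix (a × b × c) (a × b × c) ℂ →ₗ[ℂ] Matrix (a' × b' × c') (a' × b' × c') ℂ}
    (h : IsPPTPreserving Y) : IsPPT (regroup (choiMatrix Y)) := by
  let f : (a × a') × (b × b') × (c × c') → (a × b × c) × (a' × b' × c') := fun p =>
    ((p.1.1, p.2.1.1, p.2.2.1), (p.1.2, p.2.1.2, p.2.2.2))
  exact isPPT_of_posSemidef (h.isChannel.posSemidef_choiMatrix.submatrix f)
    (h.pptA.submatrix f) (h.pptB.submatrix f) (h.pptC.submatrix f)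

/-- The criterion through which the operations below are shown to be PPT-preserving. Since `regroup`
merges the input and output index of a party, the positivity part is insensitive to which of the two
is which; only the trace condition distinguishes them. -/
theorem isPPTPreserving_of_isPPT
    {Y : Matrix (a × b × c) (a × b × c) ℂ →ₗ[ℂ] Matrix (a' × b' × c') (a' × b' × c') ℂ}
    (h : IsPPT (regroup (choiMatrix Y)))
    (htr : ∀ i j, ∑ u, choiMatrix Y (i, u) (j, u) = if i = j then 1 else 0) :
    IsPPTPreserving Y := by
  let f : (a × b × c) × (a' × b' × c') → (a × a') × (b × b') × (c × c') := fun p =>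
    ((p.1.1, p.2.1), (p.1.2.1, p.2.2.1), (p.1.2.2, p.2.2.2))
  exact ⟨isChannel_of_choiMatrix (h.posSemidef.submatrix f) htr,
    (h true false false).submatrix f, (h false true false).submatrix f,
    (h false false true).submatrix f⟩

theorem IsPPTPreserving.comp {a'' b'' c'' : Type*} [Fintype a''] [Fintype b''] [Fintype c'']
    [DecidableEq a'] [DecidableEq b'] [DecidableEq c']
    {Y : Matrix (a × b × c) (a × b × c) ℂ →ₗ[ℂ] Matrix (a' × b' × c') (a' × b' × c') ℂ}
    {Y' : Matrix (a' × b' × c') (a' × b' × c') ℂ →ₗ[ℂ] Matrix (a'' × b'' × c'') (a'' × b'' × c'') ℂ}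
    (hY' : IsPPTPreserving Y') (hY : IsPPTPreserving Y) : IsPPTPreserving (Y' ∘ₗ Y) := by
  refine isPPTPreserving_of_isPPT ?_ (hY'.isChannel.comp hY.isChannel).sum_choiMatrix
  have := hY.isPPT.link hY'.isPPT (α := a × a'') (β := b × b'') (γ := c × c'')
    (μ := a') (ν := b') (κ := c') (fun x => (x.1.1, x.2)) (fun x => (x.1.1, x.2))
    (fun x => (x.1.1, x.2)) (fun x => (x.2, x.1.2)) (fun x => (x.2, x.1.2))
    (fun x => (x.2, x.1.2))
  convert this using 1
  ext p q
  exact choiMatrix_comp Y' Y _ _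

end Choi

/-! ### The fidelity with two EPR pairs -/

/-- `Tr (A B)` is the sum of all entries of the Schur product of `A` and `Bᵀ`. -/
theorem trace_mul_nonneg {n : Type*} [Fintype n] {A B : Matrix n n ℂ} (hA : A.PosSemidef)
    (hB : B.PosSemidef) : 0 ≤ (A * B).trace := by
  have h := (posSemidef_contract (p := Unit) (m := n)
    ((posSemidef_mul_entries hA hB.transpose).submatrix Prod.snd)).diag_nonneg (i := ())
  simpa [Matrix.trace, Matrix.mul_apply] using h

section Fidelity

variable {r₁ r₂ : ℕ}

theorem eprPair_apply (p q : (Fin r₁ × Fin r₂) × (Fin r₁ × Fin r₂)) :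
    eprPair r₁ r₂ p q = ((r₁ : ℂ) * r₂)⁻¹ * ((if p.1 = p.2 then 1 else 0) *
      if q.1 = q.2 then 1 else 0) := by
  obtain ⟨⟨p₁, p₂⟩, p₃, p₄⟩ := p
  obtain ⟨⟨q₁, q₂⟩, q₃, q₄⟩ := q
  simp only [eprPair, epr, eprUnnormalized, Matrix.of_apply, Matrix.smul_apply, smul_eq_mul,
    Fintype.card_fin, Prod.mk.injEq, mul_inv]
  by_cases h1 : p₁ = p₃ <;> by_cases h2 : p₂ = p₄ <;> by_cases h3 : q₁ = q₃ <;>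
    by_cases h4 : q₂ = q₄ <;> simp [h1, h2, h3, h4]

theorem trace_eprPair_mul
    (σ : Matrix ((Fin r₁ × Fin r₂) × (Fin r₁ × Fin r₂)) ((Fin r₁ × Fin r₂) × (Fin r₁ × Fin r₂)) ℂ) :
    (eprPair r₁ r₂ * σ).trace = ((r₁ : ℂ) * r₂)⁻¹ * ∑ s, ∑ s', σ (s, s) (s', s') := by
  simp only [Matrix.trace, Matrix.diag_apply, Matrix.mul_apply, eprPair_apply,
    Fintype.sum_prod_type (α₁ := Fin r₁ × Fin r₂)]
  simp only [mul_assoc, ← Finset.mul_sum, ite_mul, one_mul, zero_mul, Finset.sum_ite_irrel,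
    Finset.sum_const_zero, Finset.sum_ite_eq, Finset.mem_univ, if_true]
  rw [Finset.sum_comm]

theorem eprFidelity_eq
    (σ : Matrix ((Fin r₁ × Fin r₂) × (Fin r₁ × Fin r₂)) ((Fin r₁ × Fin r₂) × (Fin r₁ × Fin r₂)) ℂ) :
    eprFidelity σ = (((r₁ : ℂ) * r₂)⁻¹ * ∑ s, ∑ s', σ (s, s) (s', s')).re := by
  rw [eprFidelity, trace_eprPair_mul]

theorem posSemidef_eprPair : (eprPair r₁ r₂).PosSemidef := by
  let v : (Fin r₁ × Fin r₂) × (Fin r₁ × Fin r₂) → ℂ := fun p => if p.1 = p.2 then 1 else 0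
  have h := (Matrix.posSemidef_vecMulVec_self_star v).smul
    (a := ((r₁ : ℂ) * r₂)⁻¹) (by rw [inv_nonneg]; positivity)
  convert h using 1
  ext p q
  rw [eprPair_apply]
  by_cases hp : p.1 = p.2 <;> by_cases hq : q.1 = q.2 <;> simp [v, Matrix.vecMulVec_apply, hp, hq]

theorem eprPair_mul_self (h₁ : 0 < r₁) (h₂ : 0 < r₂) :
    eprPair r₁ r₂ * eprPair r₁ r₂ = eprPair r₁ r₂ := by
  ext p q
  have h1 : (r₁ : ℂ) ≠ 0 := by exact_mod_cast h₁.ne'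
  have h2 : (r₂ : ℂ) ≠ 0 := by exact_mod_cast h₂.ne'
  simp only [Matrix.mul_apply, eprPair_apply, Fintype.sum_prod_type (α₁ := Fin r₁ × Fin r₂)]
  by_cases hp : p.1 = p.2 <;> by_cases hq : q.1 = q.2 <;> simp [hp, hq]
  field_simp

theorem eprFidelity_nonneg
    {σ : Matrix ((Fin r₁ × Fin r₂) × (Fin r₁ × Fin r₂)) ((Fin r₁ × Fin r₂) × (Fin r₁ × Fin r₂)) ℂ}
    (hσ : σ.PosSemidef) : 0 ≤ eprFidelity σ :=
  (Complex.le_def.1 (trace_mul_nonneg posSemidef_eprPair hσ)).1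

theorem posSemidef_one_sub {n : Type*} [Fintype n] [DecidableEq n] {P : Matrix n n ℂ}
    (hP : P.PosSemidef) (h : P * P = P) : (1 - P).PosSemidef := by
  have := Matrix.posSemidef_conjTranspose_mul_self (1 - P)
  rwa [Matrix.conjTranspose_sub, Matrix.conjTranspose_one, hP.isHermitian.eq, mul_sub, sub_mul,
    sub_mul, h, one_mul, one_mul, mul_one, sub_self, sub_zero] at this

theorem eprFidelity_le_trace (h₁ : 0 < r₁) (h₂ : 0 < r₂)
    {σ : Matrix ((Fin r₁ × Fin r₂) × (Fin r₁ × Fin r₂)) ((Fin r₁ × Fin r₂) × (Fin r₁ × Fin r₂)) ℂ}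
    (hσ : σ.PosSemidef) : eprFidelity σ ≤ σ.trace.re := by
  have h := (Complex.le_def.1 (trace_mul_nonneg
    (posSemidef_one_sub posSemidef_eprPair (eprPair_mul_self h₁ h₂)) hσ)).1
  rw [sub_mul, one_mul, Matrix.trace_sub, Complex.sub_re, Complex.zero_re] at h
  exact sub_nonneg.1 h

end Fidelity

/-! ### Choi matrices of codes -/

theorem conjBy_single_apply {a b : Type*} [Fintype a] [DecidableEq a] (V : Matrix b a ℂ) (s s' : a)
    (x x' : b) : conjBy V (Matrix.single s s' 1) x x' = V x s * star (V x' s') := by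
  change (V * Matrix.single s s' (1 : ℂ) * V.conjTranspose : Matrix b b ℂ) x x' = _
  rw [Matrix.mul_apply, Finset.sum_eq_single s']
  · rw [Matrix.mul_apply, Finset.sum_eq_single s]
    · simp
    · intro i _ hi
      simp [hi.symm]
    · simp
  · intro i _ hi
    rw [Matrix.mul_apply, Finset.sum_eq_zero, zero_mul]
    intro j _
    simp [hi.symm]
  · simp

theorem trace_idTensor {k a b : Type*} [Fintype k] [Fintype a] [Fintype b]
    {Φ : Matrix a a ℂ →ₗ[ℂ] Matrix b b ℂ} (h : ∀ X, (Φ X).trace = X.trace)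
    (X : Matrix (k × a) (k × a) ℂ) : (idTensor k Φ X).trace = X.trace := by
  simp only [Matrix.trace, Matrix.diag_apply, Fintype.sum_prod_type]
  exact Finset.sum_congr rfl fun r _ => h (Matrix.of fun i j => X (r, i) (r, j))

namespace ForwardAssistedCode

variable {a b c : Type*} [Fintype a] [Fintype b] [Fintype c] [DecidableEq a] {r₁ r₂ : ℕ}

theorem tensorId_conjBy_single [DecidableEq b] [DecidableEq c]
    (Z : ForwardAssistedCode a b c r₁ r₂) (s s' : Fin r₁ × Fin r₂) (w w' : b × c)
    (x x' : a × Fin Z.dimR) (v v' : b × c) :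
    tensorId (conjBy Z.encoder) (b × c) (Matrix.single (s, w) (s', w') 1) (x, v) (x', v') =
      if w = v ∧ w' = v' then Z.encoder x s * star (Z.encoder x' s') else 0 := by
  have h : (Matrix.of fun i j => Matrix.single (s, w) (s', w') (1 : ℂ) (i, v) (j, v')) =
      if w = v ∧ w' = v' then Matrix.single s s' (1 : ℂ) else 0 := by
    ext i j
    by_cases hw : w = v <;> by_cases hw' : w' = v' <;>
      simp [Matrix.single_apply, hw, hw', Prod.ext_iff]
  change conjBy Z.encoder
    (Matrix.of fun i j => Matrix.single (s, w) (s', w') (1 : ℂ) (i, v) (j, v')) x x' = _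
  rw [h]
  split_ifs
  · exact conjBy_single_apply _ _ _ _ _
  · simp

theorem choiMatrix_operation [DecidableEq b] [DecidableEq c]
    (Z : ForwardAssistedCode a b c r₁ r₂) (s s' : Fin r₁ × Fin r₂) (w w' : b × c) (x x' : a)
    (u u' : Fin r₁ × Fin r₂) :
    choiMatrix Z.operation ((s, w), (x, u)) ((s', w'), (x', u')) =
      ∑ r, ∑ r', Z.encoder (x, r) s * star (Z.encoder (x', r') s') *
        choiMatrix Z.decoder ((r, w), u) ((r', w'), u') := by
  rw [choiMatrix_apply]
  change Z.decoder (Matrix.of fun i j => tensorId (conjBy Z.encoder) (b × c)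
    (Matrix.single (s, w) (s', w') 1) ((x, i.1), i.2) ((x', j.1), j.2)) u u' = _
  rw [map_apply_eq_sum]
  simp only [Matrix.of_apply, tensorId_conjBy_single, Fintype.sum_prod_type (α₂ := b × c)]
  refine Finset.sum_congr rfl fun r _ => ?_
  rw [Finset.sum_eq_single w]
  · refine Finset.sum_congr rfl fun r' _ => ?_
    rw [Finset.sum_eq_single w']
    · simp
    · intro v _ hv
      simp [hv.symm]
    · simp
  · intro v _ hv
    simp [hv.symm]
  · simp

/-- The code enters only through its tripartite operation: `N` is inserted between the output `A'`
and the inputs `BC`. Fidelities can thus be compared by manipulating the Choi matrix of the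
operation. -/
theorem choiMatrix_inducedChannel [DecidableEq b] [DecidableEq c]
    (Z : ForwardAssistedCode a b c r₁ r₂)
    (N : Matrix a a ℂ →ₗ[ℂ] Matrix (b × c) (b × c) ℂ) (s s' u u' : Fin r₁ × Fin r₂) :
    choiMatrix (Z.inducedChannel N) (s, u) (s', u') =
      ∑ p : a × b × c, ∑ p' : a × b × c, choiMatrix N p p' *
        choiMatrix Z.operation ((s, p.2), (p.1, u)) ((s', p'.2), (p'.1, u')) := by
  simp only [choiMatrix_operation]
  rw [choiMatrix_apply]
  change Z.decoder (Matrix.of fun i j => N (Matrix.of fun x x' =>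
    conjBy Z.encoder (Matrix.single s s' 1) (x, i.1) (x', j.1)) i.2 j.2) u u' = _
  rw [map_apply_eq_sum]
  simp only [Matrix.of_apply, map_apply_eq_sum N, conjBy_single_apply,
    Fintype.sum_prod_type (α₂ := b × c), Finset.sum_mul, Finset.mul_sum]
  have e1 (f : Fin Z.dimR → b × c → Fin Z.dimR → b × c → a → a → ℂ) :
      ∑ r, ∑ w, ∑ r', ∑ w', ∑ x, ∑ x', f r w r' w' x x' =
        ∑ x, ∑ w, ∑ x', ∑ w', ∑ r, ∑ r', f r w r' w' x x' := by
    simp only [← Fintype.sum_prod_type']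
    refine Fintype.sum_equiv
      { toFun := fun t => (t.2.2.2.2.1, t.2.1, t.2.2.2.2.2, t.2.2.2.1, t.1, t.2.2.1)
        invFun := fun t => (t.2.2.2.2.1, t.2.1, t.2.2.2.2.2, t.2.2.2.1, t.1, t.2.2.1)
        left_inv := fun t => rfl
        right_inv := fun t => rfl } _ _ fun t => rfl
  rw [e1]
  refine Finset.sum_congr rfl fun x _ => Finset.sum_congr rfl fun w _ => Finset.sum_congr rfl
    fun x' _ => Finset.sum_congr rfl fun w' _ => Finset.sum_congr rfl fun r _ =>
    Finset.sum_congr rfl fun r' _ => ?_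
  ring

theorem sum_star_encoder_mul (Z : ForwardAssistedCode a b c r₁ r₂) (s s' : Fin r₁ × Fin r₂) :
    ∑ y, star (Z.encoder y s) * Z.encoder y s' = if s = s' then 1 else 0 := by
  have h := congrFun₂ Z.encoder_isometry s s'
  rw [Matrix.mul_apply] at h
  simpa [Matrix.one_apply] using h

theorem trace_inducedChannel (Z : ForwardAssistedCode a b c r₁ r₂)
    {N : Matrix a a ℂ →ₗ[ℂ] Matrix (b × c) (b × c) ℂ} (hN : IsChannel N)
    (X : Matrix (Fin r₁ × Fin r₂) (Fin r₁ × Fin r₂) ℂ) :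
    (Z.inducedChannel N X).trace = X.trace := by
  have h : (Z.encoder * X * Z.encoder.conjTranspose).trace = X.trace := by
    rw [Matrix.trace_mul_comm, ← Matrix.mul_assoc, Z.encoder_isometry, Matrix.one_mul]
  rw [← h]
  refine (Z.decoder_isChannel.tracePreserving _).trans ?_
  refine (trace_idTensor hN.tracePreserving _).trans ?_
  exact Fintype.sum_equiv (Equiv.prodComm _ _) _ _ fun _ => rfl

theorem posSemidef_choiMatrix_inducedChannel [DecidableEq b] [DecidableEq c]
    (Z : ForwardAssistedCode a b c r₁ r₂)
    {N : Matrix a a ℂ →ₗ[ℂ] Matrix (b × c) (b × c) ℂ} (hN : IsChannel N)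
    (hZ : (choiMatrix Z.operation).PosSemidef) :
    (choiMatrix (Z.inducedChannel N)).PosSemidef := by
  have h := posSemidef_contract ((posSemidef_mul_entries
    (hN.posSemidef_choiMatrix.submatrix
      fun x : ((Fin r₁ × Fin r₂) × (Fin r₁ × Fin r₂)) × (a × b × c) => x.2)
    (hZ.submatrix
      fun x : ((Fin r₁ × Fin r₂) × (Fin r₁ × Fin r₂)) × (a × b × c) =>
        ((x.1.1, x.2.2), (x.2.1, x.1.2)))))
  convert h using 1
  ext p q
  exact choiMatrix_inducedChannel Z N _ _ _ _

theorem idTensor_inducedChannel_eprPair (Z : ForwardAssistedCode a b c r₁ r₂)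
    (N : Matrix a a ℂ →ₗ[ℂ] Matrix (b × c) (b × c) ℂ) :
    idTensor (Fin r₁ × Fin r₂) (Z.inducedChannel N) (eprPair r₁ r₂) =
      ((r₁ : ℂ) * r₂)⁻¹ • choiMatrix (Z.inducedChannel N) := by
  ext p q
  have h : (Matrix.of fun i j => eprPair r₁ r₂ (p.1, i) (q.1, j)) =
      ((r₁ : ℂ) * r₂)⁻¹ • Matrix.single p.1 q.1 (1 : ℂ) := by
    ext i j
    by_cases hp : p.1 = i <;> by_cases hq : q.1 = j <;>
      simp [eprPair_apply, hp, hq]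
  change Z.inducedChannel N (Matrix.of fun i j => eprPair r₁ r₂ (p.1, i) (q.1, j)) p.2 q.2 = _
  rw [h, map_smul, Matrix.smul_apply, Matrix.smul_apply, choiMatrix_apply]

theorem fidelity_eq (Z : ForwardAssistedCode a b c r₁ r₂)
    (N : Matrix a a ℂ →ₗ[ℂ] Matrix (b × c) (b × c) ℂ) :
    Z.fidelity N = eprFidelity (((r₁ : ℂ) * r₂)⁻¹ • choiMatrix (Z.inducedChannel N)) := by
  rw [fidelity, idTensor_inducedChannel_eprPair]

theorem fidelity_nonneg [DecidableEq b] [DecidableEq c] (Z : ForwardAssistedCode a b c r₁ r₂)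
    {N : Matrix a a ℂ →ₗ[ℂ] Matrix (b × c) (b × c) ℂ} (hN : IsChannel N)
    (hZ : (choiMatrix Z.operation).PosSemidef) : 0 ≤ Z.fidelity N := by
  rw [fidelity_eq]
  exact eprFidelity_nonneg ((Z.posSemidef_choiMatrix_inducedChannel hN hZ).smul
    (by rw [inv_nonneg]; positivity))

/-- Bounds the set defining `codeFidelity`; the real supremum of an unbounded set would be the
default value `0`. -/
theorem fidelity_le_one [DecidableEq b] [DecidableEq c] (h₁ : 0 < r₁) (h₂ : 0 < r₂)
    (Z : ForwardAssistedCode a b c r₁ r₂)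
    {N : Matrix a a ℂ →ₗ[ℂ] Matrix (b × c) (b × c) ℂ} (hN : IsChannel N)
    (hZ : (choiMatrix Z.operation).PosSemidef) : Z.fidelity N ≤ 1 := by
  rw [fidelity_eq]
  refine (eprFidelity_le_trace h₁ h₂ ((Z.posSemidef_choiMatrix_inducedChannel hN hZ).smul
    (by rw [inv_nonneg]; positivity))).trans_eq ?_
  have h1 : (r₁ : ℂ) ≠ 0 := by exact_mod_cast h₁.ne'
  have h2 : (r₂ : ℂ) ≠ 0 := by exact_mod_cast h₂.ne'
  have ht : (choiMatrix (Z.inducedChannel N)).trace = (r₁ : ℂ) * r₂ := by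
    rw [Matrix.trace, Fintype.sum_prod_type]
    simp only [Matrix.diag_apply]
    have h (s : Fin r₁ × Fin r₂) :
        ∑ u, choiMatrix (Z.inducedChannel N) (s, u) (s, u) = 1 := by
      simp only [choiMatrix_apply]
      exact (Z.trace_inducedChannel hN _).trans (Matrix.trace_single_eq_same s 1)
    simp [h]
  rw [Matrix.trace_smul, ht, smul_eq_mul, inv_mul_cancel₀ (mul_ne_zero h1 h2), Complex.one_re]

end ForwardAssistedCode

/-! ### Converting the outcome of a test into an EPR pair -/

theorem epr_apply {d : ℕ} (p q : Fin d × Fin d) :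
    epr (Fin d) p q = (d : ℂ)⁻¹ * ((if p.1 = p.2 then 1 else 0) * if q.1 = q.2 then 1 else 0) := by
  by_cases hp : p.1 = p.2 <;> by_cases hq : q.1 = q.2 <;>
    simp [epr, eprUnnormalized, hp, hq]

theorem posSemidef_epr {d : ℕ} : (epr (Fin d)).PosSemidef := by
  let v : Fin d × Fin d → ℂ := fun p => if p.1 = p.2 then 1 else 0
  have h := (Matrix.posSemidef_vecMulVec_self_star v).smul
    (a := (d : ℂ)⁻¹) (by rw [inv_nonneg]; positivity)
  convert h using 1
  ext p q
  rw [epr_apply]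
  by_cases hp : p.1 = p.2 <;> by_cases hq : q.1 = q.2 <;> simp [v, Matrix.vecMulVec_apply, hp, hq]

theorem epr_mul_self {d : ℕ} (hd : 0 < d) : epr (Fin d) * epr (Fin d) = epr (Fin d) := by
  ext p q
  have h1 : (d : ℂ) ≠ 0 := by exact_mod_cast hd.ne'
  simp only [Matrix.mul_apply, epr_apply, Fintype.sum_prod_type]
  by_cases hp : p.1 = p.2 <;> by_cases hq : q.1 = q.2 <;> simp [hp, hq]
  field_simp

theorem epr_fin_one : epr (Fin 1) = 1 := by
  ext p q
  have h : p = q := Subsingleton.elim _ _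
  subst h
  rw [epr_apply]
  have h : p.1 = p.2 := Subsingleton.elim _ _
  simp [h]

/-- The swap operator on two copies of a system. -/
def swapMatrix (o : Type*) [DecidableEq o] : Matrix (o × o) (o × o) ℂ :=
  Matrix.of fun p q => if p.1 = q.2 ∧ p.2 = q.1 then 1 else 0

section Swap

variable {o : Type*} [DecidableEq o]

theorem isHermitian_swapMatrix : (swapMatrix o).IsHermitian := by
  ext p q
  have h : (q.1 = p.2 ∧ q.2 = p.1) ↔ (p.1 = q.2 ∧ p.2 = q.1) :=
    ⟨fun h => ⟨h.2.symm, h.1.symm⟩, fun h => ⟨h.2.symm, h.1.symm⟩⟩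
  by_cases h' : p.1 = q.2 ∧ p.2 = q.1 <;> simp [swapMatrix, h, h']

theorem swapMatrix_mul_self [Fintype o] : swapMatrix o * swapMatrix o = 1 := by
  ext p q
  rw [Matrix.mul_apply, Finset.sum_eq_single (p.2, p.1)]
  · by_cases h1 : p.1 = q.1 <;> by_cases h2 : p.2 = q.2 <;>
      simp [swapMatrix, Matrix.one_apply, Prod.ext_iff, h1, h2]
  · intro m _ hm
    have : ¬ (p.1 = m.2 ∧ p.2 = m.1) := fun h => hm (Prod.ext h.2.symm h.1.symm)
    simp [swapMatrix, this]
  · simp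

theorem posSemidef_one_add_swapMatrix [Fintype o] : (1 + swapMatrix o).PosSemidef := by
  have h := (Matrix.posSemidef_conjTranspose_mul_self (1 + swapMatrix o)).smul
    (a := (2⁻¹ : ℝ)) (by norm_num)
  convert h using 1
  rw [Matrix.conjTranspose_add, Matrix.conjTranspose_one, isHermitian_swapMatrix.eq, mul_add,
    add_mul, add_mul, swapMatrix_mul_self, one_mul, mul_one, one_mul]
  ext p q
  simp
  ring

theorem posSemidef_one_sub_swapMatrix [Fintype o] : (1 - swapMatrix o).PosSemidef := by
  have h := (Matrix.posSemidef_conjTranspose_mul_self (1 - swapMatrix o)).smul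
    (a := (2⁻¹ : ℝ)) (by norm_num)
  convert h using 1
  rw [Matrix.conjTranspose_sub, Matrix.conjTranspose_one, isHermitian_swapMatrix.eq, mul_sub,
    sub_mul, sub_mul, swapMatrix_mul_self, one_mul, mul_one, one_mul]
  ext p q
  simp
  ring

end Swap

/-- The partial transpose of a bipartite operator on the second system. -/
def transposeSnd {α β : Type*} (X : Matrix (α × β) (α × β) ℂ) : Matrix (α × β) (α × β) ℂ :=
  Matrix.of fun p q => X (p.1, q.2) (q.1, p.2)

theorem transposeSnd_epr {d : ℕ} : transposeSnd (epr (Fin d)) = (d : ℂ)⁻¹ • swapMatrix (Fin d) := by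
  ext p q
  have h : q.1 = p.2 ↔ p.2 = q.1 := eq_comm
  by_cases h1 : p.1 = q.2 <;> by_cases h2 : p.2 = q.1 <;>
    simp [transposeSnd, epr_apply, swapMatrix, h, h1, h2]

theorem transposeSnd_one {α β : Type*} [DecidableEq α] [DecidableEq β] :
    transposeSnd (1 : Matrix (α × β) (α × β) ℂ) = 1 := by
  ext p q
  simp only [transposeSnd, Matrix.of_apply, Matrix.one_apply, Prod.ext_iff]
  simp only [eq_comm (a := q.2)]

/-- An effect `E` on a bipartite system for which the operation producing an EPR pair of dimension
`d` on acceptance, and the normalized complement of the EPR pair on rejection, is PPT-preserving. -/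
structure IsRainsTest {α β : Type*} [DecidableEq α] [DecidableEq β]
    (E : Matrix (α × β) (α × β) ℂ) (d : ℕ) : Prop where
  pos : 0 < d
  posSemidef : E.PosSemidef
  posSemidef_one_sub : (1 - E).PosSemidef
  -- This field and the next are Rains' condition `-1 ≤ d E^Γ ≤ 1`.
  posSemidef_one_add_smul : (1 + (d : ℂ) • transposeSnd E).PosSemidef
  posSemidef_one_sub_smul : (1 - (d : ℂ) • transposeSnd E).PosSemidef
  -- For `d = 1` the complement of the EPR pair is zero and cannot be normalized, so rejection must
  -- be impossible.
  eq_one : d = 1 → E = 1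

theorem isRainsTest_epr {d : ℕ} (hd : 0 < d) : IsRainsTest (epr (Fin d)) d := by
  have h1 : (d : ℂ) ≠ 0 := by exact_mod_cast hd.ne'
  have h : (d : ℂ) • transposeSnd (epr (Fin d)) = swapMatrix (Fin d) := by
    rw [transposeSnd_epr, smul_smul, mul_inv_cancel₀ h1, one_smul]
  refine ⟨hd, posSemidef_epr, BroadcastCode.posSemidef_one_sub posSemidef_epr (epr_mul_self hd),
    ?_, ?_, ?_⟩
  · rw [h]
    exact posSemidef_one_add_swapMatrix
  · rw [h]
    exact posSemidef_one_sub_swapMatrix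
  · rintro rfl
    exact epr_fin_one

/-! ### The two-party operation attached to a test -/

section Kernel

variable {α β : Type*} [DecidableEq α] [DecidableEq β]

/-- The Choi matrix of the operation producing an EPR pair of dimension `d` if the effect `E` is
accepted and the normalized complement of the EPR pair otherwise. -/
def rainsKernel (E : Matrix (α × β) (α × β) ℂ) (d : ℕ) :
    Matrix ((α × β) × (Fin d × Fin d)) ((α × β) × (Fin d × Fin d)) ℂ :=
  Matrix.of fun p q => E p.1 q.1 * epr (Fin d) p.2 q.2 +
    ((d : ℂ) ^ 2 - 1)⁻¹ * ((1 - E) p.1 q.1 * (1 - epr (Fin d)) p.2 q.2)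

variable {E : Matrix (α × β) (α × β) ℂ} {d : ℕ}

theorem sq_sub_one_ne_zero (hd : 2 ≤ d) : (d : ℂ) ^ 2 - 1 ≠ 0 := by
  have : (d : ℝ) ^ 2 - 1 ≠ 0 := by
    have : (2 : ℝ) ≤ d := by exact_mod_cast hd
    nlinarith
  exact_mod_cast this

theorem posSemidef_rainsKernel [Fintype α] [Fintype β] (h : IsRainsTest E d) :
    (rainsKernel E d).PosSemidef := by
  have h1 : (0 : ℂ) ≤ ((d : ℂ) ^ 2 - 1)⁻¹ := by
    have h2 : (0 : ℝ) ≤ ((d : ℝ) ^ 2 - 1)⁻¹ := by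
      have : (1 : ℝ) ≤ d := by exact_mod_cast h.pos
      rw [inv_nonneg]
      nlinarith
    have h3 : ((d : ℂ) ^ 2 - 1)⁻¹ = ((((d : ℝ) ^ 2 - 1)⁻¹ : ℝ) : ℂ) := by push_cast; rfl
    rw [h3]
    exact Complex.zero_le_real.2 h2
  have t1 := posSemidef_mul_entries
    (h.posSemidef.submatrix fun p : (α × β) × (Fin d × Fin d) => p.1)
    ((posSemidef_epr (d := d)).submatrix fun p : (α × β) × (Fin d × Fin d) => p.2)
  have t2 := (posSemidef_mul_entries
    (h.posSemidef_one_sub.submatrix fun p : (α × β) × (Fin d × Fin d) => p.1)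
    ((isRainsTest_epr h.pos).posSemidef_one_sub.submatrix
      fun p : (α × β) × (Fin d × Fin d) => p.2)).smul h1
  exact t1.add t2

/-- With `F` the swap, the transpose of the EPR pair is `F / d`. Expanding in `1 + F` and `1 - F`,
which are positive, gives the coefficients `(1 + d E^Γ) / (2d(d + 1))` and `(1 - d E^Γ) / (2d(d -
1))`; the bounds in `IsRainsTest` say that these are positive. -/
theorem posSemidef_rainsKernel_transpose [Fintype α] [Fintype β] (h : IsRainsTest E d) :
    (Matrix.of fun p q : (α × β) × (Fin d × Fin d) =>
      rainsKernel E d ((p.1.1, q.1.2), (p.2.1, q.2.2))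
        ((q.1.1, p.1.2), (q.2.1, p.2.2))).PosSemidef := by
  have hr (p q : (α × β) × (Fin d × Fin d)) : rainsKernel E d ((p.1.1, q.1.2), (p.2.1, q.2.2))
        ((q.1.1, p.1.2), (q.2.1, p.2.2)) =
      transposeSnd E p.1 q.1 * ((d : ℂ)⁻¹ * swapMatrix (Fin d) p.2 q.2) +
        ((d : ℂ) ^ 2 - 1)⁻¹ * (((1 : Matrix (α × β) (α × β) ℂ) - transposeSnd E) p.1 q.1 *
          ((1 : Matrix (Fin d × Fin d) (Fin d × Fin d) ℂ) p.2 q.2 -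
            (d : ℂ)⁻¹ * swapMatrix (Fin d) p.2 q.2)) := by
    rw [← smul_eq_mul (a := (d : ℂ)⁻¹), ← Matrix.smul_apply, ← transposeSnd_epr]
    have o₁ : (1 : Matrix (α × β) (α × β) ℂ) p.1 q.1 = (1 : Matrix (α × β) (α × β) ℂ)
        (p.1.1, q.1.2) (q.1.1, p.1.2) := (congrFun₂ transposeSnd_one p.1 q.1).symm
    have o₂ : (1 : Matrix (Fin d × Fin d) (Fin d × Fin d) ℂ) p.2 q.2 =
        (1 : Matrix (Fin d × Fin d) (Fin d × Fin d) ℂ) (p.2.1, q.2.2) (q.2.1, p.2.2) :=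
      (congrFun₂ transposeSnd_one p.2 q.2).symm
    simp only [rainsKernel, Matrix.of_apply, Matrix.sub_apply, o₁, o₂]
    rfl
  simp only [hr]
  rcases Nat.lt_or_ge d 2 with hd | hd
  -- The coefficient with `d - 1` in the denominator is meaningless here; since `E = 1`, only the
  -- one-dimensional EPR pair remains.
  · obtain rfl : d = 1 := by have := h.pos; omega
    have hE := h.eq_one rfl
    subst hE
    have t := posSemidef_mul_entries
      ((Matrix.PosSemidef.one (n := α × β) (R := ℂ)).submatrix
        fun p : (α × β) × (Fin 1 × Fin 1) => p.1)
      ((posSemidef_one_add_swapMatrix (o := Fin 1)).submatrix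
        fun p : (α × β) × (Fin 1 × Fin 1) => p.2)
    have t' := t.smul (a := (2⁻¹ : ℝ)) (by norm_num)
    convert t' using 1
    ext p q
    have hp : p.2 = q.2 := Subsingleton.elim _ _
    have hs : swapMatrix (Fin 1) p.2 q.2 = 1 := by
      simp [swapMatrix, eq_iff_true_of_subsingleton]
    have ho : (1 : Matrix (Fin 1 × Fin 1) (Fin 1 × Fin 1) ℂ) p.2 q.2 = 1 := by
      rw [hp, Matrix.one_apply_eq]
    simp [transposeSnd_one, ho, hs]
    ring
  · have hd0 : (d : ℂ) ≠ 0 := by exact_mod_cast h.pos.ne'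
    have h1 : (d : ℂ) - 1 ≠ 0 := fun h0 => sq_sub_one_ne_zero hd (by linear_combination (d + 1 : ℂ) * h0)
    have h2 : (d : ℂ) + 1 ≠ 0 := fun h0 => sq_sub_one_ne_zero hd (by linear_combination (d - 1 : ℂ) * h0)
    have c1 : (0 : ℝ) ≤ (2 * d * (d + 1) : ℝ)⁻¹ := by positivity
    have c2 : (0 : ℝ) ≤ (2 * d * (d - 1) : ℝ)⁻¹ := by
      have : (2 : ℝ) ≤ d := by exact_mod_cast hd
      rw [inv_nonneg]
      nlinarith
    have t1 := (posSemidef_mul_entries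
      (h.posSemidef_one_add_smul.submatrix fun p : (α × β) × (Fin d × Fin d) => p.1)
      ((posSemidef_one_add_swapMatrix (o := Fin d)).submatrix
        fun p : (α × β) × (Fin d × Fin d) => p.2)).smul c1
    have t2 := (posSemidef_mul_entries
      (h.posSemidef_one_sub_smul.submatrix fun p : (α × β) × (Fin d × Fin d) => p.1)
      ((posSemidef_one_sub_swapMatrix (o := Fin d)).submatrix
        fun p : (α × β) × (Fin d × Fin d) => p.2)).smul c2
    convert t1.add t2 using 1
    ext p q
    have h3 := sq_sub_one_ne_zero hd
    have h4 : ((d : ℂ) ^ 2 - 1)⁻¹ = ((d : ℂ) - 1)⁻¹ * ((d : ℂ) + 1)⁻¹ := by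
      rw [← mul_inv]
      congr 1
      ring
    simp only [Matrix.of_apply, Matrix.add_apply, Matrix.sub_apply, Matrix.smul_apply,
      Matrix.submatrix_apply, Complex.real_smul, smul_eq_mul, h4]
    push_cast
    generalize transposeSnd E p.1 q.1 = x
    generalize swapMatrix (Fin d) p.2 q.2 = y
    generalize (1 : Matrix (α × β) (α × β) ℂ) p.1 q.1 = z
    generalize (1 : Matrix (Fin d × Fin d) (Fin d × Fin d) ℂ) p.2 q.2 = w
    field_simp
    ring

/-- The EPR pair and its normalized complement both have a maximally mixed marginal, so this
marginal does not reveal the outcome of the test. Trace preservation and the teleporting decoder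
both rest on this. -/
theorem sum_rainsKernel_snd (h : IsRainsTest E d) (m m' : α × β) (s s' : Fin d) :
    ∑ u, rainsKernel E d (m, (s, u)) (m', (s', u)) =
      if m = m' ∧ s = s' then (d : ℂ)⁻¹ else 0 := by
  have hd0 : (d : ℂ) ≠ 0 := by exact_mod_cast h.pos.ne'
  have e1 : ∑ u, epr (Fin d) (s, u) (s', u) = if s = s' then (d : ℂ)⁻¹ else 0 := by
    simp [epr_apply]
  have e2 : ∑ u, (1 - epr (Fin d)) (s, u) (s', u) =
      if s = s' then (d : ℂ) - (d : ℂ)⁻¹ else 0 := by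
    simp only [Matrix.sub_apply, Finset.sum_sub_distrib, e1]
    by_cases hs : s = s' <;> simp [Matrix.one_apply, hs]
  simp only [rainsKernel, Matrix.of_apply, Finset.sum_add_distrib, ← Finset.mul_sum, e1, e2]
  rcases Nat.lt_or_ge d 2 with hd | hd
  · obtain rfl : d = 1 := by have := h.pos; omega
    rw [h.eq_one rfl]
    by_cases hm : m = m' <;> by_cases hs : s = s' <;> simp [Matrix.one_apply, hm, hs]
  · have h3 := sq_sub_one_ne_zero hd
    by_cases hm : m = m' <;> by_cases hs : s = s' <;>
      simp only [Matrix.sub_apply, Matrix.one_apply, hm, hs, if_true, if_false, and_self, and_false, false_and,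
        mul_zero, add_zero]
    · field_simp
      ring
    · field_simp
      ring

/-- The complement is orthogonal to the EPR pair, so only the accepted branch counts: the EPR
fidelity of the output is the acceptance probability. -/
theorem sum_rainsKernel_diag (h : IsRainsTest E d) (m m' : α × β) :
    ∑ s, ∑ s', rainsKernel E d (m, (s, s)) (m', (s', s')) = d * E m m' := by
  have hd0 : (d : ℂ) ≠ 0 := by exact_mod_cast h.pos.ne'
  have e1 : ∑ s : Fin d, ∑ s' : Fin d, epr (Fin d) (s, s) (s', s') = d := by
    simp [epr_apply]
    field_simp
  have e2 : ∑ s : Fin d, ∑ s' : Fin d, (1 - epr (Fin d)) (s, s) (s', s') = 0 := by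
    simp only [Matrix.sub_apply, Finset.sum_sub_distrib, e1]
    simp [Matrix.one_apply]
  simp only [rainsKernel, Matrix.of_apply, Finset.sum_add_distrib, ← Finset.mul_sum, e1, e2]
  ring

end Kernel

theorem sum_sum_comm {ι κ : Type*} [Fintype ι] [Fintype κ] (f : ι → ι → κ → κ → ℂ) :
    ∑ i, ∑ i', ∑ k, ∑ k', f i i' k k' = ∑ k, ∑ k', ∑ i, ∑ i', f i i' k k' := by
  have := Finset.sum_comm (s := (Finset.univ : Finset (ι × ι)))
    (t := (Finset.univ : Finset (κ × κ))) (f := fun p q => f p.1 p.2 q.1 q.2)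
  simpa only [Fintype.sum_prod_type] using this

/-! ### Two such operations in parallel, with Alice taking part in both -/

section DoubleKernel

variable {A α₁ α₂ β γ : Type*} [DecidableEq α₁] [DecidableEq α₂]
  [DecidableEq β] [DecidableEq γ] {d₁ d₂ : ℕ}

/-- The Choi matrix of the tripartite operation that applies the operations with Choi matrices
`rainsKernel E₁ d₁` and `rainsKernel E₂ d₂` between Alice and Bob and between Alice and Charlie. -/
def doubleKernel (f : A → α₁ × α₂) (E₁ : Matrix (α₁ × β) (α₁ × β) ℂ)
    (E₂ : Matrix (α₂ × γ) (α₂ × γ) ℂ) (d₁ d₂ : ℕ) :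
    Matrix ((A × β × γ) × ((Fin d₁ × Fin d₂) × Fin d₁ × Fin d₂))
      ((A × β × γ) × ((Fin d₁ × Fin d₂) × Fin d₁ × Fin d₂)) ℂ :=
  Matrix.of fun p q =>
    rainsKernel E₁ d₁ (((f p.1.1).1, p.1.2.1), (p.2.1.1, p.2.2.1))
      (((f q.1.1).1, q.1.2.1), (q.2.1.1, q.2.2.1)) *
    rainsKernel E₂ d₂ (((f p.1.1).2, p.1.2.2), (p.2.1.2, p.2.2.2))
      (((f q.1.1).2, q.1.2.2), (q.2.1.2, q.2.2.2))

variable {f : A → α₁ × α₂} {E₁ : Matrix (α₁ × β) (α₁ × β) ℂ} {E₂ : Matrix (α₂ × γ) (α₂ × γ) ℂ}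

theorem isPPT_doubleKernel [Fintype A] [Fintype α₁] [Fintype α₂] [Fintype β] [Fintype γ]
    (h₁ : IsRainsTest E₁ d₁) (h₂ : IsRainsTest E₂ d₂) :
    IsPPT (regroup (doubleKernel f E₁ E₂ d₁ d₂)) := by
  have t₁ := IsPPT.of_fst (γ := γ × Fin d₂)
    ((posSemidef_rainsKernel h₁).submatrix fun p : (α₁ × Fin d₁) × (β × Fin d₁) =>
      ((p.1.1, p.2.1), (p.1.2, p.2.2)))
    ((posSemidef_rainsKernel_transpose h₁).submatrix fun p : (α₁ × Fin d₁) × (β × Fin d₁) =>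
      ((p.1.1, p.2.1), (p.1.2, p.2.2)))
  have t₂ := IsPPT.of_snd (β := β × Fin d₁)
    ((posSemidef_rainsKernel h₂).submatrix fun p : (α₂ × Fin d₂) × (γ × Fin d₂) =>
      ((p.1.1, p.2.1), (p.1.2, p.2.2)))
    ((posSemidef_rainsKernel_transpose h₂).submatrix fun p : (α₂ × Fin d₂) × (γ × Fin d₂) =>
      ((p.1.1, p.2.1), (p.1.2, p.2.2)))
  exact (t₁.submatrix (fun x : A × (Fin d₁ × Fin d₂) => ((f x.1).1, x.2.1)) id id).hadamard
    (t₂.submatrix (fun x : A × (Fin d₁ × Fin d₂) => ((f x.1).2, x.2.2)) id id)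

/-- Injectivity of `f` means that Alice's system is embedded isometrically in `α₁ × α₂`, so the two
Kronecker deltas on the components combine to one on `A`. -/
theorem sum_doubleKernel_snd [DecidableEq A] (hf : Function.Injective f)
    (h₁ : IsRainsTest E₁ d₁) (h₂ : IsRainsTest E₂ d₂) (m m' : A × β × γ) (s s' : Fin d₁ × Fin d₂) :
    ∑ u, doubleKernel f E₁ E₂ d₁ d₂ (m, (s, u)) (m', (s', u)) =
      if m = m' ∧ s = s' then ((d₁ : ℂ) * d₂)⁻¹ else 0 := by
  obtain ⟨x, y, z⟩ := m
  obtain ⟨x', y', z'⟩ := m'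
  obtain ⟨s₁, s₂⟩ := s
  obtain ⟨s₁', s₂'⟩ := s'
  simp only [doubleKernel, Matrix.of_apply, Fintype.sum_prod_type, ← Finset.mul_sum,
    ← Finset.sum_mul, sum_rainsKernel_snd h₁, sum_rainsKernel_snd h₂]
  have hx : x = x' ↔ (f x).1 = (f x').1 ∧ (f x).2 = (f x').2 := by
    rw [← Prod.ext_iff, hf.eq_iff]
  simp only [Prod.mk.injEq, hx]
  rw [ite_zero_mul_ite_zero, mul_inv]
  congr 1
  simp only [eq_iff_iff]
  tauto

theorem sum_doubleKernel_diag (h₁ : IsRainsTest E₁ d₁) (h₂ : IsRainsTest E₂ d₂)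
    (m m' : A × β × γ) :
    ∑ s, ∑ s', doubleKernel f E₁ E₂ d₁ d₂ (m, (s, s)) (m', (s', s')) = (d₁ * d₂) *
      (E₁ ((f m.1).1, m.2.1) ((f m'.1).1, m'.2.1) *
        E₂ ((f m.1).2, m.2.2) ((f m'.1).2, m'.2.2)) := by
  have e := congrArg₂ (· * ·)
    (sum_rainsKernel_diag h₁ ((f m.1).1, m.2.1) ((f m'.1).1, m'.2.1))
    (sum_rainsKernel_diag h₂ ((f m.1).2, m.2.2) ((f m'.1).2, m'.2.2))
  simp only [doubleKernel, Matrix.of_apply, Fintype.sum_prod_type]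
  rw [mul_mul_mul_comm, ← e]
  simp only [Finset.sum_mul_sum]

theorem isPPTPreserving_ofChoi_doubleKernel
    [Fintype A] [DecidableEq A] [Fintype α₁] [Fintype α₂] [Fintype β] [Fintype γ]
    (hf : Function.Injective f) (h₁ : IsRainsTest E₁ d₁) (h₂ : IsRainsTest E₂ d₂) :
    IsPPTPreserving (ofChoi (doubleKernel f E₁ E₂ d₁ d₂)) := by
  have n₁ : (d₁ : ℂ) ≠ 0 := by exact_mod_cast h₁.pos.ne'
  have n₂ : (d₂ : ℂ) ≠ 0 := by exact_mod_cast h₂.pos.ne'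
  refine isPPTPreserving_of_isPPT ?_ fun i j => ?_
  · rw [choiMatrix_ofChoi]
    exact isPPT_doubleKernel h₁ h₂
  · rw [choiMatrix_ofChoi, Fintype.sum_prod_type]
    simp only [sum_doubleKernel_snd hf h₁ h₂, and_true, Finset.sum_const, Finset.card_univ,
      Fintype.card_prod, Fintype.card_fin, nsmul_eq_mul, Nat.cast_mul, mul_ite, mul_zero]
    rw [mul_inv_cancel₀ (mul_ne_zero n₁ n₂)]

theorem eprFidelity_ofChoi_doubleKernel [Fintype A] [Fintype β] [Fintype γ]
    (h₁ : IsRainsTest E₁ d₁) (h₂ : IsRainsTest E₂ d₂)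
    (τ : Matrix (A × β × γ) (A × β × γ) ℂ) :
    eprFidelity (ofChoi (doubleKernel f E₁ E₂ d₁ d₂) τ) = (∑ m, ∑ m', τ m m' *
      (E₁ ((f m.1).1, m.2.1) ((f m'.1).1, m'.2.1) *
        E₂ ((f m.1).2, m.2.2) ((f m'.1).2, m'.2.2))).re := by
  have n₁ : (d₁ : ℂ) ≠ 0 := by exact_mod_cast h₁.pos.ne'
  have n₂ : (d₂ : ℂ) ≠ 0 := by exact_mod_cast h₂.pos.ne'
  rw [eprFidelity_eq]
  simp only [ofChoi_apply]
  congr 1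
  have e : ∑ s, ∑ s', ∑ m, ∑ m', τ m m' *
      doubleKernel f E₁ E₂ d₁ d₂ (m, (s, s)) (m', (s', s')) =
      ∑ m, ∑ m', τ m m' *
        ∑ s, ∑ s', doubleKernel f E₁ E₂ d₁ d₂ (m, (s, s)) (m', (s', s')) := by
    simp only [Finset.mul_sum]
    rw [sum_sum_comm]
  rw [e]
  simp only [sum_doubleKernel_diag h₁ h₂, Finset.mul_sum]
  refine Finset.sum_congr rfl fun m _ => Finset.sum_congr rfl fun m' _ => ?_
  field_simp

end DoubleKernel

/-! ### From combing operations to codes -/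

/-- The amplitude of the basis states in the maximally entangled vector on `a × a`. -/
def eprAmplitude (a : Type*) [Fintype a] : ℂ := (((√(Fintype.card a : ℝ))⁻¹ : ℝ) : ℂ)

theorem star_eprAmplitude {a : Type*} [Fintype a] : star (eprAmplitude a) = eprAmplitude a := Complex.conj_ofReal _

theorem eprAmplitude_mul_self {a : Type*} [Fintype a] :
    eprAmplitude a * eprAmplitude a = (Fintype.card a : ℂ)⁻¹ := by
  rw [eprAmplitude, ← Complex.ofReal_mul, ← mul_inv, Real.mul_self_sqrt (Nat.cast_nonneg _)]
  push_cast
  rfl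

section Combing

variable {a b c : Type*} [Fintype a] [Fintype b] [Fintype c]
    [DecidableEq a] [DecidableEq b] [DecidableEq c] {r₁ r₂ : ℕ}

/-- The kernel of the test for two EPR pairs. -/
def eprKernel (r₁ r₂ : ℕ) :
    Matrix (((Fin r₁ × Fin r₂) × Fin r₁ × Fin r₂) × ((Fin r₁ × Fin r₂) × Fin r₁ × Fin r₂))
      (((Fin r₁ × Fin r₂) × Fin r₁ × Fin r₂) × ((Fin r₁ × Fin r₂) × Fin r₁ × Fin r₂)) ℂ :=
  doubleKernel id (epr (Fin r₁)) (epr (Fin r₂)) r₁ r₂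

/-- The Choi matrix of the decoder of the code built from the operation `Y`. -/
def combingDecoderChoi
    (Y : Matrix (a × b × c) (a × b × c) ℂ →ₗ[ℂ]
      Matrix ((Fin r₁ × Fin r₂) × Fin r₁ × Fin r₂) ((Fin r₁ × Fin r₂) × Fin r₁ × Fin r₂) ℂ) :
    Matrix ((((Fin r₁ × Fin r₂) × a) × b × c) × (Fin r₁ × Fin r₂))
      ((((Fin r₁ × Fin r₂) × a) × b × c) × (Fin r₁ × Fin r₂)) ℂ :=
  Matrix.of fun p q => (r₁ * r₂ : ℂ) * ∑ m, ∑ m',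
    choiMatrix Y ((p.1.1.2, p.1.2), m) ((q.1.1.2, q.1.2), m') *
      eprKernel r₁ r₂ (m, (p.1.1.1, p.2)) (m', (q.1.1.1, q.2))

theorem posSemidef_combingDecoderChoi
    {Y : Matrix (a × b × c) (a × b × c) ℂ →ₗ[ℂ]
      Matrix ((Fin r₁ × Fin r₂) × Fin r₁ × Fin r₂) ((Fin r₁ × Fin r₂) × Fin r₁ × Fin r₂) ℂ}
    (hY : IsPPTPreserving Y) (h₁ : 0 < r₁) (h₂ : 0 < r₂) :
    (combingDecoderChoi Y).PosSemidef := by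
  have hK := (isPPTPreserving_ofChoi_doubleKernel (A := Fin r₁ × Fin r₂) Function.injective_id
    (isRainsTest_epr h₁) (isRainsTest_epr h₂)).isChannel.posSemidef_choiMatrix
  rw [choiMatrix_ofChoi] at hK
  have := posSemidef_contract (posSemidef_mul_entries
    (hY.isChannel.posSemidef_choiMatrix.submatrix
      fun x : ((((Fin r₁ × Fin r₂) × a) × b × c) × (Fin r₁ × Fin r₂)) ×
        ((Fin r₁ × Fin r₂) × Fin r₁ × Fin r₂) => ((x.1.1.1.2, x.1.1.2), x.2))
    (hK.submatrix
      fun x : ((((Fin r₁ × Fin r₂) × a) × b × c) × (Fin r₁ × Fin r₂)) ×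
        ((Fin r₁ × Fin r₂) × Fin r₁ × Fin r₂) => (x.2, (x.1.1.1.1, x.1.2))))
  exact this.smul (a := (r₁ * r₂ : ℂ)) (by positivity)

/-- The twirled output has marginal `1 / (r₁ r₂)` on Alice's index, uncorrelated with the rest, so
rescaling by `r₁ r₂` makes this index an input of a trace-preserving map. -/
theorem sum_combingDecoderChoi
    {Y : Matrix (a × b × c) (a × b × c) ℂ →ₗ[ℂ]
      Matrix ((Fin r₁ × Fin r₂) × Fin r₁ × Fin r₂) ((Fin r₁ × Fin r₂) × Fin r₁ × Fin r₂) ℂ}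
    (hY : IsPPTPreserving Y) (h₁ : 0 < r₁) (h₂ : 0 < r₂) (i j : ((Fin r₁ × Fin r₂) × a) × b × c) :
    ∑ u, combingDecoderChoi Y (i, u) (j, u) = if i = j then 1 else 0 := by
  have n₁ : (r₁ : ℂ) ≠ 0 := by exact_mod_cast h₁.ne'
  have n₂ : (r₂ : ℂ) ≠ 0 := by exact_mod_cast h₂.ne'
  obtain ⟨⟨s, x⟩, w⟩ := i
  obtain ⟨⟨s', x'⟩, w'⟩ := j
  have hK := sum_doubleKernel_snd (A := Fin r₁ × Fin r₂) Function.injective_id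
    (isRainsTest_epr h₁) (isRainsTest_epr h₂)
  have hYs := hY.isChannel.sum_choiMatrix (x, w) (x', w')
  have e : ∑ u, combingDecoderChoi Y (((s, x), w), u) (((s', x'), w'), u) =
      (r₁ * r₂ : ℂ) * ∑ m, ∑ m', choiMatrix Y ((x, w), m) ((x', w'), m') *
        ∑ u, eprKernel r₁ r₂ (m, (s, u)) (m', (s', u)) := by
    simp only [combingDecoderChoi, Matrix.of_apply, ← Finset.mul_sum]
    rw [Finset.sum_comm]
    congr 1
    refine Finset.sum_congr rfl fun m _ => ?_
    rw [Finset.sum_comm]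
    simp only [Finset.mul_sum]
  rw [e]
  simp only [eprKernel, hK]
  by_cases hs : s = s'
  · simp only [hs, and_true, mul_ite, mul_zero, Finset.sum_ite_eq, Finset.mem_univ, if_true,
      ← Finset.sum_mul, hYs, Prod.mk.injEq, true_and]
    split_ifs
    · field_simp
    · simp_all
  · simp [hs]

theorem sum_mul_eprPair
    (σ : Matrix ((Fin r₁ × Fin r₂) × (Fin r₁ × Fin r₂)) ((Fin r₁ × Fin r₂) × (Fin r₁ × Fin r₂)) ℂ) :
    eprFidelity σ = (∑ m, ∑ m', σ m m' * eprPair r₁ r₂ m m').re := by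
  rw [eprFidelity]
  congr 1
  simp only [Matrix.trace, Matrix.diag_apply, Matrix.mul_apply]
  rw [Finset.sum_comm]
  refine Finset.sum_congr rfl fun m _ => Finset.sum_congr rfl fun m' _ => ?_
  rw [eprPair_apply, eprPair_apply]
  ring

variable {n : ℕ} (e : Fin n ≃ (Fin r₁ × Fin r₂) × a)

/-- The isometry `|s⟩ ↦ ∑ x, |x⟩|s x⟩ / √|a|`. -/
def eprEncoder : Matrix (a × Fin n) (Fin r₁ × Fin r₂) ℂ :=
  Matrix.of fun y s => if e y.2 = (s, y.1) then eprAmplitude a else 0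

theorem eprEncoder_isometry [Nonempty a] :
    (eprEncoder e).conjTranspose * eprEncoder e = 1 := by
  ext s s'
  have hc : (Fintype.card a : ℂ) ≠ 0 := by exact_mod_cast Fintype.card_ne_zero
  simp only [eprEncoder, Matrix.mul_apply, Matrix.conjTranspose_apply, Matrix.of_apply,
    Fintype.sum_prod_type (α₁ := a), apply_ite star, star_zero, star_eprAmplitude]
  have hr (x : a) : ∑ r, (if e r = (s, x) then eprAmplitude a else 0) *
      (if e r = (s', x) then eprAmplitude a else 0) =
      if s = s' then (Fintype.card a : ℂ)⁻¹ else 0 := by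
    rw [Equiv.sum_comp e (fun t => (if t = (s, x) then eprAmplitude a else 0) *
      (if t = (s', x) then eprAmplitude a else 0))]
    by_cases hs : s = s'
    · simp [hs, eprAmplitude_mul_self]
    · simp [hs, Ne.symm hs]
  rw [Finset.sum_congr rfl fun x _ => hr x]
  by_cases hs : s = s' <;> simp [Matrix.one_apply, hs, hc]

/-- The decoder of the code built from the operation `Y`. -/
def combingDecoder
    (Y : Matrix (a × b × c) (a × b × c) ℂ →ₗ[ℂ]
      Matrix ((Fin r₁ × Fin r₂) × Fin r₁ × Fin r₂) ((Fin r₁ × Fin r₂) × Fin r₁ × Fin r₂) ℂ) :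
    Matrix (Fin n × b × c) (Fin n × b × c) ℂ →ₗ[ℂ] Matrix (Fin r₁ × Fin r₂) (Fin r₁ × Fin r₂) ℂ :=
  ofChoi ((combingDecoderChoi Y).submatrix
    (fun p => ((e p.1.1, p.1.2), p.2)) fun p => ((e p.1.1, p.1.2), p.2))

theorem isChannel_combingDecoder
    {Y : Matrix (a × b × c) (a × b × c) ℂ →ₗ[ℂ]
      Matrix ((Fin r₁ × Fin r₂) × Fin r₁ × Fin r₂) ((Fin r₁ × Fin r₂) × Fin r₁ × Fin r₂) ℂ}
    (hY : IsPPTPreserving Y) (h₁ : 0 < r₁) (h₂ : 0 < r₂) :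
    IsChannel (combingDecoder e Y) := by
  refine isChannel_of_choiMatrix ?_ fun i j => ?_
  · rw [combingDecoder, choiMatrix_ofChoi]
    exact (posSemidef_combingDecoderChoi hY h₁ h₂).submatrix _
  · have h := sum_combingDecoderChoi hY h₁ h₂ (e i.1, i.2) (e j.1, j.2)
    rw [combingDecoder, choiMatrix_ofChoi]
    simp only [Matrix.submatrix_apply]
    rw [h]
    simp only [Prod.mk.injEq, e.apply_eq_iff_eq, ← Prod.ext_iff]

/-- The code built from the operation `Y`: Alice keeps half of an EPR pair, and the decoder applies
`Y` to the other half and the channel output and teleports Alice's input through the result. -/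
def combingCode
    (Y : Matrix (a × b × c) (a × b × c) ℂ →ₗ[ℂ]
      Matrix ((Fin r₁ × Fin r₂) × Fin r₁ × Fin r₂) ((Fin r₁ × Fin r₂) × Fin r₁ × Fin r₂) ℂ)
    (hY : IsPPTPreserving Y) (h₁ : 0 < r₁) (h₂ : 0 < r₂) [Nonempty a] :
    ForwardAssistedCode a b c r₁ r₂ where
  dimR := n
  encoder := eprEncoder e
  encoder_isometry := eprEncoder_isometry e
  decoder := combingDecoder e Y
  decoder_isChannel := isChannel_combingDecoder e hY h₁ h₂

variable {Y : Matrix (a × b × c) (a × b × c) ℂ →ₗ[ℂ]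
      Matrix ((Fin r₁ × Fin r₂) × Fin r₁ × Fin r₂) ((Fin r₁ × Fin r₂) × Fin r₁ × Fin r₂) ℂ}
    (hY : IsPPTPreserving Y) (h₁ : 0 < r₁) (h₂ : 0 < r₂) [Nonempty a]

/-- The encoder correlates the forwarded `x` perfectly with `A'`, so the decoder's input index `x`
reappears as Alice's output index, with weight `1 / |a|`. -/
theorem choiMatrix_operation_combingCode (s s' : Fin r₁ × Fin r₂) (w w' : b × c) (x x' : a)
    (u u' : Fin r₁ × Fin r₂) :
    choiMatrix (combingCode e Y hY h₁ h₂).operation ((s, w), (x, u)) ((s', w'), (x', u')) =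
      (Fintype.card a : ℂ)⁻¹ *
        combingDecoderChoi Y (((s, x), w), u) (((s', x'), w'), u') := by
  rw [ForwardAssistedCode.choiMatrix_operation]
  change ∑ r : Fin n, ∑ r' : Fin n, eprEncoder e (x, r) s * star (eprEncoder e (x', r') s') *
    choiMatrix (combingDecoder e Y) ((r, w), u) ((r', w'), u') = _
  simp only [combingDecoder, choiMatrix_ofChoi, eprEncoder, Matrix.of_apply, Matrix.submatrix_apply,
    apply_ite star, star_zero, star_eprAmplitude]
  rw [Finset.sum_eq_single (e.symm (s, x)), Finset.sum_eq_single (e.symm (s', x'))]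
  · simp only [Equiv.apply_symm_apply, if_true, eprAmplitude_mul_self]
  · intro t _ ht
    have : e t ≠ (s', x') := fun h => ht (by rw [← h, e.symm_apply_apply])
    simp [this]
  · simp
  · intro t _ ht
    have : e t ≠ (s, x) := fun h => ht (by rw [← h, e.symm_apply_apply])
    simp [this]
  · simp

theorem isPPTPreserving_operation_combingCode :
    IsPPTPreserving (combingCode e Y hY h₁ h₂).operation := by
  have hc : (Fintype.card a : ℂ) ≠ 0 := by exact_mod_cast Fintype.card_ne_zero
  refine isPPTPreserving_of_isPPT ?_ fun i j => ?_
  -- Up to positive scalars this is the Choi matrix of the twirl after `Y`, with Alice's two indices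
  -- trading the roles of input and output. Her share is the same, hence so are the partial
  -- transposes.
  · have := ((hY.isPPT.link (isPPT_doubleKernel (f := id) (isRainsTest_epr h₁) (isRainsTest_epr h₂))
      (α := (Fin r₁ × Fin r₂) × a) (β := b × Fin r₁) (γ := c × Fin r₂)
      (μ := Fin r₁ × Fin r₂) (ν := Fin r₁) (κ := Fin r₂)
      (fun t => (t.1.2, t.2)) (fun t => (t.1.1, t.2)) (fun t => (t.1.1, t.2))
      (fun t => (t.2, t.1.1)) (fun t => (t.2, t.1.2)) (fun t => (t.2, t.1.2))).smul
      (z := (r₁ * r₂ : ℂ)) (by positivity)).smul (z := (Fintype.card a : ℂ)⁻¹)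
      (by rw [inv_nonneg]; positivity)
    convert this using 1
    ext p q
    exact choiMatrix_operation_combingCode e hY h₁ h₂ _ _ _ _ _ _ _ _
  · obtain ⟨s, w⟩ := i
    obtain ⟨s', w'⟩ := j
    rw [Fintype.sum_prod_type]
    simp only [choiMatrix_operation_combingCode, ← Finset.mul_sum,
      sum_combingDecoderChoi hY h₁ h₂]
    simp [Prod.ext_iff, hc]

theorem fidelity_combingCode (N : Matrix a a ℂ →ₗ[ℂ] Matrix (b × c) (b × c) ℂ) :
    (combingCode e Y hY h₁ h₂).fidelity N = eprFidelity (Y (choiState N)) := by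
  have n₁ : (r₁ : ℂ) ≠ 0 := by exact_mod_cast h₁.ne'
  have n₂ : (r₂ : ℂ) ≠ 0 := by exact_mod_cast h₂.ne'
  rw [ForwardAssistedCode.fidelity_eq, eprFidelity_eq, sum_mul_eprPair]
  congr 1
  simp only [Matrix.smul_apply, smul_eq_mul, ForwardAssistedCode.choiMatrix_inducedChannel,
    choiMatrix_operation_combingCode, combingDecoderChoi, Matrix.of_apply, map_apply_eq_sum Y,
    choiState_apply, ← Finset.mul_sum, Finset.sum_mul]
  -- Summing the kernel over `s`, `s'` leaves the projector onto the EPR pairs, which expresses that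
  -- the twirl does not change the fidelity.
  have hsum : ∑ s, ∑ s', ∑ p : a × b × c, ∑ p' : a × b × c, choiMatrix N p p' *
      ((Fintype.card a : ℂ)⁻¹ * ((r₁ * r₂ : ℂ) * ∑ m, ∑ m', choiMatrix Y (p, m) (p', m') *
        eprKernel r₁ r₂ (m, (s, s)) (m', (s', s')))) =
      ∑ p : a × b × c, ∑ p' : a × b × c, choiMatrix N p p' *
      ((Fintype.card a : ℂ)⁻¹ * ((r₁ * r₂ : ℂ) * ∑ m, ∑ m', choiMatrix Y (p, m) (p', m') *
        ((r₁ * r₂ : ℂ) * eprPair r₁ r₂ m m'))) := by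
    rw [sum_sum_comm]
    refine Finset.sum_congr rfl fun p _ => Finset.sum_congr rfl fun p' _ => ?_
    simp only [← Finset.mul_sum]
    rw [sum_sum_comm]
    simp only [← Finset.mul_sum, eprKernel,
      sum_doubleKernel_diag (isRainsTest_epr h₁) (isRainsTest_epr h₂)]
    rfl
  refine (congrArg (fun t => ((r₁ : ℂ) * r₂)⁻¹ * (((r₁ : ℂ) * r₂)⁻¹ * t)) hsum).trans ?_
  simp only [Finset.mul_sum]
  rw [sum_sum_comm]
  refine Finset.sum_congr rfl fun m _ => Finset.sum_congr rfl fun m' _ => Finset.sum_congr rfl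
    fun p _ => Finset.sum_congr rfl fun p' _ => ?_
  field_simp

end Combing

/-! ### From codes to combing operations -/

section Simulation

variable {a b c : Type*} [Fintype a] [Fintype b] [Fintype c]
    [DecidableEq a] [DecidableEq b] [DecidableEq c] {r₁ r₂ : ℕ}

/-- `K` is the kernel of a simulation of `N` that consumes one copy of the state `ρ`: the first index
is that of the state, the second that of the channel input and output. -/
structure IsSimulationKernel (N : Matrix a a ℂ →ₗ[ℂ] Matrix (b × c) (b × c) ℂ)
    (ρ : Matrix (a × b × c) (a × b × c) ℂ)
    (K : Matrix ((a × b × c) × (a × b × c)) ((a × b × c) × (a × b × c)) ℂ) : Prop where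
  isPPT : IsPPT (regroup K)
  sum_snd : ∀ p p' x x', ∑ w, K (p, (x, w)) (p', (x', w)) = if p = p' ∧ x = x' then 1 else 0
  choiMatrix_eq : ∀ q q', choiMatrix N q q' = ∑ p, ∑ p', ρ p p' * K (p, q) (p', q')

theorem measureOut_single {b : Type*} (O : Matrix (a × a) (a × a) ℂ)
    (ρ : Matrix (a × b) (a × b) ℂ) (x x' : a) (y y' : b) :
    measureOut O (Matrix.single x x' 1) ρ y y' =
      ∑ t, ∑ t', O (x', t') (x, t) * ρ (t, y) (t', y') := by
  simp only [measureOut, Matrix.of_apply, Fintype.sum_prod_type]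
  rw [Finset.sum_eq_single x']
  · rw [Finset.sum_comm]
    rw [Finset.sum_eq_single x]
    · rw [Finset.sum_comm]
      simp
    · intro i _ hi
      simp [hi.symm]
    · simp
  · intro i _ hi
    simp [hi.symm]
  · simp

theorem tensorMap_apply {b' c' : Type*} (Φ : Matrix b b ℂ →ₗ[ℂ] Matrix b' b' ℂ)
    (Ψ : Matrix c c ℂ →ₗ[ℂ] Matrix c' c' ℂ) (X : Matrix (b × c) (b × c) ℂ) (u u' : b' × c') :
    tensorMap Φ Ψ X u u' = ∑ w, ∑ w', X w w' *
      (choiMatrix Φ (w.1, u.1) (w'.1, u'.1) * choiMatrix Ψ (w.2, u.2) (w'.2, u'.2)) := by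
  change Ψ (Matrix.of fun k l => Φ (Matrix.of fun i j => X (i, k) (j, l)) u.1 u'.1) u.2 u'.2 = _
  rw [map_apply_eq_sum]
  simp only [Matrix.of_apply, map_apply_eq_sum Φ, Finset.sum_mul, Fintype.sum_prod_type]
  have e (f : c → c → b → b → ℂ) :
      ∑ k, ∑ l, ∑ i, ∑ j, f k l i j = ∑ i, ∑ k, ∑ j, ∑ l, f k l i j := by
    simp only [← Fintype.sum_prod_type']
    exact Fintype.sum_equiv
      { toFun := fun t => (t.2.2.1, t.1, t.2.2.2, t.2.1)
        invFun := fun t => (t.2.1, t.2.2.2, t.1, t.2.2.1)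
        left_inv := fun t => rfl
        right_inv := fun t => rfl } _ _ fun t => rfl
  rw [e]
  simp only [mul_assoc]

/-- The kernel of a teleportation simulation. -/
def teleportationKernel {ι₁ ι₂ : Type*} [Fintype ι₁] [Fintype ι₂]
    (O : ι₁ → ι₂ → Matrix (a × a) (a × a) ℂ) (V₁ : ι₁ → (Matrix b b ℂ →ₗ[ℂ] Matrix b b ℂ))
    (V₂ : ι₂ → (Matrix c c ℂ →ₗ[ℂ] Matrix c c ℂ)) :
    Matrix ((a × b × c) × (a × b × c)) ((a × b × c) × (a × b × c)) ℂ :=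
  ∑ l₁, ∑ l₂, Matrix.of fun i j => O l₁ l₂ (j.2.1, j.1.1) (i.2.1, i.1.1) *
    (choiMatrix (V₁ l₁) (i.1.2.1, i.2.2.1) (j.1.2.1, j.2.2.1) *
      choiMatrix (V₂ l₂) (i.1.2.2, i.2.2.2) (j.1.2.2, j.2.2.2))

/-- For fixed messages the kernel is a product of local positive operators, and classical
communication merely sums such products. The effects enter transposed because the kernel is paired
with the state entrywise, without a transpose. -/
theorem IsTeleportationSimulable.exists_isSimulationKernel
    {N : Matrix a a ℂ →ₗ[ℂ] Matrix (b × c) (b × c) ℂ} (h : IsTeleportationSimulable N) :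
    ∃ K, IsSimulationKernel N (choiState N) K := by
  obtain ⟨m₁, m₂, O, V₁, V₂, hO, hO1, hV₁, hV₂, hN⟩ := h
  refine ⟨teleportationKernel O V₁ V₂, ?_, ?_, ?_⟩
  · have := IsPPT.sum Finset.univ fun l₁ _ => IsPPT.sum Finset.univ fun l₂ _ => IsPPT.product
      ((hO l₁ l₂).transpose.submatrix fun x : a × a => (x.2, x.1))
      (hV₁ l₁).posSemidef_choiMatrix (hV₂ l₂).posSemidef_choiMatrix
    convert this using 1
    ext p q
    simp only [regroup, teleportationKernel, Matrix.of_apply, Matrix.sum_apply]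
    rfl
  · rintro ⟨t, y, z⟩ ⟨t', y', z'⟩ x x'
    have hs₁ := fun l₁ => (hV₁ l₁).sum_choiMatrix y y'
    have hs₂ := fun l₂ => (hV₂ l₂).sum_choiMatrix z z'
    have hO' : ∑ l₁, ∑ l₂, O l₁ l₂ (x', t') (x, t) = if x = x' ∧ t = t' then 1 else 0 := by
      have := congrFun₂ hO1 (x', t') (x, t)
      simp only [Matrix.sum_apply] at this
      rw [this, Matrix.one_apply]
      simp only [Prod.mk.injEq, eq_comm]
    simp only [teleportationKernel, Matrix.of_apply, Matrix.sum_apply]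
    rw [Finset.sum_comm]
    have (l₁ : Fin m₁) : ∑ w : b × c, ∑ l₂, O l₁ l₂ (x', t') (x, t) *
        (choiMatrix (V₁ l₁) (y, w.1) (y', w.1) * choiMatrix (V₂ l₂) (z, w.2) (z', w.2)) =
        (∑ l₂, O l₁ l₂ (x', t') (x, t)) * ((if y = y' then 1 else 0) * if z = z' then 1 else 0) := by
      rw [Finset.sum_comm, Finset.sum_mul]
      refine Finset.sum_congr rfl fun l₂ _ => ?_
      rw [← Finset.mul_sum, Fintype.sum_prod_type, ← hs₁ l₁, ← hs₂ l₂, Finset.sum_mul_sum]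
    rw [Finset.sum_congr rfl fun l₁ _ => this l₁, ← Finset.sum_mul, hO']
    simp only [Prod.mk.injEq, ite_zero_mul_ite_zero, mul_one]
    congr 1
    simp only [eq_iff_iff]
    tauto
  · rintro ⟨x, w⟩ ⟨x', w'⟩
    rw [choiMatrix_apply, hN]
    simp only [Matrix.sum_apply, tensorMap_apply, measureOut_single, teleportationKernel,
      Matrix.of_apply, Finset.mul_sum, Finset.sum_mul, Fintype.sum_prod_type (α₁ := a)]
    have e (f : Fin m₁ → Fin m₂ → b × c → b × c → a → a → ℂ) :
        ∑ l₁, ∑ l₂, ∑ v, ∑ v', ∑ t, ∑ t', f l₁ l₂ v v' t t' =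
          ∑ t, ∑ v, ∑ t', ∑ v', ∑ l₁, ∑ l₂, f l₁ l₂ v v' t t' := by
      simp only [← Fintype.sum_prod_type']
      exact Fintype.sum_equiv
        { toFun := fun t => (t.2.2.2.2.1, t.2.2.1, t.2.2.2.2.2, t.2.2.2.1, t.1, t.2.1)
          invFun := fun t => (t.2.2.2.2.1, t.2.2.2.2.2, t.2.1, t.2.2.2.1, t.1, t.2.2.1)
          left_inv := fun t => rfl
          right_inv := fun t => rfl } _ _ fun t => rfl
    rw [e]
    refine Finset.sum_congr rfl fun t _ => Finset.sum_congr rfl fun v _ => Finset.sum_congr rfl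
      fun t' _ => Finset.sum_congr rfl fun v' _ => Finset.sum_congr rfl fun l₁ _ =>
      Finset.sum_congr rfl fun l₂ _ => ?_
    ring

/-- The Choi matrix of the combing operation obtained from a code and a simulation. -/
def simulationChoi (Z : ForwardAssistedCode a b c r₁ r₂)
    (K : Matrix ((a × b × c) × (a × b × c)) ((a × b × c) × (a × b × c)) ℂ) :
    Matrix ((a × b × c) × ((Fin r₁ × Fin r₂) × Fin r₁ × Fin r₂))
      ((a × b × c) × ((Fin r₁ × Fin r₂) × Fin r₁ × Fin r₂)) ℂ :=
  Matrix.of fun i j => ((r₁ : ℂ) * r₂)⁻¹ * ∑ q, ∑ q',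
    choiMatrix Z.operation ((i.2.1, q.2), (q.1, i.2.2)) ((j.2.1, q'.2), (q'.1, j.2.2)) *
      K (i.1, q) (j.1, q')

/-- Once the decoder's output is discarded, what is left is the reduced state on `A'` of the encoded
basis vector `s`. -/
theorem sum_choiMatrix_operation (Z : ForwardAssistedCode a b c r₁ r₂) (s : Fin r₁ × Fin r₂)
    (w w' : b × c) (x x' : a) :
    ∑ u, choiMatrix Z.operation ((s, w), (x, u)) ((s, w'), (x', u)) =
      if w = w' then ∑ r, Z.encoder (x, r) s * star (Z.encoder (x', r) s) else 0 := by
  have h := Z.decoder_isChannel.sum_choiMatrix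
  simp only [ForwardAssistedCode.choiMatrix_operation]
  rw [Finset.sum_comm]
  simp only [Finset.sum_comm (s := (Finset.univ : Finset (Fin r₁ × Fin r₂))), ← Finset.mul_sum, h]
  by_cases hw : w = w' <;> simp [hw]

variable {N : Matrix a a ℂ →ₗ[ℂ] Matrix (b × c) (b × c) ℂ}
  {ρ : Matrix (a × b × c) (a × b × c) ℂ}
  {K : Matrix ((a × b × c) × (a × b × c)) ((a × b × c) × (a × b × c)) ℂ} {Z : ForwardAssistedCode a b c r₁ r₂}

/-- The operation prepares a maximally entangled state of `A₁A₂` with a copy, which accounts for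
`(r₁ r₂)⁻¹`, encodes one half, simulates `N` by means of the shared state, and decodes. -/
theorem isPPTPreserving_ofChoi_simulationChoi (hK : IsSimulationKernel N ρ K) (h₁ : 0 < r₁) (h₂ : 0 < r₂)
    (hZ : IsPPTPreserving Z.operation) :
    IsPPTPreserving (ofChoi (simulationChoi Z K)) := by
  have n₁ : (r₁ : ℂ) ≠ 0 := by exact_mod_cast h₁.ne'
  have n₂ : (r₂ : ℂ) ≠ 0 := by exact_mod_cast h₂.ne'
  refine isPPTPreserving_of_isPPT ?_ fun i j => ?_
  · rw [choiMatrix_ofChoi]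
    exact (hZ.isPPT.link hK.isPPT
      (α := a × (Fin r₁ × Fin r₂)) (β := b × Fin r₁) (γ := c × Fin r₂)
      (μ := a) (ν := b) (κ := c)
      (fun t => (t.1.2, t.2)) (fun t => (t.2, t.1.2)) (fun t => (t.2, t.1.2))
      (fun t => (t.1.1, t.2)) (fun t => (t.1.1, t.2)) (fun t => (t.1.1, t.2))).smul
      (z := ((r₁ : ℂ) * r₂)⁻¹) (by rw [inv_nonneg]; positivity)
  · rw [choiMatrix_ofChoi]
    simp only [simulationChoi, Matrix.of_apply, ← Finset.mul_sum]
    rw [Fintype.sum_prod_type]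
    have e : ∑ s : Fin r₁ × Fin r₂, ∑ u : Fin r₁ × Fin r₂, ∑ q : a × b × c, ∑ q' : a × b × c,
        choiMatrix Z.operation ((s, q.2), (q.1, u)) ((s, q'.2), (q'.1, u)) *
          K (i, q) (j, q') =
        ∑ s : Fin r₁ × Fin r₂, ∑ x, ∑ x', (∑ r, Z.encoder (x, r) s * star (Z.encoder (x', r) s)) *
          ∑ w, K (i, (x, w)) (j, (x', w)) := by
      refine Finset.sum_congr rfl fun s _ => ?_
      rw [Finset.sum_comm]
      simp only [Finset.sum_comm (s := (Finset.univ : Finset (Fin r₁ × Fin r₂))), ← Finset.sum_mul,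
        sum_choiMatrix_operation, Fintype.sum_prod_type (α₁ := a), ite_mul, zero_mul]
      refine Finset.sum_congr rfl fun x _ => ?_
      rw [Finset.sum_comm]
      refine Finset.sum_congr rfl fun x' _ => ?_
      simp [Finset.mul_sum]
    have ht : ∑ s, ∑ x, ∑ r, Z.encoder (x, r) s * star (Z.encoder (x, r) s) = r₁ * r₂ := by
      have := fun s => Z.sum_star_encoder_mul s s
      simp only [Fintype.sum_prod_type (α₁ := a), if_true] at this
      simp only [mul_comm (Z.encoder _ _), this]
      simp
    rw [e]
    simp only [hK.sum_snd]
    by_cases hij : i = j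
    · simp only [hij, true_and, mul_ite, mul_one, mul_zero, Finset.sum_ite_eq, Finset.mem_univ,
        if_true, ht]
      field_simp
    · simp [hij]

theorem eprFidelity_ofChoi_simulationChoi (hK : IsSimulationKernel N ρ K) :
    eprFidelity (ofChoi (simulationChoi Z K) ρ) = Z.fidelity N := by
  rw [ForwardAssistedCode.fidelity_eq]
  congr 1
  ext t t'
  simp only [Matrix.smul_apply, smul_eq_mul, ofChoi_apply, simulationChoi, Matrix.of_apply]
  have e : choiMatrix (Z.inducedChannel N) t t' = _ :=
    Z.choiMatrix_inducedChannel N t.1 t'.1 t.2 t'.2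
  rw [e]
  simp only [hK.choiMatrix_eq, Finset.mul_sum, Finset.sum_mul]
  rw [sum_sum_comm]
  refine Finset.sum_congr rfl fun _ _ => Finset.sum_congr rfl fun _ _ => Finset.sum_congr rfl
    fun _ _ => Finset.sum_congr rfl fun _ _ => ?_
  ring

end Simulation

/-! ### Tensor powers -/

section Powers

variable {a b c a' b' c' : Type*} {n : ℕ}

/-- Families of triples as triples of families. -/
def tripleEquiv (ι a b c : Type*) : (ι → a × b × c) ≃ (ι → a) × (ι → b) × (ι → c) where
  toFun p := (fun i => (p i).1, fun i => (p i).2.1, fun i => (p i).2.2)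
  invFun p i := (p.1 i, p.2.1 i, p.2.2 i)
  left_inv _ := rfl
  right_inv _ := rfl

theorem sum_prod_pi {ι κ : Type*} [Fintype ι] [DecidableEq ι] [Fintype κ] (f : ι → κ → ℂ) :
    ∑ x : ι → κ, ∏ i, f i (x i) = ∏ i, ∑ t, f i t := by
  rw [Finset.prod_univ_sum, Fintype.piFinset_univ]

theorem sum_prod_triple [Fintype a] [Fintype b] [Fintype c] {ι : Type*} [Fintype ι] [DecidableEq ι]
    (f : ι → a × b × c → ℂ) :
    ∑ p : (ι → a) × (ι → b) × (ι → c), ∏ i, f i (p.1 i, p.2.1 i, p.2.2 i) =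
      ∏ i, ∑ t, f i t := by
  rw [← sum_prod_pi]
  exact (Fintype.sum_equiv (tripleEquiv ι a b c) _ _ fun _ => rfl).symm

theorem sum_sum_prod_triple [Fintype a] [Fintype b] [Fintype c] {ι : Type*} [Fintype ι]
    [DecidableEq ι] (f : ι → a × b × c → a × b × c → ℂ) :
    ∑ p : (ι → a) × (ι → b) × (ι → c), ∑ q : (ι → a) × (ι → b) × (ι → c),
      ∏ i, f i (p.1 i, p.2.1 i, p.2.2 i) (q.1 i, q.2.1 i, q.2.2 i) =
      ∏ i, ∑ t, ∑ t', f i t t' := by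
  rw [← sum_prod_triple fun i t => ∑ t', f i t t']
  refine Finset.sum_congr rfl fun p _ => ?_
  exact sum_prod_triple fun i t' => f i (p.1 i, p.2.1 i, p.2.2 i) t'

/-- The tensor power of an operator on `(ABC)(A'B'C')`. -/
def piPow (M : Matrix ((a × b × c) × (a' × b' × c')) ((a × b × c) × (a' × b' × c')) ℂ) (n : ℕ) :
    Matrix (((Fin n → a) × (Fin n → b) × (Fin n → c)) ×
        ((Fin n → a') × (Fin n → b') × (Fin n → c')))
      (((Fin n → a) × (Fin n → b) × (Fin n → c)) ×
        ((Fin n → a') × (Fin n → b') × (Fin n → c'))) ℂ :=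
  Matrix.of fun p q => ∏ i, M ((p.1.1 i, p.1.2.1 i, p.1.2.2 i), (p.2.1 i, p.2.2.1 i, p.2.2.2 i))
    ((q.1.1 i, q.1.2.1 i, q.1.2.2 i), (q.2.1 i, q.2.2.1 i, q.2.2.2 i))

theorem isPPT_regroup_piPow [Fintype a] [Fintype b] [Fintype c] [Fintype a'] [Fintype b']
    [Fintype c']
    {M : Matrix ((a × b × c) × (a' × b' × c')) ((a × b × c) × (a' × b' × c')) ℂ}
    (hM : IsPPT (regroup M)) : IsPPT (regroup (piPow M n)) := by
  have h := (hM.pi (ι := Fin n)).submatrix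
    (fun (x : (Fin n → a) × (Fin n → a')) i => (x.1 i, x.2 i))
    (fun (x : (Fin n → b) × (Fin n → b')) i => (x.1 i, x.2 i))
    (fun (x : (Fin n → c) × (Fin n → c')) i => (x.1 i, x.2 i))
  convert h using 1
  ext p q
  simp only [regroup, piPow, Matrix.of_apply]

theorem prod_ite_triple {ι : Type*} [Fintype ι] [DecidableEq a] [DecidableEq b] [DecidableEq c]
    [DecidableEq ι] (p q : (ι → a) × (ι → b) × (ι → c)) :
    ∏ i, (if ((p.1 i, p.2.1 i, p.2.2 i) : a × b × c) = (q.1 i, q.2.1 i, q.2.2 i) then (1 : ℂ)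
      else 0) = if p = q then 1 else 0 := by
  rw [Finset.prod_ite_zero, Finset.prod_const_one]
  congr 1
  simp only [Finset.mem_univ, true_imp_iff, Prod.ext_iff, funext_iff, eq_iff_iff]
  exact ⟨fun h => ⟨fun i => (h i).1, fun i => (h i).2.1, fun i => (h i).2.2⟩,
    fun h i => ⟨h.1 i, h.2.1 i, h.2.2 i⟩⟩

theorem sum_mul_piPow [Fintype a] [Fintype b] [Fintype c]
    (M : Matrix ((a × b × c) × (a' × b' × c')) ((a × b × c) × (a' × b' × c')) ℂ)
    (ρ : Matrix (a × b × c) (a × b × c) ℂ)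
    (q q' : (Fin n → a') × (Fin n → b') × (Fin n → c')) :
    ∑ p, ∑ p', statePow ρ n p p' * piPow M n (p, q) (p', q') =
      ∏ i, ∑ p, ∑ p', ρ p p' * M (p, (q.1 i, q.2.1 i, q.2.2 i)) (p', (q'.1 i, q'.2.1 i, q'.2.2 i)) := by
  rw [← sum_sum_prod_triple fun i p p' => ρ p p' *
    M (p, (q.1 i, q.2.1 i, q.2.2 i)) (p', (q'.1 i, q'.2.1 i, q'.2.2 i))]
  simp only [Finset.prod_mul_distrib]
  rfl

section States

variable {ρ : Matrix (a × b × c) (a × b × c) ℂ}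

theorem posSemidef_statePow (hρ : ρ.PosSemidef) (n : ℕ) : (statePow ρ n).PosSemidef :=
  (posSemidef_pi (ι := Fin n) fun _ => hρ).submatrix
    fun p : (Fin n → a) × (Fin n → b) × (Fin n → c) => (tripleEquiv _ _ _ _).symm p

theorem trace_statePow [Fintype a] [Fintype b] [Fintype c] (n : ℕ) :
    (statePow ρ n).trace = ρ.trace ^ n := by
  refine (sum_prod_triple fun _ t => ρ t t).trans ?_
  simp [Matrix.trace]

end States

section Channels

theorem choiMatrix_channelPow [Fintype a] [DecidableEq a] (N : Matrix a a ℂ →ₗ[ℂ] Matrix (b × c) (b × c) ℂ) (n : ℕ) :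
    choiMatrix (channelPow N n) = statePow (choiMatrix N) n := by
  ext p q
  rw [choiMatrix_apply]
  refine (sum_single_mul p.1 q.1 fun x x' =>
    ∏ i, N (Matrix.single (x i) (x' i) 1) (p.2.1 i, p.2.2 i) (q.2.1 i, q.2.2 i)).trans ?_
  refine Finset.prod_congr rfl fun i _ => ?_
  rw [choiMatrix_apply]

theorem choiState_channelPow [Fintype a] [DecidableEq a] (N : Matrix a a ℂ →ₗ[ℂ] Matrix (b × c) (b × c) ℂ) (n : ℕ) :
    choiState (channelPow N n) = statePow (choiState N) n := by
  rw [choiState_apply, choiState_apply, choiMatrix_channelPow]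
  ext p q
  simp [statePow, Finset.prod_mul_distrib]

variable [Fintype a] [Fintype b] [Fintype c] [DecidableEq a] [DecidableEq b] [DecidableEq c]

/-- All three conditions factor over the copies. Passing to kernels makes it unnecessary to
reassemble a measurement and local channels for the tensor power. -/
theorem IsSimulationKernel.pow {N : Matrix a a ℂ →ₗ[ℂ] Matrix (b × c) (b × c) ℂ}
    {ρ : Matrix (a × b × c) (a × b × c) ℂ}
    {K : Matrix ((a × b × c) × (a × b × c)) ((a × b × c) × (a × b × c)) ℂ}
    (hK : IsSimulationKernel N ρ K) (n : ℕ) :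
    IsSimulationKernel (channelPow N n) (statePow ρ n) (piPow K n) := by
  refine ⟨isPPT_regroup_piPow hK.isPPT, fun p p' x x' => ?_, fun q q' => ?_⟩
  · have h := sum_prod_pi (ι := Fin n) fun i (w : b × c) =>
      K ((p.1 i, p.2.1 i, p.2.2 i), (x i, w)) ((p'.1 i, p'.2.1 i, p'.2.2 i), (x' i, w))
    simp only [hK.sum_snd] at h
    have h2 : ∏ i, (if ((p.1 i, p.2.1 i, p.2.2 i) : a × b × c) = (p'.1 i, p'.2.1 i, p'.2.2 i) ∧
        x i = x' i then (1 : ℂ) else 0) = if p = p' ∧ x = x' then 1 else 0 := by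
      rw [Finset.prod_ite_zero, Finset.prod_const_one]
      congr 1
      simp only [Finset.mem_univ, true_imp_iff, Prod.ext_iff, funext_iff, eq_iff_iff]
      exact ⟨fun h => ⟨⟨fun i => (h i).1.1, fun i => (h i).1.2.1, fun i => (h i).1.2.2⟩,
        fun i => (h i).2⟩, fun h i => ⟨⟨h.1.1 i, h.1.2.1 i, h.1.2.2 i⟩, h.2 i⟩⟩
    rw [← h2, ← h]
    exact (Fintype.sum_equiv (Equiv.arrowProdEquivProdArrow (Fin n) (fun _ => b) fun _ => c) _ _
      fun _ => rfl).symm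
  · rw [choiMatrix_channelPow, sum_mul_piPow]
    simp only [statePow, Matrix.of_apply]
    exact Finset.prod_congr rfl fun i _ => hK.choiMatrix_eq (q.1 i, q.2.1 i, q.2.2 i)
      (q'.1 i, q'.2.1 i, q'.2.2 i)

theorem isPPTPreserving_ofChoi_piPow [Fintype a'] [Fintype b'] [Fintype c']
    {Y : Matrix (a × b × c) (a × b × c) ℂ →ₗ[ℂ] Matrix (a' × b' × c') (a' × b' × c') ℂ}
    (hY : IsPPTPreserving Y) (n : ℕ) : IsPPTPreserving (ofChoi (piPow (choiMatrix Y) n)) := by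
  refine isPPTPreserving_of_isPPT ?_ fun p p' => ?_
  · rw [choiMatrix_ofChoi]
    exact isPPT_regroup_piPow hY.isPPT
  · rw [choiMatrix_ofChoi, ← prod_ite_triple]
    simp only [← hY.isChannel.sum_choiMatrix]
    exact sum_prod_triple fun i u => choiMatrix Y ((p.1 i, p.2.1 i, p.2.2 i), u)
      ((p'.1 i, p'.2.1 i, p'.2.2 i), u)

theorem ofChoi_piPow_statePow
    (Y : Matrix (a × b × c) (a × b × c) ℂ →ₗ[ℂ] Matrix (a' × b' × c') (a' × b' × c') ℂ)
    (ρ : Matrix (a × b × c) (a × b × c) ℂ) (n : ℕ) :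
    ofChoi (piPow (choiMatrix Y) n) (statePow ρ n) = statePow (Y ρ) n := by
  ext q q'
  rw [ofChoi_apply, sum_mul_piPow]
  refine Finset.prod_congr rfl fun i _ => ?_
  rw [map_apply_eq_sum Y]

end Channels

end Powers

/-! ### Discarding subsystems -/

section Discard

variable {A B C A' B' C' A'' B'' C'' : Type*}
  [Fintype A] [Fintype B] [Fintype C]
  [Fintype A''] [Fintype B''] [Fintype C'']
  [DecidableEq A] [DecidableEq B] [DecidableEq C]

/-- The local partial trace over the second factors. -/
def discardChoi (eA : A ≃ A' × A'') (eB : B ≃ B' × B'') (eC : C ≃ C' × C'') :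
    Matrix ((A × B × C) × (A' × B' × C')) ((A × B × C) × (A' × B' × C')) ℂ :=
  ∑ x : A'', ∑ y : B'', ∑ z : C'', Matrix.of fun p q =>
    if p.1 = (eA.symm (p.2.1, x), eB.symm (p.2.2.1, y), eC.symm (p.2.2.2, z)) ∧
      q.1 = (eA.symm (q.2.1, x), eB.symm (q.2.2.1, y), eC.symm (q.2.2.2, z)) then 1 else 0

variable (eA : A ≃ A' × A'') (eB : B ≃ B' × B'') (eC : C ≃ C' × C'')

theorem posSemidef_discard {D D' D'' : Type*} [Fintype D] [Fintype D'] [DecidableEq D]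
    (e : D ≃ D' × D'') (x : D'') :
    (Matrix.of fun p q => if p.1 = e.symm (p.2, x) ∧ q.1 = e.symm (q.2, x) then 1 else 0 :
      Matrix (D × D') (D × D') ℂ).PosSemidef := by
  let v : D × D' → ℂ := fun p => if p.1 = e.symm (p.2, x) then 1 else 0
  have h := Matrix.posSemidef_vecMulVec_self_star v
  convert h using 1
  ext p q
  by_cases hp : p.1 = e.symm (p.2, x) <;> by_cases hq : q.1 = e.symm (q.2, x) <;>
    simp [v, Matrix.vecMulVec_apply, hp, hq]

theorem ofChoi_discardChoi_apply (τ : Matrix (A × B × C) (A × B × C) ℂ) (u u' : A' × B' × C') :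
    ofChoi (discardChoi eA eB eC) τ u u' = ∑ x : A'', ∑ y : B'', ∑ z : C'',
      τ (eA.symm (u.1, x), eB.symm (u.2.1, y), eC.symm (u.2.2, z))
        (eA.symm (u'.1, x), eB.symm (u'.2.1, y), eC.symm (u'.2.2, z)) := by
  rw [ofChoi_apply]
  simp only [discardChoi, Matrix.sum_apply, Matrix.of_apply, Finset.mul_sum]
  have e (f : A × B × C → A × B × C → A'' → B'' → C'' → ℂ) :
      ∑ i, ∑ j, ∑ x, ∑ y, ∑ z, f i j x y z = ∑ x, ∑ y, ∑ z, ∑ i, ∑ j, f i j x y z := by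
    have := Finset.sum_comm (s := (Finset.univ : Finset ((A × B × C) × (A × B × C))))
      (t := (Finset.univ : Finset (A'' × B'' × C'')))
      (f := fun p q => f p.1 p.2 q.1 q.2.1 q.2.2)
    simpa only [Fintype.sum_prod_type (α₁ := A''), Fintype.sum_prod_type (α₁ := B''),
      Fintype.sum_prod_type (α₁ := A × B × C)] using this
  rw [e]
  refine Finset.sum_congr rfl fun x _ => Finset.sum_congr rfl fun y _ =>
    Finset.sum_congr rfl fun z _ => ?_
  rw [Finset.sum_eq_single (eA.symm (u.1, x), eB.symm (u.2.1, y), eC.symm (u.2.2, z)),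
    Finset.sum_eq_single (eA.symm (u'.1, x), eB.symm (u'.2.1, y), eC.symm (u'.2.2, z))]
  · simp
  · intro i _ hi
    simp [hi]
  · simp
  · intro i _ hi
    simp [hi]
  · simp

/-- A local partial trace is a sum over basis vectors of products of local rank-one operators. -/
theorem isPPTPreserving_ofChoi_discardChoi [Fintype A'] [Fintype B'] [Fintype C'] :
    IsPPTPreserving (ofChoi (discardChoi eA eB eC)) := by
  refine isPPTPreserving_of_isPPT ?_ fun p p' => ?_
  · rw [choiMatrix_ofChoi]
    have := IsPPT.sum Finset.univ fun x _ => IsPPT.sum Finset.univ fun y _ =>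
      IsPPT.sum Finset.univ fun z _ => IsPPT.product (posSemidef_discard eA x)
        (posSemidef_discard eB y) (posSemidef_discard eC z)
    convert this using 1
    ext p q
    simp only [regroup, discardChoi, Matrix.sum_apply, Matrix.of_apply, ite_zero_mul_ite_zero,
      mul_one, Prod.mk.injEq]
    refine Finset.sum_congr rfl fun x _ => Finset.sum_congr rfl fun y _ =>
      Finset.sum_congr rfl fun z _ => ?_
    congr 1
    simp only [eq_iff_iff]
    tauto
  · have h : (ofChoi (discardChoi eA eB eC) (Matrix.single p p' 1)).trace =
        (Matrix.single p p' (1 : ℂ)).trace := by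
      simp only [Matrix.trace, Matrix.diag_apply, ofChoi_discardChoi_apply]
      have e := Fintype.sum_equiv (Equiv.prodCongr eA (Equiv.prodCongr eB eC))
        (fun q => Matrix.single p p' (1 : ℂ) q q)
        (fun t => Matrix.single p p' (1 : ℂ)
          (eA.symm t.1, eB.symm t.2.1, eC.symm t.2.2) (eA.symm t.1, eB.symm t.2.1, eC.symm t.2.2))
        fun q => by simp
      rw [e]
      simp only [← Fintype.sum_prod_type']
      exact Fintype.sum_equiv
        { toFun := fun t => ((t.1.1, t.2.1), (t.1.2.1, t.2.2.1), (t.1.2.2, t.2.2.2))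
          invFun := fun t => ((t.1.1, t.2.1.1, t.2.2.1), (t.1.2, t.2.1.2, t.2.2.2))
          left_inv := fun t => rfl
          right_inv := fun t => rfl } _ _ fun t => rfl
    simp only [choiMatrix_apply]
    refine Eq.trans h ?_
    by_cases hp : p = p'
    · subst hp
      simp [Matrix.trace_single_eq_same]
    · simp [hp, Matrix.trace_single_eq_of_ne]

end Discard

/-! ### The one-shot equivalence -/

section OneShot

variable {a b c : Type*} [Fintype a] [Fintype b] [Fintype c]
    [DecidableEq a] [DecidableEq b] [DecidableEq c] {r₁ r₂ : ℕ}

theorem exists_code_of_combing [Nonempty a] (h₁ : 0 < r₁) (h₂ : 0 < r₂)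
    (N : Matrix a a ℂ →ₗ[ℂ] Matrix (b × c) (b × c) ℂ)
    {Y : Matrix (a × b × c) (a × b × c) ℂ →ₗ[ℂ]
      Matrix ((Fin r₁ × Fin r₂) × Fin r₁ × Fin r₂) ((Fin r₁ × Fin r₂) × Fin r₁ × Fin r₂) ℂ}
    (hY : IsPPTPreserving Y) :
    ∃ Z : ForwardAssistedCode a b c r₁ r₂,
      IsPPTPreserving Z.operation ∧ Z.fidelity N = eprFidelity (Y (choiState N)) :=
  let e := (Fintype.equivFin ((Fin r₁ × Fin r₂) × a)).symm
  ⟨combingCode e Y hY h₁ h₂, isPPTPreserving_operation_combingCode e hY h₁ h₂,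
    fidelity_combingCode e hY h₁ h₂ N⟩

theorem IsSimulationKernel.exists_combing {N : Matrix a a ℂ →ₗ[ℂ] Matrix (b × c) (b × c) ℂ}
    {ρ : Matrix (a × b × c) (a × b × c) ℂ}
    {K : Matrix ((a × b × c) × (a × b × c)) ((a × b × c) × (a × b × c)) ℂ}
    (hK : IsSimulationKernel N ρ K) (h₁ : 0 < r₁) (h₂ : 0 < r₂)
    {Z : ForwardAssistedCode a b c r₁ r₂} (hZ : IsPPTPreserving Z.operation) :
    ∃ Y : Matrix (a × b × c) (a × b × c) ℂ →ₗ[ℂ]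
        Matrix ((Fin r₁ × Fin r₂) × Fin r₁ × Fin r₂) ((Fin r₁ × Fin r₂) × Fin r₁ × Fin r₂) ℂ,
      IsPPTPreserving Y ∧ eprFidelity (Y ρ) = Z.fidelity N :=
  ⟨_, isPPTPreserving_ofChoi_simulationChoi hK h₁ h₂ hZ, eprFidelity_ofChoi_simulationChoi hK⟩

theorem combingFidelity_le_codeFidelity [Nonempty a] (h₁ : 0 < r₁) (h₂ : 0 < r₂)
    {N : Matrix a a ℂ →ₗ[ℂ] Matrix (b × c) (b × c) ℂ} (hN : IsChannel N) :
    combingFidelity (choiState N) r₁ r₂ ≤ codeFidelity N r₁ r₂ := by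
  refine Real.sSup_le ?_ (Real.sSup_nonneg ?_)
  · rintro f ⟨Y, hY, rfl⟩
    obtain ⟨Z, hZ, hf⟩ := exists_code_of_combing h₁ h₂ N hY
    refine le_csSup ⟨1, ?_⟩ ⟨Z, hZ, hf.symm⟩
    rintro f ⟨Z, hZ, rfl⟩
    exact Z.fidelity_le_one h₁ h₂ hN hZ.isChannel.posSemidef_choiMatrix
  · rintro f ⟨Z, hZ, rfl⟩
    exact Z.fidelity_nonneg hN hZ.isChannel.posSemidef_choiMatrix

/-- The two suprema are taken over the same set of reals, so no bounds are needed. -/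
theorem IsSimulationKernel.codeFidelity_eq [Nonempty a]
    {N : Matrix a a ℂ →ₗ[ℂ] Matrix (b × c) (b × c) ℂ}
    {K : Matrix ((a × b × c) × (a × b × c)) ((a × b × c) × (a × b × c)) ℂ}
    (hK : IsSimulationKernel N (choiState N) K) (h₁ : 0 < r₁) (h₂ : 0 < r₂) :
    codeFidelity N r₁ r₂ = combingFidelity (choiState N) r₁ r₂ := by
  refine congrArg sSup (Set.ext fun f => ⟨?_, ?_⟩)
  · rintro ⟨Z, hZ, rfl⟩
    obtain ⟨Y, hY, hf⟩ := hK.exists_combing h₁ h₂ hZ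
    exact ⟨Y, hY, hf.symm⟩
  · rintro ⟨Y, hY, rfl⟩
    obtain ⟨Z, hZ, hf⟩ := exists_code_of_combing h₁ h₂ N hY
    exact ⟨Z, hZ, hf.symm⟩

theorem IsChannel.posSemidef_map {a b : Type*} [Fintype a] [Fintype b] [DecidableEq a]
    {Φ : Matrix a a ℂ →ₗ[ℂ] Matrix b b ℂ} (h : IsChannel Φ)
    {X : Matrix a a ℂ} (hX : X.PosSemidef) : (Φ X).PosSemidef := by
  have h1 := hX.submatrix fun x : b × a => x.2
  have h2 := h.posSemidef_choiMatrix.submatrix fun x : b × a => (x.2, x.1)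
  have := posSemidef_contract (posSemidef_mul_entries h1 h2)
  convert this using 1
  ext p q
  exact map_apply_eq_sum Φ _ _ _

theorem IsChannel.posSemidef_choiState {a b : Type*} [Fintype a] [Fintype b] [DecidableEq a]
    {Φ : Matrix a a ℂ →ₗ[ℂ] Matrix b b ℂ} (h : IsChannel Φ) :
    (choiState Φ).PosSemidef := by
  rw [choiState_apply]
  exact h.posSemidef_choiMatrix.smul (by rw [inv_nonneg]; positivity)

theorem IsChannel.trace_choiState {a b : Type*} [Fintype a] [Fintype b] [DecidableEq a]
    [Nonempty a] {Φ : Matrix a a ℂ →ₗ[ℂ] Matrix b b ℂ}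
    (h : IsChannel Φ) : (choiState Φ).trace = 1 := by
  have hc : (Fintype.card a : ℂ) ≠ 0 := by exact_mod_cast Fintype.card_ne_zero
  rw [choiState_apply, Matrix.trace_smul, Matrix.trace, Fintype.sum_prod_type]
  simp only [Matrix.diag_apply, h.sum_choiMatrix]
  simp [hc]

end OneShot

/-! ### Combing of states -/

section Combing

variable {a b c : Type*} [Fintype a] [Fintype b] [Fintype c]
    [DecidableEq a] [DecidableEq b] [DecidableEq c] {r₁ r₂ : ℕ}
    {ρ : Matrix (a × b × c) (a × b × c) ℂ}

theorem IsPPTPreserving.eprFidelity_le_one (h₁ : 0 < r₁) (h₂ : 0 < r₂)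
    {Y : Matrix (a × b × c) (a × b × c) ℂ →ₗ[ℂ]
      Matrix ((Fin r₁ × Fin r₂) × Fin r₁ × Fin r₂) ((Fin r₁ × Fin r₂) × Fin r₁ × Fin r₂) ℂ}
    (hY : IsPPTPreserving Y) (hρ : ρ.PosSemidef) (hρ1 : ρ.trace = 1) :
    eprFidelity (Y ρ) ≤ 1 := by
  have h := eprFidelity_le_trace h₁ h₂ (hY.isChannel.posSemidef_map hρ)
  rwa [hY.isChannel.tracePreserving, hρ1] at h

theorem IsPPTPreserving.le_combingFidelity (h₁ : 0 < r₁) (h₂ : 0 < r₂)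
    {Y : Matrix (a × b × c) (a × b × c) ℂ →ₗ[ℂ]
      Matrix ((Fin r₁ × Fin r₂) × Fin r₁ × Fin r₂) ((Fin r₁ × Fin r₂) × Fin r₁ × Fin r₂) ℂ}
    (hY : IsPPTPreserving Y) (hρ : ρ.PosSemidef) (hρ1 : ρ.trace = 1) :
    eprFidelity (Y ρ) ≤ combingFidelity ρ r₁ r₂ := by
  refine le_csSup ⟨1, ?_⟩ ⟨Y, hY, rfl⟩
  rintro f ⟨Y', hY', rfl⟩
  exact hY'.eprFidelity_le_one h₁ h₂ hρ hρ1

theorem combingFidelity_le_one (h₁ : 0 < r₁) (h₂ : 0 < r₂) (hρ : ρ.PosSemidef)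
    (hρ1 : ρ.trace = 1) : combingFidelity ρ r₁ r₂ ≤ 1 := by
  refine Real.sSup_le ?_ zero_le_one
  rintro f ⟨Y', hY', rfl⟩
  exact hY'.eprFidelity_le_one h₁ h₂ hρ hρ1

/-- The assumption `0 ≤ f` rules out the empty set, whose real supremum is `0`. -/
theorem exists_lt_eprFidelity {f : ℝ} (hf0 : 0 ≤ f) (hf : f < combingFidelity ρ r₁ r₂) :
    ∃ Y : Matrix (a × b × c) (a × b × c) ℂ →ₗ[ℂ]
        Matrix ((Fin r₁ × Fin r₂) × Fin r₁ × Fin r₂) ((Fin r₁ × Fin r₂) × Fin r₁ × Fin r₂) ℂ,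
      IsPPTPreserving Y ∧ f < eprFidelity (Y ρ) := by
  have hne : {f : ℝ | ∃ Y : Matrix (a × b × c) (a × b × c) ℂ →ₗ[ℂ]
      Matrix ((Fin r₁ × Fin r₂) × Fin r₁ × Fin r₂) ((Fin r₁ × Fin r₂) × Fin r₁ × Fin r₂) ℂ,
      IsPPTPreserving Y ∧ f = eprFidelity (Y ρ)}.Nonempty := by
    by_contra h
    rw [Set.not_nonempty_iff_eq_empty] at h
    rw [combingFidelity, h, Real.sSup_empty] at hf
    exact absurd hf hf0.not_gt
  obtain ⟨_, ⟨Y, hY, rfl⟩, hlt⟩ := exists_lt_of_lt_csSup hne hf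
  exact ⟨Y, hY, hlt⟩

/-- Splitting a family along a decomposition of its index set into blocks and a remainder. -/
def familySplit {N k n r : ℕ} (e : Fin N ≃ (Fin k × Fin n) ⊕ Fin r) (a : Type*) :
    (Fin N → a) ≃ (Fin k → Fin n → a) × (Fin r → a) where
  toFun p := (fun i j => p (e.symm (.inl (i, j))), fun l => p (e.symm (.inr l)))
  invFun q l := Sum.elim (fun ij => q.1 ij.1 ij.2) q.2 (e l)
  left_inv p := by
    funext l
    obtain ⟨t, rfl⟩ := e.symm.surjective l
    cases t <;> simp
  right_inv q := by
    ext <;> simp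

theorem exists_isPPTPreserving_blocks (hρ1 : ρ.trace = 1) {N k n : ℕ} (h : k * n ≤ N) :
    ∃ W : Matrix ((Fin N → a) × (Fin N → b) × (Fin N → c))
          ((Fin N → a) × (Fin N → b) × (Fin N → c)) ℂ →ₗ[ℂ]
        Matrix ((Fin k → Fin n → a) × (Fin k → Fin n → b) × (Fin k → Fin n → c))
          ((Fin k → Fin n → a) × (Fin k → Fin n → b) × (Fin k → Fin n → c)) ℂ,
      IsPPTPreserving W ∧ W (statePow ρ N) = statePow (statePow ρ n) k := by
  obtain ⟨r, rfl⟩ := Nat.exists_eq_add_of_le h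
  let e : Fin (k * n + r) ≃ (Fin k × Fin n) ⊕ Fin r :=
    finSumFinEquiv.symm.trans (Equiv.sumCongr finProdFinEquiv.symm (Equiv.refl _))
  refine ⟨ofChoi (discardChoi (familySplit e a) (familySplit e b) (familySplit e c)),
    isPPTPreserving_ofChoi_discardChoi _ _ _, ?_⟩
  ext u u'
  rw [ofChoi_discardChoi_apply]
  have hu (x : Fin r → a) (y : Fin r → b) (z : Fin r → c) : statePow ρ (k * n + r)
      ((familySplit e a).symm (u.1, x), (familySplit e b).symm (u.2.1, y),
        (familySplit e c).symm (u.2.2, z))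
      ((familySplit e a).symm (u'.1, x), (familySplit e b).symm (u'.2.1, y),
        (familySplit e c).symm (u'.2.2, z)) =
      statePow (statePow ρ n) k u u' * ∏ l, ρ (x l, y l, z l) (x l, y l, z l) := by
    simp only [statePow, Matrix.of_apply]
    rw [← Equiv.prod_comp e.symm, Fintype.prod_sum_type, Fintype.prod_prod_type]
    simp [familySplit]
  simp only [hu, ← Finset.mul_sum]
  have hs := sum_prod_triple (ι := Fin r) fun _ t => ρ t t
  simp only [Fintype.sum_prod_type (α₁ := Fin r → a), Fintype.sum_prod_type (α₁ := Fin r → b)] at hs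
  have ht : ∑ t, ρ t t = 1 := hρ1
  rw [hs, Finset.prod_congr rfl fun _ _ => ht, Finset.prod_const_one, mul_one]

end Combing

/-! ### Tests on many copies of an EPR pair -/

section Tests

/-- If `-c i ≤ X i ≤ c i` for all `i`, then the same holds for the tensor products. -/
theorem posSemidef_prod_bound {ι κ d : Type*} [DecidableEq ι] [DecidableEq d] (π : ι → κ → d)
    (c : ι → ℝ) (X : ι → Matrix d d ℂ)
    (hadd : ∀ i, ((c i : ℂ) • (1 : Matrix d d ℂ) + X i).PosSemidef)
    (hsub : ∀ i, ((c i : ℂ) • (1 : Matrix d d ℂ) - X i).PosSemidef) (s : Finset ι) :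
    (Matrix.of fun p q => ∏ i ∈ s, (c i : ℂ) * (1 : Matrix d d ℂ) (π i p) (π i q) +
        ∏ i ∈ s, X i (π i p) (π i q) : Matrix κ κ ℂ).PosSemidef ∧
      (Matrix.of fun p q => ∏ i ∈ s, (c i : ℂ) * (1 : Matrix d d ℂ) (π i p) (π i q) -
        ∏ i ∈ s, X i (π i p) (π i q) : Matrix κ κ ℂ).PosSemidef := by
  induction s using Finset.induction_on with
  | empty =>
    simp only [Finset.prod_empty, sub_self]
    exact ⟨posSemidef_const_one.add posSemidef_const_one, Matrix.PosSemidef.zero⟩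
  | insert i s hi ih =>
    have ha := (hadd i).submatrix (π i)
    have hs := (hsub i).submatrix (π i)
    have half : (0 : ℝ) ≤ 2⁻¹ := by norm_num
    constructor
    -- `cC + xX = ((c + x)(C + X) + (c - x)(C - X)) / 2`; for the other sign, `c + x` is paired with
    -- `C - X`.
    · have := ((posSemidef_mul_entries ha ih.1).add (posSemidef_mul_entries hs ih.2)).smul half
      convert this using 1
      ext p q
      simp [Finset.prod_insert hi]
      ring
    · have := ((posSemidef_mul_entries ha ih.2).add (posSemidef_mul_entries hs ih.1)).smul half
      convert this using 1
      ext p q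
      simp [Finset.prod_insert hi]
      ring

variable {k r : ℕ}

/-- The projector onto the pattern where exactly the pairs in `S` fail the test for an EPR pair. -/
def patternTerm (r : ℕ) (S : Finset (Fin k)) :
    Matrix ((Fin k → Fin r) × (Fin k → Fin r)) ((Fin k → Fin r) × (Fin k → Fin r)) ℂ :=
  Matrix.of fun p q => ∏ i, (if i ∈ S then 1 - epr (Fin r) else epr (Fin r))
    (p.1 i, p.2 i) (q.1 i, q.2 i)

/-- The test accepting the failure patterns in `𝒮`. -/
def patternTest (r : ℕ) (𝒮 : Finset (Finset (Fin k))) :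
    Matrix ((Fin k → Fin r) × (Fin k → Fin r)) ((Fin k → Fin r) × (Fin k → Fin r)) ℂ :=
  ∑ S ∈ 𝒮, patternTerm r S

theorem prod_add_eq_sum {ι : Type*} [Fintype ι] [DecidableEq ι] (f g : ι → ℂ) :
    ∏ i, (f i + g i) = ∑ S : Finset ι, ∏ i, if i ∈ S then f i else g i := by
  rw [Finset.prod_add, Finset.powerset_univ]
  refine Finset.sum_congr rfl fun S _ => ?_
  rw [Finset.prod_ite]
  congr 1
  · congr 1
    ext
    simp
  · congr 1
    ext
    simp

theorem prod_one_pairs (p q : (Fin k → Fin r) × (Fin k → Fin r)) :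
    ∏ i, (1 : Matrix (Fin r × Fin r) (Fin r × Fin r) ℂ) (p.1 i, p.2 i) (q.1 i, q.2 i) =
      (1 : Matrix ((Fin k → Fin r) × (Fin k → Fin r)) ((Fin k → Fin r) × (Fin k → Fin r)) ℂ)
        p q := by
  simp only [Matrix.one_apply]
  rw [Finset.prod_ite_zero, Finset.prod_const_one]
  congr 1
  simp only [Finset.mem_univ, true_imp_iff, Prod.ext_iff, funext_iff, eq_iff_iff]
  exact ⟨fun h => ⟨fun i => (h i).1, fun i => (h i).2⟩, fun h i => ⟨h.1 i, h.2 i⟩⟩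

theorem patternTest_univ : patternTest r (Finset.univ : Finset (Finset (Fin k))) = 1 := by
  ext p q
  have h := prod_add_eq_sum (fun i : Fin k => (1 - epr (Fin r)) (p.1 i, p.2 i) (q.1 i, q.2 i))
    fun i => epr (Fin r) (p.1 i, p.2 i) (q.1 i, q.2 i)
  simp only [patternTest, Matrix.sum_apply, patternTerm, Matrix.of_apply]
  have h1 (S : Finset (Fin k)) : ∏ i, (if i ∈ S then 1 - epr (Fin r) else epr (Fin r))
      (p.1 i, p.2 i) (q.1 i, q.2 i) = ∏ i, if i ∈ S then (1 - epr (Fin r))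
      (p.1 i, p.2 i) (q.1 i, q.2 i) else epr (Fin r) (p.1 i, p.2 i) (q.1 i, q.2 i) :=
    Finset.prod_congr rfl fun i _ => by split_ifs <;> rfl
  rw [Finset.sum_congr rfl fun S _ => h1 S, ← h, ← prod_one_pairs]
  exact Finset.prod_congr rfl fun i _ => by rw [Matrix.sub_apply, sub_add_cancel]

theorem one_sub_patternTest (𝒮 : Finset (Finset (Fin k))) :
    1 - patternTest r 𝒮 = patternTest r 𝒮ᶜ := by
  rw [← patternTest_univ, sub_eq_iff_eq_add, patternTest, patternTest, patternTest,
    Finset.sum_compl_add_sum]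

theorem posSemidef_ite_epr (hr : 0 < r) (s : Prop) [Decidable s] :
    (if s then 1 - epr (Fin r) else epr (Fin r)).PosSemidef := by
  split_ifs
  · exact (isRainsTest_epr hr).posSemidef_one_sub
  · exact posSemidef_epr

theorem posSemidef_patternTest (hr : 0 < r) (𝒮 : Finset (Finset (Fin k))) :
    (patternTest r 𝒮).PosSemidef :=
  Matrix.posSemidef_sum _ fun S _ =>
    (posSemidef_pi fun i => posSemidef_ite_epr hr (i ∈ S)).submatrix
      fun (p : (Fin k → Fin r) × (Fin k → Fin r)) i => (p.1 i, p.2 i)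

/-- A bound on the partial transpose of a factor of `patternTerm`. -/
def patternBound (r : ℕ) (s : Prop) [Decidable s] : ℝ := if s then 2 else (r : ℝ)⁻¹

/-- The swap has norm one, so the transpose of the EPR pair has norm at most `1 / r` and that of its
complement at most `1 + 1 / r ≤ 2`. -/
theorem posSemidef_patternBound (hr : 0 < r) (s : Prop) [Decidable s] :
    ((patternBound r s : ℂ) • (1 : Matrix (Fin r × Fin r) (Fin r × Fin r) ℂ) +
      transposeSnd (if s then 1 - epr (Fin r) else epr (Fin r))).PosSemidef ∧
    ((patternBound r s : ℂ) • (1 : Matrix (Fin r × Fin r) (Fin r × Fin r) ℂ) -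
      transposeSnd (if s then 1 - epr (Fin r) else epr (Fin r))).PosSemidef := by
  have hr1 : (1 : ℝ) ≤ r := by exact_mod_cast hr
  have hi : (0 : ℝ) ≤ (r : ℝ)⁻¹ := by positivity
  have hi1 : (r : ℝ)⁻¹ ≤ 1 := inv_le_one_of_one_le₀ hr1
  have hp := posSemidef_one_add_swapMatrix (o := Fin r)
  have hm := posSemidef_one_sub_swapMatrix (o := Fin r)
  have h1 := Matrix.PosSemidef.one (n := Fin r × Fin r) (R := ℂ)
  have ht : transposeSnd (1 - epr (Fin r)) = 1 - transposeSnd (epr (Fin r)) := by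
    conv_rhs => rw [← transposeSnd_one (α := Fin r) (β := Fin r)]
    rfl
  by_cases hs : s
  · simp only [patternBound, hs, if_true, ht, transposeSnd_epr]
    constructor
    · convert (h1.smul (show (0 : ℝ) ≤ 3 - (r : ℝ)⁻¹ by linarith)).add (hm.smul hi) using 1
      ext p q
      simp
      ring
    · convert (h1.smul (show (0 : ℝ) ≤ 1 - (r : ℝ)⁻¹ by linarith)).add (hp.smul hi) using 1
      ext p q
      simp
      ring
  · simp only [patternBound, hs, if_false, transposeSnd_epr]
    constructor
    · convert hp.smul hi using 1
      ext p q
      simp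
    · convert hm.smul hi using 1
      ext p q
      simp
      ring

theorem isRainsTest_patternTest {d : ℕ} (hr : 0 < r) (hd : 0 < d) {𝒮 : Finset (Finset (Fin k))}
    (hone : d = 1 → 𝒮 = Finset.univ)
    (hbound : d ≠ 1 → (d : ℝ) * ∑ S ∈ 𝒮, ∏ i, patternBound r (i ∈ S) ≤ 1) :
    IsRainsTest (patternTest r 𝒮) d := by
  have hsum : (1 + (d : ℂ) • transposeSnd (patternTest r 𝒮)).PosSemidef ∧
      (1 - (d : ℂ) • transposeSnd (patternTest r 𝒮)).PosSemidef := by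
    by_cases h1 : d = 1
    · rw [hone h1, patternTest_univ, transposeSnd_one, h1, Nat.cast_one, one_smul, sub_self]
      exact ⟨Matrix.PosSemidef.one.add Matrix.PosSemidef.one, Matrix.PosSemidef.zero⟩
    have hS (S : Finset (Fin k)) := posSemidef_prod_bound
      (π := fun i (p : (Fin k → Fin r) × (Fin k → Fin r)) => (p.1 i, p.2 i))
      (fun i => patternBound r (i ∈ S))
      (fun i => transposeSnd (if i ∈ S then 1 - epr (Fin r) else epr (Fin r)))
      (fun i => (posSemidef_patternBound hr _).1) (fun i => (posSemidef_patternBound hr _).2)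
      Finset.univ
    simp only [Finset.prod_mul_distrib, prod_one_pairs] at hS
    have hadd := (Matrix.posSemidef_sum 𝒮 fun S _ => (hS S).1).smul (Nat.cast_nonneg (α := ℝ) d)
    have hsub := (Matrix.posSemidef_sum 𝒮 fun S _ => (hS S).2).smul (Nat.cast_nonneg (α := ℝ) d)
    have hrem := (Matrix.PosSemidef.one (n := (Fin k → Fin r) × (Fin k → Fin r)) (R := ℂ)).smul
      (sub_nonneg.2 (hbound h1))
    have ht (p q : (Fin k → Fin r) × (Fin k → Fin r)) : transposeSnd (patternTest r 𝒮) p q =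
        ∑ S ∈ 𝒮, ∏ i, transposeSnd (if i ∈ S then 1 - epr (Fin r) else epr (Fin r))
          (p.1 i, p.2 i) (q.1 i, q.2 i) := by
      simp only [transposeSnd, patternTest, Matrix.of_apply, Matrix.sum_apply, patternTerm]
    constructor
    · convert hrem.add hadd using 1
      ext p q
      simp only [Matrix.add_apply, Matrix.smul_apply, Matrix.sum_apply, Matrix.of_apply, ht,
        Finset.sum_add_distrib, ← Finset.sum_mul, Complex.real_smul, smul_eq_mul]
      push_cast
      ring
    · convert hrem.add hsub using 1
      ext p q
      simp only [Matrix.add_apply, Matrix.sub_apply, Matrix.smul_apply, Matrix.sum_apply,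
        Matrix.of_apply, ht, Finset.sum_sub_distrib, ← Finset.sum_mul, Complex.real_smul,
        smul_eq_mul]
      push_cast
      ring
  refine ⟨hd, posSemidef_patternTest hr 𝒮, ?_, hsum.1, hsum.2, fun h => ?_⟩
  · rw [one_sub_patternTest]
    exact posSemidef_patternTest hr _
  · rw [hone h, patternTest_univ]

/-- The failure patterns with at most `t` failures. -/
def fewFailures (k t : ℕ) : Finset (Finset (Fin k)) := Finset.univ.filter fun S => S.card ≤ t

/-- There are at most `2 ^ k` patterns; in each, the failing factors contribute at most `2 ^ k` and
the at least `k - t` passing ones at most `r ^ (-(k - t))`. -/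
theorem sum_patternBound_le (hr : 0 < r) {t : ℕ} (ht : t ≤ k) :
    ∑ S ∈ fewFailures k t, ∏ i, patternBound r (i ∈ S) ≤ 4 ^ k * ((r : ℝ)⁻¹) ^ (k - t) := by
  have hr1 : (1 : ℝ) ≤ r := by exact_mod_cast hr
  have hi : (0 : ℝ) ≤ (r : ℝ)⁻¹ := by positivity
  have hi1 : (r : ℝ)⁻¹ ≤ 1 := inv_le_one_of_one_le₀ hr1
  have hS (S : Finset (Fin k)) (h : S ∈ fewFailures k t) :
      ∏ i, patternBound r (i ∈ S) ≤ 2 ^ k * ((r : ℝ)⁻¹) ^ (k - t) := by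
    simp only [fewFailures, Finset.mem_filter, Finset.mem_univ, true_and] at h
    have hc : (Finset.univ.filter fun i => i ∉ S).card = k - S.card := by
      have : (Finset.univ.filter fun i => i ∉ S) = Sᶜ := by ext; simp
      rw [this, Finset.card_compl, Fintype.card_fin]
    have hc' : (Finset.univ.filter fun i => i ∈ S).card = S.card := by
      congr 1
      ext
      simp
    simp only [patternBound]
    rw [Finset.prod_ite, Finset.prod_const, Finset.prod_const, hc, hc']
    gcongr ?_ * ?_
    · exact pow_le_pow_right₀ one_le_two (h.trans ht)
    · exact pow_le_pow_of_le_one hi hi1 (by omega)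
  calc ∑ S ∈ fewFailures k t, ∏ i, patternBound r (i ∈ S)
      ≤ ∑ S ∈ fewFailures k t, 2 ^ k * ((r : ℝ)⁻¹) ^ (k - t) := Finset.sum_le_sum hS
    _ = (fewFailures k t).card * (2 ^ k * ((r : ℝ)⁻¹) ^ (k - t)) := by simp
    _ ≤ 2 ^ k * (2 ^ k * ((r : ℝ)⁻¹) ^ (k - t)) := by
      gcongr
      have : (fewFailures k t).card ≤ 2 ^ k := by
        refine (Finset.card_le_univ _).trans ?_
        simp
      exact_mod_cast this
    _ = 4 ^ k * ((r : ℝ)⁻¹) ^ (k - t) := by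
      rw [← mul_assoc, ← mul_pow]
      norm_num

/-- For `d = 1` the test has to accept every pattern; then no size condition is needed and nothing
is rejected. -/
theorem exists_isRainsTest {d t : ℕ} (hr : 0 < r) (hd : 0 < d) (ht : t ≤ k)
    (h : d = 1 ∨ (d : ℝ) * 4 ^ k ≤ (r : ℝ) ^ (k - t)) :
    ∃ 𝒮 : Finset (Finset (Fin k)), IsRainsTest (patternTest r 𝒮) d ∧
      ∀ S ∈ 𝒮ᶜ, t + 1 ≤ S.card := by
  have hr0 : (0 : ℝ) < r := by exact_mod_cast hr
  by_cases h1 : d = 1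
  · exact ⟨Finset.univ, isRainsTest_patternTest hr hd (fun _ => rfl) fun h => absurd h1 h,
      fun S hS => by simp at hS⟩
  · refine ⟨fewFailures k t, isRainsTest_patternTest hr hd (fun h => absurd h h1) fun _ => ?_,
      fun S hS => ?_⟩
    · have h2 := h.resolve_left h1
      calc (d : ℝ) * ∑ S ∈ fewFailures k t, ∏ i, patternBound r (i ∈ S)
          ≤ d * (4 ^ k * ((r : ℝ)⁻¹) ^ (k - t)) := by
            gcongr
            exact sum_patternBound_le hr ht
        _ = (d * 4 ^ k) * ((r : ℝ)⁻¹) ^ (k - t) := by ring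
        _ ≤ r ^ (k - t) * ((r : ℝ)⁻¹) ^ (k - t) := by gcongr
        _ = 1 := by rw [← mul_pow, mul_inv_cancel₀ hr0.ne', one_pow]
    · simp only [fewFailures, Finset.compl_filter, Finset.mem_filter, Finset.mem_univ, true_and,
        not_le] at hS
      exact hS

end Tests

/-! ### Distillation from many copies of two noisy EPR pairs -/

section Pairing

/-- The pairing `Tr (τ Eᵀ)`. -/
def pairing {m : Type*} [Fintype m] (τ E : Matrix m m ℂ) : ℂ := ∑ i, ∑ j, τ i j * E i j

variable {m : Type*} [Fintype m] {τ : Matrix m m ℂ}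

theorem pairing_nonneg {E : Matrix m m ℂ} (hτ : τ.PosSemidef) (hE : E.PosSemidef) :
    0 ≤ pairing τ E := by
  have h := (posSemidef_contract (p := Unit) (m := m)
    ((posSemidef_mul_entries hτ hE).submatrix Prod.snd)).diag_nonneg (i := ())
  exact h

theorem pairing_add (E E' : Matrix m m ℂ) : pairing τ (E + E') = pairing τ E + pairing τ E' := by
  simp [pairing, mul_add, Finset.sum_add_distrib]

theorem pairing_sub (E E' : Matrix m m ℂ) : pairing τ (E - E') = pairing τ E - pairing τ E' := by
  simp [pairing, mul_sub, Finset.sum_sub_distrib]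

theorem pairing_sum {ι : Type*} (s : Finset ι) (E : ι → Matrix m m ℂ) :
    pairing τ (∑ l ∈ s, E l) = ∑ l ∈ s, pairing τ (E l) := by
  classical
  induction s using Finset.induction_on with
  | empty => simp [pairing]
  | insert l s hl ih => rw [Finset.sum_insert hl, pairing_add, ih, Finset.sum_insert hl]

theorem pairing_one [DecidableEq m] : pairing τ 1 = τ.trace := by
  simp [pairing, Matrix.one_apply, Matrix.trace]

end Pairing

/-! ### Products of an Alice–Bob effect and an Alice–Charlie effect -/

section Lift

variable {A α₁ α₂ β γ : Type*}

/-- The operator `E₁ ⊗ E₂`, where `E₁` is shared by Alice and Bob and `E₂` by Alice and Charlie. -/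
def lift (f : A → α₁ × α₂) (E₁ : Matrix (α₁ × β) (α₁ × β) ℂ) (E₂ : Matrix (α₂ × γ) (α₂ × γ) ℂ) :
    Matrix (A × β × γ) (A × β × γ) ℂ :=
  Matrix.of fun m m' => E₁ ((f m.1).1, m.2.1) ((f m'.1).1, m'.2.1) *
    E₂ ((f m.1).2, m.2.2) ((f m'.1).2, m'.2.2)

variable {f : A → α₁ × α₂}

theorem posSemidef_lift {E₁ : Matrix (α₁ × β) (α₁ × β) ℂ} {E₂ : Matrix (α₂ × γ) (α₂ × γ) ℂ}
    (h₁ : E₁.PosSemidef) (h₂ : E₂.PosSemidef) : (lift f E₁ E₂).PosSemidef :=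
  posSemidef_mul_entries (h₁.submatrix fun m : A × β × γ => ((f m.1).1, m.2.1))
    (h₂.submatrix fun m : A × β × γ => ((f m.1).2, m.2.2))

theorem lift_sub_left (E₁ E₁' : Matrix (α₁ × β) (α₁ × β) ℂ) (E₂ : Matrix (α₂ × γ) (α₂ × γ) ℂ) :
    lift f (E₁ - E₁') E₂ = lift f E₁ E₂ - lift f E₁' E₂ := by
  ext
  simp [lift, sub_mul]

theorem lift_sub_right (E₁ : Matrix (α₁ × β) (α₁ × β) ℂ) (E₂ E₂' : Matrix (α₂ × γ) (α₂ × γ) ℂ) :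
    lift f E₁ (E₂ - E₂') = lift f E₁ E₂ - lift f E₁ E₂' := by
  ext
  simp [lift, mul_sub]

theorem lift_sum_left {ι : Type*} (s : Finset ι) (E₁ : ι → Matrix (α₁ × β) (α₁ × β) ℂ)
    (E₂ : Matrix (α₂ × γ) (α₂ × γ) ℂ) :
    lift f (∑ l ∈ s, E₁ l) E₂ = ∑ l ∈ s, lift f (E₁ l) E₂ := by
  ext
  simp [lift, Matrix.sum_apply, Finset.sum_mul]

theorem lift_sum_right {ι : Type*} (s : Finset ι) (E₁ : Matrix (α₁ × β) (α₁ × β) ℂ)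
    (E₂ : ι → Matrix (α₂ × γ) (α₂ × γ) ℂ) :
    lift f E₁ (∑ l ∈ s, E₂ l) = ∑ l ∈ s, lift f E₁ (E₂ l) := by
  ext
  simp [lift, Matrix.sum_apply, Finset.mul_sum]

theorem lift_one_one [DecidableEq A] [DecidableEq α₁] [DecidableEq α₂] [DecidableEq β]
    [DecidableEq γ] (hf : Function.Injective f) :
    lift f (1 : Matrix (α₁ × β) (α₁ × β) ℂ) (1 : Matrix (α₂ × γ) (α₂ × γ) ℂ) = 1 := by
  ext ⟨x, y, z⟩ ⟨x', y', z'⟩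
  have hx : x = x' ↔ (f x).1 = (f x').1 ∧ (f x).2 = (f x').2 := by
    rw [← Prod.ext_iff, hf.eq_iff]
  simp only [lift, Matrix.of_apply, Matrix.one_apply, ite_zero_mul_ite_zero, mul_one,
    Prod.mk.injEq, hx]
  congr 1
  simp only [eq_iff_iff]
  tauto

end Lift

/-! ### Failure probabilities over independent blocks -/

section Blocks

variable {k r r₁ r₂ : ℕ}

/-- The tensor product of operators on pairs. -/
def pairPi (X : Fin k → Matrix (Fin r × Fin r) (Fin r × Fin r) ℂ) :
    Matrix ((Fin k → Fin r) × (Fin k → Fin r)) ((Fin k → Fin r) × (Fin k → Fin r)) ℂ :=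
  Matrix.of fun p q => ∏ i, X i (p.1 i, p.2 i) (q.1 i, q.2 i)

theorem pairPi_one : pairPi (fun _ : Fin k => (1 : Matrix (Fin r × Fin r) (Fin r × Fin r) ℂ)) =
    1 := by
  ext p q
  exact prod_one_pairs p q

/-- Families of pairs as pairs of families. -/
def unzip (x : Fin k → Fin r₁ × Fin r₂) : (Fin k → Fin r₁) × (Fin k → Fin r₂) :=
  (fun i => (x i).1, fun i => (x i).2)

theorem unzip_injective : Function.Injective (unzip : (Fin k → Fin r₁ × Fin r₂) → _) :=
  fun _ _ h => funext fun i => Prod.ext (congrFun (congrArg Prod.fst h) i)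
    (congrFun (congrArg Prod.snd h) i)

variable {σ : Matrix ((Fin r₁ × Fin r₂) × Fin r₁ × Fin r₂) ((Fin r₁ × Fin r₂) × Fin r₁ × Fin r₂) ℂ}

theorem pairing_statePow_lift (X₁ : Fin k → Matrix (Fin r₁ × Fin r₁) (Fin r₁ × Fin r₁) ℂ)
    (X₂ : Fin k → Matrix (Fin r₂ × Fin r₂) (Fin r₂ × Fin r₂) ℂ) :
    pairing (statePow σ k) (lift unzip (pairPi X₁) (pairPi X₂)) =
      ∏ i, pairing σ (lift id (X₁ i) (X₂ i)) := by
  have h := sum_sum_prod_triple (ι := Fin k) fun i m m' => σ m m' * lift id (X₁ i) (X₂ i) m m'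
  simp only [pairing]
  rw [← h]
  refine Finset.sum_congr rfl fun m _ => Finset.sum_congr rfl fun m' _ => ?_
  simp only [statePow, lift, pairPi, Matrix.of_apply, Finset.prod_mul_distrib, unzip, id]

theorem norm_eq_re_of_nonneg {z : ℂ} (hz : 0 ≤ z) : ‖z‖ = z.re := by
  have h := Complex.le_def.1 hz
  have hz' : z = (z.re : ℂ) := Complex.ext rfl (by simpa using h.2.symm)
  rw [hz', Complex.norm_real, Complex.ofReal_re, Real.norm_of_nonneg h.1]

variable {η : ℝ} (hσ : σ.PosSemidef) (hσ1 : σ.trace = 1) (hη : 1 - η ≤ eprFidelity σ)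
  (h₁ : 0 < r₁) (h₂ : 0 < r₂)

theorem eprFidelity_eq_pairing :
    eprFidelity σ = (pairing σ (lift id (epr (Fin r₁)) (epr (Fin r₂)))).re :=
  sum_mul_eprPair σ

/-- For `x`, `y` the probabilities that the pair with one receiver fails or passes, and `z` the
probability that both pairs pass. -/
theorem norm_le_of_complementary {x y z : ℂ} (hx : 0 ≤ x) (hy : 0 ≤ y) (hxy : x + y = 1)
    (hz : z ≤ y) (hzη : 1 - η ≤ z.re) : ‖x‖ ≤ η ∧ ‖y‖ ≤ 1 := by
  rw [norm_eq_re_of_nonneg hx, norm_eq_re_of_nonneg hy]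
  have h := congrArg Complex.re hxy
  rw [Complex.add_re, Complex.one_re] at h
  have := (Complex.le_def.1 hz).1
  have := (Complex.le_def.1 hx).1
  rw [Complex.zero_re] at this
  constructor <;> linarith

include hσ hσ1 hη h₁ h₂

/-- Stated with norms so that the bounds can be multiplied over the blocks. -/
theorem norm_pairing_left (s : Prop) [Decidable s] :
    ‖pairing σ (lift id (if s then 1 - epr (Fin r₁) else epr (Fin r₁)) 1)‖ ≤
      if s then η else 1 := by
  have hx := pairing_nonneg hσ (posSemidef_lift (f := id)
    (isRainsTest_epr h₁).posSemidef_one_sub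
    (Matrix.PosSemidef.one (n := Fin r₂ × Fin r₂) (R := ℂ)))
  have hy := pairing_nonneg hσ (posSemidef_lift (f := id)
    (posSemidef_epr (d := r₁)) (Matrix.PosSemidef.one (n := Fin r₂ × Fin r₂) (R := ℂ)))
  have hd := pairing_nonneg hσ (posSemidef_lift (f := id) (posSemidef_epr (d := r₁))
    (isRainsTest_epr h₂).posSemidef_one_sub)
  rw [lift_sub_right, pairing_sub, sub_nonneg] at hd
  have hxy : pairing σ (lift id (1 - epr (Fin r₁)) (1 : Matrix (Fin r₂ × Fin r₂) _ ℂ)) +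
      pairing σ (lift id (epr (Fin r₁)) 1) = 1 := by
    rw [lift_sub_left, pairing_sub, sub_add_cancel, lift_one_one Function.injective_id,
      pairing_one, hσ1]
  have := norm_le_of_complementary hx hy hxy hd (eprFidelity_eq_pairing ▸ hη)
  split_ifs
  · exact this.1
  · exact this.2

theorem norm_pairing_right (s : Prop) [Decidable s] :
    ‖pairing σ (lift id 1 (if s then 1 - epr (Fin r₂) else epr (Fin r₂)))‖ ≤
      if s then η else 1 := by
  have hx := pairing_nonneg hσ (posSemidef_lift (f := id)
    (Matrix.PosSemidef.one (n := Fin r₁ × Fin r₁) (R := ℂ))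
    (isRainsTest_epr h₂).posSemidef_one_sub)
  have hy := pairing_nonneg hσ (posSemidef_lift (f := id)
    (Matrix.PosSemidef.one (n := Fin r₁ × Fin r₁) (R := ℂ)) (posSemidef_epr (d := r₂)))
  have hd := pairing_nonneg hσ (posSemidef_lift (f := id)
    (isRainsTest_epr h₁).posSemidef_one_sub (posSemidef_epr (d := r₂)))
  rw [lift_sub_left, pairing_sub, sub_nonneg] at hd
  have hxy : pairing σ (lift id (1 : Matrix (Fin r₁ × Fin r₁) _ ℂ) (1 - epr (Fin r₂))) +
      pairing σ (lift id 1 (epr (Fin r₂))) = 1 := by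
    rw [lift_sub_right, pairing_sub, sub_add_cancel, lift_one_one Function.injective_id,
      pairing_one, hσ1]
  have := norm_le_of_complementary hx hy hxy hd (eprFidelity_eq_pairing ▸ hη)
  split_ifs
  · exact this.1
  · exact this.2

omit hσ hσ1 hη h₁ h₂ in
theorem sum_prod_failures_le {t : ℕ} (hη0 : 0 ≤ η) (hη1 : η ≤ 1) {𝒮 : Finset (Finset (Fin k))}
    (h𝒮 : ∀ S ∈ 𝒮, t ≤ S.card) :
    ∑ S ∈ 𝒮, ∏ i, (if i ∈ S then η else 1) ≤ 2 ^ k * η ^ t := by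
  calc ∑ S ∈ 𝒮, ∏ i, (if i ∈ S then η else 1)
      ≤ ∑ S ∈ 𝒮, η ^ t := by
        refine Finset.sum_le_sum fun S hS => ?_
        rw [Finset.prod_ite_mem, Finset.univ_inter, Finset.prod_const]
        exact pow_le_pow_of_le_one hη0 hη1 (h𝒮 S hS)
    _ = 𝒮.card * η ^ t := by simp
    _ ≤ 2 ^ k * η ^ t := by
      gcongr
      have : 𝒮.card ≤ 2 ^ k := by
        refine (Finset.card_le_univ _).trans ?_
        simp
      exact_mod_cast this

theorem norm_pairing_patternTest_left {t : ℕ} (hη0 : 0 ≤ η) (hη1 : η ≤ 1)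
    {𝒮 : Finset (Finset (Fin k))} (h𝒮 : ∀ S ∈ 𝒮, t ≤ S.card) :
    ‖pairing (statePow σ k) (lift unzip (patternTest r₁ 𝒮) 1)‖ ≤ 2 ^ k * η ^ t := by
  rw [patternTest, lift_sum_left, pairing_sum]
  refine (norm_sum_le _ _).trans (le_trans (Finset.sum_le_sum fun S _ => ?_)
    (sum_prod_failures_le hη0 hη1 h𝒮))
  have h : pairing (statePow σ k) (lift unzip (patternTerm r₁ S) 1) = _ :=
    pairPi_one (k := k) (r := r₂) ▸ pairing_statePow_lift
      (fun i => if i ∈ S then 1 - epr (Fin r₁) else epr (Fin r₁)) fun _ => 1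
  rw [h, norm_prod]
  exact Finset.prod_le_prod (fun _ _ => norm_nonneg _)
    fun i _ => norm_pairing_left hσ hσ1 hη h₁ h₂ _

theorem norm_pairing_patternTest_right {t : ℕ} (hη0 : 0 ≤ η) (hη1 : η ≤ 1)
    {𝒮 : Finset (Finset (Fin k))} (h𝒮 : ∀ S ∈ 𝒮, t ≤ S.card) :
    ‖pairing (statePow σ k) (lift unzip 1 (patternTest r₂ 𝒮))‖ ≤ 2 ^ k * η ^ t := by
  rw [patternTest, lift_sum_right, pairing_sum]
  refine (norm_sum_le _ _).trans (le_trans (Finset.sum_le_sum fun S _ => ?_)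
    (sum_prod_failures_le hη0 hη1 h𝒮))
  have h : pairing (statePow σ k) (lift unzip 1 (patternTerm r₂ S)) = _ :=
    pairPi_one (k := k) (r := r₁) ▸ pairing_statePow_lift (fun _ => 1)
      fun i => if i ∈ S then 1 - epr (Fin r₂) else epr (Fin r₂)
  rw [h, norm_prod]
  exact Finset.prod_le_prod (fun _ _ => norm_nonneg _)
    fun i _ => norm_pairing_right hσ hσ1 hη h₁ h₂ _

/-- A union bound: in `E₁ ⊗ E₂ = 1 - (1 - E₁) ⊗ 1 - 1 ⊗ (1 - E₂) + (1 - E₁) ⊗ (1 - E₂)` the last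
term contributes nonnegatively. Within a block, the failures towards Bob and Charlie may be
correlated. -/
theorem le_eprFidelity_distillation {d₁ d₂ t : ℕ} (hη0 : 0 ≤ η) (hη1 : η ≤ 1)
    {𝒮₁ 𝒮₂ : Finset (Finset (Fin k))} (hT₁ : IsRainsTest (patternTest r₁ 𝒮₁) d₁)
    (hT₂ : IsRainsTest (patternTest r₂ 𝒮₂) d₂)
    (h𝒮₁ : ∀ S ∈ 𝒮₁ᶜ, t ≤ S.card) (h𝒮₂ : ∀ S ∈ 𝒮₂ᶜ, t ≤ S.card) :
    1 - 2 * (2 ^ k * η ^ t) ≤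
      eprFidelity (ofChoi (doubleKernel unzip (patternTest r₁ 𝒮₁) (patternTest r₂ 𝒮₂) d₁ d₂)
        (statePow σ k)) := by
  set τ := statePow σ k with hτ
  set E₁ := patternTest r₁ 𝒮₁
  set E₂ := patternTest r₂ 𝒮₂
  have hfid : eprFidelity (ofChoi (doubleKernel unzip E₁ E₂ d₁ d₂) τ) =
      (pairing τ (lift unzip E₁ E₂)).re := eprFidelity_ofChoi_doubleKernel hT₁ hT₂ τ
  have hp := pairing_nonneg (posSemidef_statePow hσ k) (posSemidef_lift (f := unzip)
    hT₁.posSemidef_one_sub hT₂.posSemidef_one_sub)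
  have hl := norm_pairing_patternTest_left hσ hσ1 hη h₁ h₂ hη0 hη1 h𝒮₁
  have hr := norm_pairing_patternTest_right hσ hσ1 hη h₁ h₂ hη0 hη1 h𝒮₂
  rw [← one_sub_patternTest] at hl hr
  have h1 : pairing τ (lift unzip 1 1) = 1 := by
    rw [lift_one_one unzip_injective, pairing_one, hτ, trace_statePow, hσ1, one_pow]
  have hsum : pairing τ (lift unzip E₁ E₂) = 1 - pairing τ (lift unzip (1 - E₁) 1) -
      pairing τ (lift unzip 1 (1 - E₂)) + pairing τ (lift unzip (1 - E₁) (1 - E₂)) := by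
    simp only [lift_sub_left, lift_sub_right, pairing_sub, h1]
    ring
  have hp' := (Complex.le_def.1 hp).1
  have hl' := (Complex.re_le_norm _).trans hl
  have hr' := (Complex.re_le_norm _).trans hr
  rw [hfid, hsum]
  simp only [Complex.add_re, Complex.sub_re, Complex.one_re, Complex.zero_re] at hp' ⊢
  linarith

end Blocks

/-! ### Asymptotic rates -/

section Rates

variable {a b c : Type*} [Fintype a] [Fintype b] [Fintype c]
    [DecidableEq a] [DecidableEq b] [DecidableEq c]
    {ρ : Matrix (a × b × c) (a × b × c) ℂ}

/-- Discard the surplus copies, comb each of the `k` blocks with `Y`, and apply the two pattern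
tests. A rejected pattern has at least `t + 1` failures, whence the exponent. -/
theorem le_combingFidelity_blocks (hρ : ρ.PosSemidef) (hρ1 : ρ.trace = 1)
    {r₁ r₂ d₁ d₂ n k t N : ℕ} (h₁ : 0 < r₁) (h₂ : 0 < r₂) {η : ℝ} (hη0 : 0 ≤ η) (hη1 : η ≤ 1)
    (hη : 1 - η < combingFidelity (statePow ρ n) r₁ r₂) (hN : k * n ≤ N) (ht : t ≤ k)
    (hd₁ : 0 < d₁) (hd₂ : 0 < d₂)
    (hr₁ : d₁ = 1 ∨ (d₁ : ℝ) * 4 ^ k ≤ (r₁ : ℝ) ^ (k - t))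
    (hr₂ : d₂ = 1 ∨ (d₂ : ℝ) * 4 ^ k ≤ (r₂ : ℝ) ^ (k - t)) :
    1 - 2 * (2 ^ k * η ^ (t + 1)) ≤ combingFidelity (statePow ρ N) d₁ d₂ := by
  have hpow (m : ℕ) : (statePow ρ m).trace = 1 := by rw [trace_statePow, hρ1, one_pow]
  obtain ⟨Y, hY, hYη⟩ := exists_lt_eprFidelity (sub_nonneg.2 hη1) hη
  obtain ⟨W, hW, hWρ⟩ := exists_isPPTPreserving_blocks hρ1 hN
  obtain ⟨𝒮₁, hT₁, h𝒮₁⟩ := exists_isRainsTest h₁ hd₁ ht hr₁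
  obtain ⟨𝒮₂, hT₂, h𝒮₂⟩ := exists_isRainsTest h₂ hd₂ ht hr₂
  have hσ := hY.isChannel.posSemidef_map (posSemidef_statePow hρ n)
  have hσ1 := (hY.isChannel.tracePreserving (statePow ρ n)).trans (hpow n)
  refine (le_eprFidelity_distillation hσ hσ1 hYη.le h₁ h₂ hη0 hη1 hT₁ hT₂ h𝒮₁ h𝒮₂).trans ?_
  have hP := ((isPPTPreserving_ofChoi_doubleKernel unzip_injective hT₁ hT₂).comp
    (isPPTPreserving_ofChoi_piPow hY k)).comp hW
  have := hP.le_combingFidelity hd₁ hd₂ (posSemidef_statePow hρ N) (hpow N)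
  rwa [LinearMap.comp_apply, LinearMap.comp_apply, hWρ, ofChoi_piPow_statePow] at this

theorem isRainsTest_one {α β : Type*} [DecidableEq α] [DecidableEq β] [Fintype α] [Fintype β] :
    IsRainsTest (1 : Matrix (α × β) (α × β) ℂ) 1 := by
  refine ⟨one_pos, Matrix.PosSemidef.one, ?_, ?_, ?_, fun _ => rfl⟩
  · rw [sub_self]
    exact Matrix.PosSemidef.zero
  · rw [transposeSnd_one, Nat.cast_one, one_smul]
    exact Matrix.PosSemidef.one.add Matrix.PosSemidef.one
  · rw [transposeSnd_one, Nat.cast_one, one_smul, sub_self]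
    exact Matrix.PosSemidef.zero

theorem combingFidelity_one_one (hρ : ρ.PosSemidef) (hρ1 : ρ.trace = 1) :
    combingFidelity ρ 1 1 = 1 := by
  refine le_antisymm (combingFidelity_le_one one_pos one_pos hρ hρ1) ?_
  -- A test that always accepts, with `d = 1`, discards its input; the diagonal embedding serves
  -- both tests with the one system of Alice.
  let f : a → a × a := fun x => (x, x)
  have hf : Function.Injective f := fun _ _ h => congrArg Prod.fst h
  have h := (isPPTPreserving_ofChoi_doubleKernel hf (isRainsTest_one (α := a) (β := b))
    (isRainsTest_one (α := a) (β := c))).le_combingFidelity one_pos one_pos hρ hρ1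
  have e : eprFidelity (ofChoi (doubleKernel f 1 1 1 1) ρ) =
      (pairing ρ (lift f 1 1)).re :=
    eprFidelity_ofChoi_doubleKernel (isRainsTest_one (α := a) (β := b)) (isRainsTest_one (α := a) (β := c)) ρ
  rwa [e, lift_one_one hf, pairing_one, hρ1, Complex.one_re] at h

theorem combingSumRate_nonneg (hρ : ρ.PosSemidef) (hρ1 : ρ.trace = 1) : 0 ≤ combingSumRate ρ := by
  refine le_sSup ⟨0, 0, le_rfl, le_rfl, ?_, by simp⟩
  have h (n : ℕ) : combingFidelity (statePow ρ n) 1 1 = 1 :=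
    combingFidelity_one_one (posSemidef_statePow hρ n) (by rw [trace_statePow, hρ1, one_pow])
  simp [h]

/-- The rate obtained by distilling blocks of `n` copies with `L` noisy qubit pairs each, if a
fraction `1 / M` of the blocks may fail. -/
def blockRate (L : ℝ) (M n : ℕ) : ℝ := max 0 (((1 - 2 / M) * L - 2) / n)

/-- The factor `4 ^ k` costs two bits per block. In `2 / M`, one `1 / M` pays for the tolerated
failures and the other for the incomplete last block, which is affordable since `M ≤ k`. -/
theorem blockRate_size {r M n k N : ℕ} (hr : 0 < r) (hM : 2 ≤ M) (hn : 0 < n) (hk : M ≤ k)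
    (hN : N < (k + 1) * n) :
    ⌊(2 : ℝ) ^ ((N : ℝ) * blockRate (Real.logb 2 r) M n)⌋₊ = 1 ∨
      (⌊(2 : ℝ) ^ ((N : ℝ) * blockRate (Real.logb 2 r) M n)⌋₊ : ℝ) * 4 ^ k ≤
        (r : ℝ) ^ (k - k / M) := by
  set L := Real.logb 2 r with hL
  have hr1 : (1 : ℝ) ≤ r := by exact_mod_cast hr
  have hL0 : 0 ≤ L := Real.logb_nonneg one_lt_two hr1
  have hn0 : (0 : ℝ) < n := by exact_mod_cast hn
  have hM0 : (2 : ℝ) ≤ M := by exact_mod_cast hM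
  have hMpos : (0 : ℝ) < M := by linarith
  have hkM : (M : ℝ) ≤ k := by exact_mod_cast hk
  rcases le_or_gt (((1 - 2 / M) * L - 2) / n) 0 with h0 | h0
  · left
    rw [blockRate, max_eq_left h0]
    simp
  · right
    rw [blockRate, max_eq_right h0.le]
    have hNr : (N : ℝ) ≤ (k + 1) * n := by exact_mod_cast hN.le
    have hexp : (N : ℝ) * (((1 - 2 / M) * L - 2) / n) ≤ (k + 1) * ((1 - 2 / M) * L - 2) := by
      calc (N : ℝ) * (((1 - 2 / M) * L - 2) / n) ≤ ((k + 1) * n) * (((1 - 2 / M) * L - 2) / n) := by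
            gcongr
        _ = _ := by field_simp
    have ht : ((k / M : ℕ) : ℝ) ≤ k / M := Nat.cast_div_le
    have htk : k / M ≤ k := Nat.div_le_self _ _
    have hkey : (k + 1) * ((1 - 2 / M) * L - 2) + 2 * k ≤ L * ((k - k / M : ℕ) : ℝ) := by
      rw [Nat.cast_sub htk]
      have h1 : (k + 1 : ℝ) * (1 - 2 / M) ≤ k - k / M := by
        have h2 : (1 : ℝ) ≤ k / M := (one_le_div hMpos).2 hkM
        have h3 : (k + 1 : ℝ) * (1 - 2 / M) = k + 1 - 2 * (k / M) - 2 / M := by ring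
        have h4 : (0 : ℝ) ≤ 2 / M := by positivity
        rw [h3]
        linarith
      have h5 : L * (k - k / M) ≤ L * (k - ((k / M : ℕ) : ℝ)) := by gcongr
      have h6 : L * ((k + 1 : ℝ) * (1 - 2 / M)) ≤ L * (k - k / M) := by gcongr
      have h7 : (k + 1 : ℝ) * ((1 - 2 / M) * L - 2) + 2 * k =
        L * ((k + 1 : ℝ) * (1 - 2 / M)) - 2 := by ring
      rw [h7]
      linarith
    have hrL : (r : ℝ) = 2 ^ L := by
      rw [hL, Real.rpow_logb two_pos (by norm_num) (by linarith)]
    have h4 : (4 : ℝ) ^ k = 2 ^ (2 * k : ℝ) := by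
      rw [Real.rpow_mul zero_le_two, Real.rpow_natCast]
      norm_num
    calc (⌊(2 : ℝ) ^ ((N : ℝ) * (((1 - 2 / M) * L - 2) / n))⌋₊ : ℝ) * 4 ^ k
        ≤ 2 ^ ((N : ℝ) * (((1 - 2 / M) * L - 2) / n)) * 4 ^ k := by
          gcongr
          exact Nat.floor_le (by positivity)
      _ ≤ 2 ^ ((k + 1) * ((1 - 2 / M) * L - 2)) * 2 ^ (2 * k : ℝ) := by
          rw [h4]
          gcongr
          exact one_le_two
      _ = 2 ^ ((k + 1) * ((1 - 2 / M) * L - 2) + 2 * k) := by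
          rw [Real.rpow_add two_pos]
      _ ≤ 2 ^ (L * ((k - k / M : ℕ) : ℝ)) := Real.rpow_le_rpow_of_exponent_le one_le_two hkey
      _ = (r : ℝ) ^ (k - k / M) := by
          rw [Real.rpow_mul zero_le_two, ← hrL, Real.rpow_natCast]

/-- The `+ 1` compensates the rounding in `k / M`, so that `η ^ (k / M + 1) ≤ 4 ^ (-k)`, which
outweighs the `2 ^ k` patterns. -/
theorem failure_le {M k : ℕ} (hM : 0 < M) {η : ℝ} (hη0 : 0 ≤ η) (hη : η ≤ (1 / 4) ^ M) :
    2 ^ k * η ^ (k / M + 1) ≤ (1 / 2 : ℝ) ^ k := by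
  have hk : k ≤ M * (k / M + 1) := (Nat.lt_mul_div_succ k hM).le
  calc 2 ^ k * η ^ (k / M + 1) ≤ 2 ^ k * ((1 / 4) ^ M) ^ (k / M + 1) := by gcongr
    _ = 2 ^ k * (1 / 4) ^ (M * (k / M + 1)) := by rw [pow_mul]
    _ ≤ 2 ^ k * (1 / 4) ^ k := by
      gcongr 2 ^ k * ?_
      exact pow_le_pow_of_le_one (by norm_num) (by norm_num) hk
    _ = (1 / 2 : ℝ) ^ k := by
      rw [← mul_pow]
      norm_num

theorem floor_two_rpow_pos {x : ℝ} (hx : 0 ≤ x) : 0 < ⌊(2 : ℝ) ^ x⌋₊ :=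
  Nat.floor_pos.2 (Real.one_le_rpow one_le_two hx)

theorem tendsto_combingFidelity_blockRate (hρ : ρ.PosSemidef) (hρ1 : ρ.trace = 1)
    {r₁ r₂ M n : ℕ} (h₁ : 0 < r₁) (h₂ : 0 < r₂) (hM : 2 ≤ M) (hn : 0 < n) {η : ℝ} (hη0 : 0 ≤ η)
    (hηM : η ≤ (1 / 4) ^ M) (hη : 1 - η < combingFidelity (statePow ρ n) r₁ r₂) :
    Tendsto (fun N : ℕ => combingFidelity (statePow ρ N)
      ⌊(2 : ℝ) ^ ((N : ℝ) * blockRate (Real.logb 2 r₁) M n)⌋₊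
      ⌊(2 : ℝ) ^ ((N : ℝ) * blockRate (Real.logb 2 r₂) M n)⌋₊) atTop (𝓝 1) := by
  have hη1 : η ≤ 1 := hηM.trans (pow_le_one₀ (by norm_num) (by norm_num))
  have hpos (N r : ℕ) : 0 < ⌊(2 : ℝ) ^ ((N : ℝ) * blockRate (Real.logb 2 r) M n)⌋₊ :=
    floor_two_rpow_pos (mul_nonneg (Nat.cast_nonneg _) (le_max_left _ _))
  have hdiv : Tendsto (fun N : ℕ => N / n) atTop atTop := Nat.tendsto_div_const_atTop hn.ne'
  have hlow : Tendsto (fun N : ℕ => 1 - 2 * (1 / 2 : ℝ) ^ (N / n)) atTop (𝓝 1) := by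
    have := (tendsto_pow_atTop_nhds_zero_of_lt_one (r := (1 / 2 : ℝ)) (by norm_num)
      (by norm_num)).comp hdiv
    simpa using (this.const_mul 2).const_sub 1
  refine tendsto_of_tendsto_of_tendsto_of_le_of_le' hlow tendsto_const_nhds ?_ ?_
  · filter_upwards [hdiv.eventually_ge_atTop M] with N hN
    have hlt : N < (N / n + 1) * n := by
      rw [mul_comm]
      exact Nat.lt_mul_div_succ N hn
    refine le_trans ?_ (le_combingFidelity_blocks hρ hρ1 h₁ h₂ hη0 hη1 hη
      (Nat.div_mul_le_self N n) (Nat.div_le_self (N / n) M) (hpos N r₁) (hpos N r₂)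
      (blockRate_size h₁ hM hn hN hlt) (blockRate_size h₂ hM hn hN hlt))
    have := failure_le (k := N / n) (by omega : 0 < M) hη0 hηM
    linarith
  · exact Eventually.of_forall fun N => combingFidelity_le_one (hpos N r₁) (hpos N r₂)
      (posSemidef_statePow hρ N) (by rw [trace_statePow, hρ1, one_pow])

/-- If infinitely many block lengths allow combing at a rate above `s` with a small error, then every
rate below `s` is achievable with vanishing error. -/
theorem exists_le_combingSumRate (hρ : ρ.PosSemidef) (hρ1 : ρ.trace = 1) {s s' : ℝ} (hs' : 0 ≤ s')
    (hs : s' < s) :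
    ∃ ε₀ > 0, ∀ ε, 0 < ε → ε < ε₀ →
      (∃ᶠ n : ℕ in atTop, ∃ r₁ r₂ : ℕ, 0 < r₁ ∧ 0 < r₂ ∧
        1 - ε ≤ combingFidelity (statePow ρ n) r₁ r₂ ∧
        s * n < Real.logb 2 r₁ + Real.logb 2 r₂) →
      (s' : EReal) ≤ combingSumRate ρ := by
  have hss : 0 < s - s' := sub_pos.2 hs
  have hs0 : 0 < s := hs'.trans_lt hs
  -- This makes the loss `2 s / M` at most half of `s - s'`; block lengths `n ≥ 8 / (s - s')` do the
  -- same for the loss `4 / n`. As `M` depends only on `s` and `s'`, the threshold `ε₀` is fixed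
  -- before the block length.
  obtain ⟨M, hM⟩ := exists_nat_ge (max 2 (4 * s / (s - s')))
  have hM2 : (2 : ℝ) ≤ M := (le_max_left _ _).trans hM
  have hM2' : 2 ≤ M := by exact_mod_cast hM2
  have hMs : 2 / M * s ≤ (s - s') / 2 := by
    have h := (le_max_right _ _).trans hM
    rw [div_le_iff₀ hss] at h
    rw [div_mul_eq_mul_div, div_le_div_iff₀ (by linarith) two_pos]
    linarith
  refine ⟨(1 / 4) ^ M / 2, by positivity, fun ε hε hε₀ hf => ?_⟩
  obtain ⟨m, hm⟩ := exists_nat_ge (8 / (s - s'))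
  obtain ⟨n, ⟨r₁, r₂, h₁, h₂, hF, hlog⟩, hn⟩ :=
    (hf.and_eventually (eventually_ge_atTop (max 1 m))).exists
  have hn1 : 0 < n := (le_max_left _ _).trans hn
  have hn0 : (0 : ℝ) < n := by exact_mod_cast hn1
  have hnm : 8 / (s - s') ≤ n := hm.trans (by exact_mod_cast (le_max_right _ _).trans hn)
  -- Doubling `ε` turns `1 - ε ≤ F` into the strict inequality needed to pick an actual operation.
  have hlim := tendsto_combingFidelity_blockRate hρ hρ1 h₁ h₂ hM2' hn1 (η := 2 * ε) (by linarith)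
    (by linarith) (by linarith)
  refine le_trans ?_ (le_sSup ⟨_, _, le_max_left _ _, le_max_left _ _, hlim, rfl⟩)
  rw [EReal.coe_le_coe_iff]
  have hl (L : ℝ) : ((1 - 2 / M) * L - 2) / n ≤ blockRate L M n := le_max_right _ _
  have h3 : (0 : ℝ) ≤ 1 - 2 / M := sub_nonneg.2 ((div_le_one (by linarith)).2 hM2)
  have h4 : 4 / n ≤ (s - s') / 2 := by
    rw [div_le_iff₀ hss] at hnm
    rw [div_le_div_iff₀ hn0 two_pos]
    linarith
  calc s' ≤ (1 - 2 / M) * s - 4 / n := by linarith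
    _ = ((1 - 2 / M) * (s * n) - 4) / n := by field_simp
    _ ≤ ((1 - 2 / M) * (Real.logb 2 r₁ + Real.logb 2 r₂) - 4) / n := by gcongr
    _ = ((1 - 2 / M) * Real.logb 2 r₁ - 2) / n + ((1 - 2 / M) * Real.logb 2 r₂ - 2) / n := by ring
    _ ≤ _ := add_le_add (hl _) (hl _)

end Rates

/-! ### The asymptotic capacity -/

section Capacity

variable {a b c : Type*} [Fintype a] [Fintype b] [Fintype c]
    [DecidableEq a] [DecidableEq b] [DecidableEq c]
    {N : Matrix a a ℂ →ₗ[ℂ] Matrix (b × c) (b × c) ℂ}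

theorem sub_one_le_logb_floor {x : ℝ} (hx : 0 ≤ x) : x - 1 ≤ Real.logb 2 ⌊(2 : ℝ) ^ x⌋₊ := by
  have h1 : (1 : ℝ) ≤ (2 : ℝ) ^ x := Real.one_le_rpow one_le_two hx
  have hpos : (1 : ℝ) ≤ ⌊(2 : ℝ) ^ x⌋₊ := by exact_mod_cast floor_two_rpow_pos hx
  rw [Real.le_logb_iff_rpow_le one_lt_two (by linarith), Real.rpow_sub two_pos, Real.rpow_one]
  have := Nat.lt_floor_add_one ((2 : ℝ) ^ x)
  linarith

/-- Rounding the two dimensions down costs at most one bit each, hence the vanishing correction `2 /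
n`. -/
theorem combingSumRate_le_liminf
    (hF : ∀ n r₁ r₂ : ℕ, 0 < r₁ → 0 < r₂ →
      codeFidelity (channelPow N n) r₁ r₂ = combingFidelity (statePow (choiState N) n) r₁ r₂)
    {ε : ℝ} (hε : 0 < ε) :
    combingSumRate (choiState N) ≤
      liminf (fun n : ℕ => oneShotSumCapacity (channelPow N n) ε / (n : EReal)) atTop := by
  refine sSup_le ?_
  rintro _ ⟨R₁, R₂, hR₁, hR₂, hlim, rfl⟩
  have hreal : Tendsto (fun n : ℕ => R₁ + R₂ - 2 / (n : ℝ)) atTop (𝓝 (R₁ + R₂)) := by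
    simpa using (tendsto_const_div_atTop_nhds_zero_nat (2 : ℝ)).const_sub (R₁ + R₂)
  have hE : Tendsto (fun n : ℕ => ((R₁ + R₂ - 2 / (n : ℝ) : ℝ) : EReal)) atTop
      (𝓝 ((R₁ + R₂ : ℝ) : EReal)) := (continuous_coe_real_ereal.tendsto _).comp hreal
  rw [← hE.liminf_eq]
  refine liminf_le_liminf ?_
  filter_upwards [hlim.eventually (lt_mem_nhds (show 1 - ε < 1 by linarith)),
    eventually_gt_atTop 0] with n hn hn0
  have hn0' : (0 : ℝ) < n := by exact_mod_cast hn0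
  have p₁ : 0 ≤ (n : ℝ) * R₁ := by positivity
  have p₂ : 0 ≤ (n : ℝ) * R₂ := by positivity
  have hQ : ((Real.logb 2 ⌊(2 : ℝ) ^ ((n : ℝ) * R₁)⌋₊ + Real.logb 2 ⌊(2 : ℝ) ^ ((n : ℝ) * R₂)⌋₊ : ℝ) :
      EReal) ≤ oneShotSumCapacity (channelPow N n) ε :=
    le_sSup ⟨_, _, floor_two_rpow_pos p₁, floor_two_rpow_pos p₂,
      by rw [hF _ _ _ (floor_two_rpow_pos p₁) (floor_two_rpow_pos p₂)]; exact hn.le, rfl⟩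
  rw [EReal.le_div_iff_mul_le (by exact_mod_cast hn0) (EReal.natCast_ne_top n)]
  refine le_trans ?_ hQ
  have hcast : ((n : ℕ) : EReal) = ((n : ℝ) : EReal) := rfl
  rw [hcast, ← EReal.coe_mul, EReal.coe_le_coe_iff]
  have q₁ := sub_one_le_logb_floor p₁
  have q₂ := sub_one_le_logb_floor p₂
  have : (R₁ + R₂ - 2 / (n : ℝ)) * n = (n : ℝ) * R₁ + n * R₂ - 2 := by field_simp
  rw [this]
  linarith

theorem exists_limsup_le [Nonempty a] (hN : IsChannel N)
    (hF : ∀ n r₁ r₂ : ℕ, 0 < r₁ → 0 < r₂ →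
      codeFidelity (channelPow N n) r₁ r₂ = combingFidelity (statePow (choiState N) n) r₁ r₂)
    {q : EReal} (hq : combingSumRate (choiState N) < q) :
    ∃ ε₀ > 0, ∀ ε, 0 < ε → ε < ε₀ →
      limsup (fun n : ℕ => oneShotSumCapacity (channelPow N n) ε / (n : EReal)) atTop < q := by
  have hρ := hN.posSemidef_choiState
  have hρ1 := hN.trace_choiState
  -- If the upper limit exceeded `s`, then infinitely many block lengths would beat the rate `s`,
  -- and `s'` would be achievable, although it lies above the combing rate.
  obtain ⟨s', hs', hs'q⟩ := EReal.lt_iff_exists_real_btwn.1 hq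
  obtain ⟨s, hs, hsq⟩ := EReal.lt_iff_exists_real_btwn.1 hs'q
  have hs0 : 0 ≤ s' := by
    exact_mod_cast (combingSumRate_nonneg hρ hρ1).trans hs'.le
  obtain ⟨ε₀, hε₀, h⟩ := exists_le_combingSumRate hρ hρ1 hs0 (EReal.coe_lt_coe_iff.1 hs)
  refine ⟨ε₀, hε₀, fun ε hε hεε₀ => lt_of_le_of_lt (not_lt.1 fun hlt => ?_) hsq⟩
  refine absurd (h ε hε hεε₀ ?_) hs'.not_ge
  refine ((frequently_lt_of_lt_limsup (by isBoundedDefault) hlt).and_eventually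
    (eventually_gt_atTop 0)).mono fun n hn => ?_
  obtain ⟨hn, hn0⟩ := hn
  rw [EReal.lt_div_iff (by exact_mod_cast hn0) (EReal.natCast_ne_top n)] at hn
  obtain ⟨_, ⟨r₁, r₂, h₁, h₂, hfid, rfl⟩, hlt'⟩ := lt_sSup_iff.1 hn
  refine ⟨r₁, r₂, h₁, h₂, hF n r₁ r₂ h₁ h₂ ▸ hfid, ?_⟩
  have hcast : ((n : ℕ) : EReal) = ((n : ℝ) : EReal) := rfl
  rwa [hcast, ← EReal.coe_mul, EReal.coe_lt_coe_iff] at hlt'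

/-- The lower bound holds for every `ε > 0` already with the lower limit, the upper bound for small
`ε` even with the upper limit, which settles both readings. Simulability is used only through `hF`.
-/
theorem hasAsymptoticSumCapacity [Nonempty a] (hN : IsChannel N)
    (hF : ∀ n r₁ r₂ : ℕ, 0 < r₁ → 0 < r₂ →
      codeFidelity (channelPow N n) r₁ r₂ = combingFidelity (statePow (choiState N) n) r₁ r₂) :
    HasAsymptoticSumCapacity N (combingSumRate (choiState N)) := by
  have hlow {ε : ℝ} (hε : 0 < ε) := combingSumRate_le_liminf hF hε
  have hle (ε : ℝ) : liminf (fun n : ℕ => oneShotSumCapacity (channelPow N n) ε / (n : EReal))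
      atTop ≤ limsup (fun n : ℕ => oneShotSumCapacity (channelPow N n) ε / (n : EReal)) atTop :=
    liminf_le_limsup
  have hup {q : EReal} (hq : combingSumRate (choiState N) < q) : ∀ᶠ ε in 𝓝[>] (0 : ℝ),
      limsup (fun n : ℕ => oneShotSumCapacity (channelPow N n) ε / (n : EReal)) atTop < q := by
    obtain ⟨ε₀, hε₀, h⟩ := exists_limsup_le hN hF hq
    filter_upwards [Ioo_mem_nhdsGT hε₀] with ε hε
    exact h ε hε.1 hε.2
  refine ⟨tendsto_order.2 ⟨fun q hq => ?_, fun q hq => ?_⟩,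
    tendsto_order.2 ⟨fun q hq => ?_, fun q hq => hup hq⟩⟩
  · filter_upwards [self_mem_nhdsWithin] with ε hε
    exact hq.trans_le (hlow hε)
  · filter_upwards [hup hq] with ε hε
    exact (hle ε).trans_lt hε
  · filter_upwards [self_mem_nhdsWithin] with ε hε
    exact hq.trans_le ((hlow hε).trans (hle ε))

end Capacity

end

end BroadcastCode

theorem mainTheorem11 {a b c : Type*} [Fintype a] [Fintype b] [Fintype c]
    [DecidableEq a] [DecidableEq b] [DecidableEq c] [Nonempty a]
    (N : Matrix a a ℂ →ₗ[ℂ] Matrix (b × c) (b × c) ℂ) (hN : IsChannel N) :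
    (∀ r₁ r₂ : ℕ, 0 < r₁ → 0 < r₂ →
      (∀ Y : Matrix (a × b × c) (a × b × c) ℂ →ₗ[ℂ]
          Matrix ((Fin r₁ × Fin r₂) × Fin r₁ × Fin r₂) ((Fin r₁ × Fin r₂) × Fin r₁ × Fin r₂) ℂ,
        IsPPTPreserving Y →
          ∃ Z : ForwardAssistedCode a b c r₁ r₂,
            IsPPTPreserving Z.operation ∧ Z.fidelity N = eprFidelity (Y (choiState N))) ∧
      combingFidelity (choiState N) r₁ r₂ ≤ codeFidelity N r₁ r₂) ∧
    (IsTeleportationSimulable N →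
      (∀ r₁ r₂ : ℕ, 0 < r₁ → 0 < r₂ →
        (∀ Z : ForwardAssistedCode a b c r₁ r₂, IsPPTPreserving Z.operation →
          ∃ Y : Matrix (a × b × c) (a × b × c) ℂ →ₗ[ℂ]
              Matrix ((Fin r₁ × Fin r₂) × Fin r₁ × Fin r₂)
                ((Fin r₁ × Fin r₂) × Fin r₁ × Fin r₂) ℂ,
            IsPPTPreserving Y ∧ eprFidelity (Y (choiState N)) = Z.fidelity N) ∧
        codeFidelity N r₁ r₂ = combingFidelity (choiState N) r₁ r₂) ∧
      HasAsymptoticSumCapacity N (combingSumRate (choiState N))) := by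
  refine ⟨fun r₁ r₂ h₁ h₂ => ⟨fun Y hY => exists_code_of_combing h₁ h₂ N hY,
    combingFidelity_le_codeFidelity h₁ h₂ hN⟩, fun hsim => ?_⟩
  obtain ⟨K, hK⟩ := hsim.exists_isSimulationKernel
  refine ⟨fun r₁ r₂ h₁ h₂ => ⟨fun Z hZ => hK.exists_combing h₁ h₂ hZ, hK.codeFidelity_eq h₁ h₂⟩,
    hasAsymptoticSumCapacity hN fun n r₁ r₂ h₁ h₂ => ?_⟩
  have hKn := hK.pow n
  rw [← choiState_channelPow] at hKn ⊢
  exact hKn.codeFidelity_eq h₁ h₂
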